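/- **Setting.** Let $\mathbf R$ be an $m\times n$ matrix with entries in $\{0,1\}$ (rows are labels, columns are vertices), $L_\ell=\{v:\mathbf R_{\ell,v}=1\}$, and let $K^{(\ell)}$ be the complete graph on $L_\ell$. The weighted intersection graph $G(V,E,\mathbf R^T\mathbf R)$ is regarded as the multigraph $\bigcup^+_{\ell} K^{(\ell)}$. A label $\ell$ is *strong* if $|L_\ell|\ge 3$. For a choice of maximal matchings $M^{(\ell)}$ of $K^{(\ell)}$, $\ell\in[m]$, let $G^{(b)}=\bigcup^+_\ell M^{(\ell)}$, and let $\mathcal C_{odd}(G^{(b)})$ be the set of sequences $\sigma=v_1,\ell_1,v_2,\ell_2,\dots,v_k,\ell_k,v_{k+1}=v_1$ with $k$ odd, $v_1,\dots,v_k$ distinct vertices, $\ell_1,\dots,\ell_k$ distinct labels, $\{v_i,v_{i+1}\}\subseteq L_{\ell_i}$ and $v_i$ adjacent to $v_{i+1}$ in $G^{(b)}$ for all $i$, and at least one $\ell_i$ strong. The *Weak Bipartization Algorithm* first draws, for each $\ell$, a uniformly random maximal matching $M^{(\ell)}$ of $K^{(\ell)}$; then, while $\mathcal C_{odd}(G^{(b)})\neq\emptyset$,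 it selects some $\sigma\in\mathcal C_{odd}(G^{(b)})$ and a strong label $\ell$ of $\sigma$, and replaces $M^{(\ell)}$ by a new, independent, uniformly random maximal matching of $K^{(\ell)}$; when $\mathcal C_{odd}(G^{(b)})=\emptyset$ it returns $G^{(b)}$. Time is counted on a unit-cost random access machine (addition and truncated subtraction of natural numbers, variables, arrays, tests) that has $\mathbf R$ as incidence lists; drawing a random maximal matching of $K^{(\ell)}$ takes time $|L_\ell|+1$. An *implementation* is a program for this machine that carries out the algorithm on every input, for some way of making the selections. **Theorem.** Let $0<c<1$ be a constant, $m=n$, $p=c/n$, and let the entries of $\mathbf R$ be independent Bernoulli random variables with success probability $p$. "With high probability" (whp) means with probability tending to $1$ as $n\to\infty$. 1. For every implementation, and thus whichever selections it makes, and for every $\varepsilon>0$, whp over $\mathbf R$: the algorithm terminates on input $\mathbf R$ with probability $1$ over its random matchings, and with probability at least $1-\varepsilon$ over its random matchings it terminates after at most $\log n$ executions of the body of the while loop. 2. There are an implementation and, for each such $c$, a constant $C=C(c)$ such that, for every $\varepsilon>0$, whp over $\mathbf R$: the implementation terminates on input $\mathbf R$ with probability $1$ over its random matchings, and with probability at least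 $1-\varepsilon$ over its random matchings it terminates within time $C\,\bigl(n+\sum_{\ell\in[n]}|L_\ell|\bigr)\log n$. -/

import Mathlib

open MeasureTheory Filter Topology
open scoped ENNReal

noncomputable section

namespace WeakBip

/-! ### Weighted random intersection graphs -/

/-- A representation matrix with `m` labels and `n` vertices; `R ℓ v = true` means that vertex `v`
has chosen label `ℓ`. -/
abbrev RepMatrix (m n : ℕ) : Type := Fin m → Fin n → Bool

/-- The Bernoulli law with success probability `p`. -/
def entryLaw (p : ℝ) : Measure Bool :=
  ENNReal.ofReal p • Measure.dirac true + ENNReal.ofReal (1 - p) • Measure.dirac false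

/-- The law of a representation matrix with independent Bernoulli entries. -/
def matrixLaw (m n : ℕ) (p : ℝ) : Measure (RepMatrix m n) :=
  Measure.pi fun _ => Measure.pi fun _ => entryLaw p

variable {m n : ℕ}

/-- The set `L_ℓ` of the vertices that have chosen label `ℓ`. -/
def labelSet (R : RepMatrix m n) (ℓ : Fin m) : Finset (Fin n) :=
  Finset.univ.filter fun v => R ℓ v = true

/-- The number `∑_ℓ |L_ℓ|`. -/
def totalSize (R : RepMatrix m n) : ℕ := ∑ ℓ, (labelSet R ℓ).card

/-! ### Maximal matchings of the cliques -/

/-- `N` is a matching of the complete graph on the vertex set `S`. -/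
def IsMatchingOf (S : Finset (Fin n)) (N : Finset (Sym2 (Fin n))) : Prop :=
  (∀ e ∈ N, ¬ e.IsDiag ∧ ∀ v ∈ e, v ∈ S) ∧
    ∀ e ∈ N, ∀ f ∈ N, ∀ v, v ∈ e → v ∈ f → e = f

open Classical in
/-- The matchings of the complete graph on `S` that are maximal with respect to inclusion. -/
def maximalMatchings (S : Finset (Fin n)) : Finset (Finset (Sym2 (Fin n))) :=
  Finset.univ.filter fun N => Maximal (IsMatchingOf S) N

theorem maximalMatchings_nonempty (S : Finset (Fin n)) : (maximalMatchings S).Nonempty := by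
  have h0 : IsMatchingOf S (∅ : Finset (Sym2 (Fin n))) := by
    constructor <;> simp
  obtain ⟨N, -, hN⟩ :=
    (Set.toFinite {N : Finset (Sym2 (Fin n)) | IsMatchingOf S N}).exists_le_maximal h0
  exact ⟨N, by simpa [maximalMatchings] using hN⟩

/-- A uniformly random maximal matching of the complete graph on `S`. -/
def randomMatching (S : Finset (Fin n)) : PMF (Finset (Sym2 (Fin n))) :=
  PMF.uniformOfFinset (maximalMatchings S) (maximalMatchings_nonempty S)

/-! ### Closed vertex-label sequences -/

/-- An alternating sequence `v_0, ℓ_0, v_1, ℓ_1, …, ℓ_{k-1}, v_k` of vertices and labels. -/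
structure VLSeq (m n : ℕ) where
  size : ℕ
  vert : Fin (size + 1) → Fin n
  lab : Fin size → Fin m

/-- The sequence is a closed vertex-label sequence of the intersection graph. -/
def VLSeq.IsClosedIn (σ : VLSeq m n) (R : RepMatrix m n) : Prop :=
  σ.vert (Fin.last σ.size) = σ.vert 0 ∧
    ∀ i : Fin σ.size, σ.vert i.castSucc ∈ labelSet R (σ.lab i) ∧
      σ.vert i.succ ∈ labelSet R (σ.lab i)

/-- A label is strong if at least three vertices have chosen it. -/
def IsStrong (R : RepMatrix m n) (ℓ : Fin m) : Prop := 3 ≤ (labelSet R ℓ).card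

open Classical in
/-- The number `λ` for which the sequence is `λ`-strong. -/
def VLSeq.strength (σ : VLSeq m n) (R : RepMatrix m n) : ℕ :=
  (Finset.univ.filter fun i : Fin σ.size => IsStrong R (σ.lab i)).card

/-- The set `C_odd(G^(b))`, where the multigraph `G^(b)` is the union, with multiplicities, of the
edge sets `M ℓ`. -/
def codd (R : RepMatrix m n) (M : Fin m → Finset (Sym2 (Fin n))) : Set (VLSeq m n) :=
  {σ | σ.IsClosedIn R ∧ Odd σ.size ∧
    Function.Injective (fun i : Fin σ.size => σ.vert i.castSucc) ∧
    Function.Injective σ.lab ∧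
    (∀ i : Fin σ.size, ∃ ℓ, s(σ.vert i.castSucc, σ.vert i.succ) ∈ M ℓ) ∧
    0 < σ.strength R}

/-! ### A random access machine

The machine works on natural numbers, with finitely many variables and arrays occurring in a
program. It has the input `R` at hand as incidence lists, in both directions, and the current
matchings as the partner of each entry of these lists. Its only source of randomness is the command
that draws a new random maximal matching `M^(ℓ)`, which takes `|L_ℓ| + 1` units of time (as many
as the random choices and memory accesses, up to a constant factor, for pairing up the vertices of
`L_ℓ` at random). Any other command or test takes one unit; the expressions in it have a size that
is fixed by the program. -/

/-- The jagged arrays that a program can read but not write. -/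
inductive Table
  | size
  | member
  | degree
  | label
  | mate

/-- Expressions: constants, variables, array entries, table entries, sum, truncated difference. -/
inductive Expr
  | const (k : ℕ)
  | var (x : ℕ)
  | get (a : ℕ) (i : Expr)
  | table (t : Table) (i j : Expr)
  | add (e f : Expr)
  | sub (e f : Expr)

/-- Programs of the machine. -/
inductive Cmd
  | assign (x : ℕ) (e : Expr)
  | store (a : ℕ) (i e : Expr)
  | seq (c d : Cmd)
  | ite (e : Expr) (c d : Cmd)
  | loop (e : Expr) (c : Cmd)
  | draw (e : Expr)

/-- The vertices of `L_ℓ` in increasing order. -/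
def memberList (R : RepMatrix m n) (ℓ : Fin m) : List (Fin n) :=
  (List.finRange n).filter fun v => R ℓ v

/-- The labels chosen by the vertex `v` in increasing order. -/
def choiceList (R : RepMatrix m n) (v : Fin n) : List (Fin m) :=
  (List.finRange m).filter fun ℓ => R ℓ v

/-- The vertex that is matched to `v` in `N`, or `v` itself if `v` is not matched. -/
def partner (N : Finset (Sym2 (Fin n))) (v : Fin n) : Fin n :=
  ((List.finRange n).find? fun w => decide (s(v, w) ∈ N)).getD v

/-- The contents of the tables, with value `0` outside their range:
`size ℓ _ = |L_ℓ|`, `member ℓ j` is the `j`-th vertex of `L_ℓ`, `degree v _` is the number of labels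
chosen by `v`, `label v j` is the `j`-th of them, and `mate ℓ j` is the partner in `M^(ℓ)` of the
`j`-th vertex of `L_ℓ`. -/
def tableValue (R : RepMatrix m n) (M : Fin m → Finset (Sym2 (Fin n))) : Table → ℕ → ℕ → ℕ
  | .size, i, _ => if h : i < m then (memberList R ⟨i, h⟩).length else 0
  | .member, i, j =>
      if h : i < m then (((memberList R ⟨i, h⟩)[j]?).map fun v => (v : ℕ)).getD 0 else 0
  | .degree, i, _ => if h : i < n then (choiceList R ⟨i, h⟩).length else 0
  | .label, i, j =>
      if h : i < n then (((choiceList R ⟨i, h⟩)[j]?).map fun ℓ => (ℓ : ℕ)).getD 0 else 0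
  | .mate, i, j =>
      if h : i < m then
        (((memberList R ⟨i, h⟩)[j]?).map fun v => (partner (M ⟨i, h⟩) v : ℕ)).getD 0
      else 0

/-- A configuration of the machine: the commands still to be executed, the contents of the variables
and of the arrays, the labels whose matching has been drawn at least once, the current matchings,
the number of repeated draws (executions of the body of the while loop), and the time spent. -/
structure Config (m n : ℕ) where
  stack : List Cmd
  vars : ℕ → ℕ
  arrs : ℕ → ℕ → ℕ
  drawn : Finset (Fin m)
  matching : Fin m → Finset (Sym2 (Fin n))
  rounds : ℕ
  time : ℕ

/-- The value of an expression in a configuration. -/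
def Config.eval (R : RepMatrix m n) (s : Config m n) : Expr → ℕ
  | .const k => k
  | .var x => s.vars x
  | .get a i => s.arrs a (s.eval R i)
  | .table t i j => tableValue R s.matching t (s.eval R i) (s.eval R j)
  | .add e f => s.eval R e + s.eval R f
  | .sub e f => s.eval R e - s.eval R f

/-- The effect of replacing the matching of label `ℓ` by `N`, with `rest` still to be executed. -/
def Config.redraw (R : RepMatrix m n) (s : Config m n) (rest : List Cmd) (ℓ : Fin m)
    (N : Finset (Sym2 (Fin n))) : Config m n :=
  { s with
    stack := rest
    drawn := insert ℓ s.drawn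
    matching := Function.update s.matching ℓ N
    rounds := if ℓ ∈ s.drawn then s.rounds + 1 else s.rounds
    time := s.time + (labelSet R ℓ).card + 1 }

/-- One step of the machine; a configuration with no command left has halted. A test succeeds if its
value is not `0`. -/
def step (R : RepMatrix m n) (s : Config m n) : PMF (Config m n) :=
  match s.stack with
  | [] => PMF.pure s
  | .assign x e :: rest =>
      PMF.pure { s with
        stack := rest, time := s.time + 1, vars := Function.update s.vars x (s.eval R e) }
  | .store a i e :: rest =>
      PMF.pure { s with
        stack := rest
        time := s.time + 1
        arrs := Function.update s.arrs a
          (Function.update (s.arrs a) (s.eval R i) (s.eval R e)) }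
  | .seq c d :: rest => PMF.pure { s with stack := c :: d :: rest, time := s.time + 1 }
  | .ite e c d :: rest =>
      PMF.pure { s with
        stack := (if s.eval R e ≠ 0 then c else d) :: rest, time := s.time + 1 }
  | .loop e c :: rest =>
      PMF.pure { s with
        stack := if s.eval R e ≠ 0 then c :: .loop e c :: rest else rest, time := s.time + 1 }
  | .draw e :: rest =>
      if h : s.eval R e < m then
        (randomMatching (labelSet R ⟨s.eval R e, h⟩)).map (s.redraw R rest ⟨s.eval R e, h⟩)
      else PMF.pure { s with stack := rest, time := s.time + 1 }

/-- The initial configuration of a program: the variables `0` and `1` hold the numbers of labels and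
of vertices, the rest of the memory is `0`, and no matching has been drawn. -/
def start (P : Cmd) (m n : ℕ) : Config m n where
  stack := [P]
  vars := fun x => if x = 0 then m else if x = 1 then n else 0
  arrs := fun _ _ => 0
  drawn := ∅
  matching := fun _ => ∅
  rounds := 0
  time := 0

/-- The law of the configuration that is reached from `s` after `t` steps. -/
def runFrom (R : RepMatrix m n) (s : Config m n) : ℕ → PMF (Config m n)
  | 0 => PMF.pure s
  | t + 1 => (runFrom R s t).bind (step R)

/-- The law of the configuration of the program `P` on input `R` after `t` steps. -/
def run (R : RepMatrix m n) (P : Cmd) (t : ℕ) : PMF (Config m n) := runFrom R (start P m n) t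

/-- The configuration `s` occurs with positive probability when `P` runs on input `R`. -/
def Reachable (R : RepMatrix m n) (P : Cmd) (s : Config m n) : Prop := ∃ t, s ∈ (run R P t).support

/-- A draw for label `ℓ` is allowed in the configuration `s`: either the matching of `ℓ` is drawn for
the first time, or all matchings have been drawn and `ℓ` is a strong label of some sequence in
`C_odd(G^(b))`. -/
def MayDraw (R : RepMatrix m n) (s : Config m n) (ℓ : Fin m) : Prop :=
  ℓ ∉ s.drawn ∨
    (s.drawn = Finset.univ ∧ IsStrong R ℓ ∧
      ∃ σ ∈ codd R s.matching, ∃ i : Fin σ.size, σ.lab i = ℓ)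

/-- The program implements the Weak Bipartization Algorithm: on every input, each draw that it makes
is one that the algorithm makes, it halts only when all matchings have been drawn and
`C_odd(G^(b))` is empty, and it always reaches the next draw or halts after finitely many steps. -/
structure Implements (P : Cmd) : Prop where
  draws : ∀ (m n : ℕ) (R : RepMatrix m n) (s : Config m n), Reachable R P s →
    ∀ e rest, s.stack = .draw e :: rest →
      ∃ h : s.eval R e < m, MayDraw R s ⟨s.eval R e, h⟩
  halts : ∀ (m n : ℕ) (R : RepMatrix m n) (s : Config m n), Reachable R P s →
    s.stack = [] → s.drawn = Finset.univ ∧ codd R s.matching = ∅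
  progress : ∀ (m n : ℕ) (R : RepMatrix m n) (s : Config m n), Reachable R P s →
    ∃ t, ∃ s' ∈ (runFrom R s t).support,
      s'.stack = [] ∨ ∃ e rest, s'.stack = .draw e :: rest

/-- The probability, over the random matchings, that `P` on input `R` halts within time `T`.
Each step takes at least one unit of time, so it is enough to look at the configuration after
`T` steps. -/
def haltProb (R : RepMatrix m n) (P : Cmd) (T : ℕ) : ℝ≥0∞ :=
  (run R P T).toOuterMeasure {s | s.stack = [] ∧ s.time ≤ T}

/-- The probability, over the random matchings, that `P` on input `R` ever halts. -/
def terminationProb (R : RepMatrix m n) (P : Cmd) : ℝ≥0∞ := ⨆ T, haltProb R P T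

/-- The probability, over the random matchings, that `P` on input `R` halts after at most `K`
executions of the body of the while loop. -/
def haltRoundsProb (R : RepMatrix m n) (P : Cmd) (K : ℕ) : ℝ≥0∞ :=
  ⨆ t, (run R P t).toOuterMeasure {s | s.stack = [] ∧ s.rounds ≤ K}

end WeakBip

end

noncomputable section

namespace WeakBip

/-! ### Subgraphs of minimum degree two -/

section Core

variable {α : Type*} {G : SimpleGraph α}

/-! `R` is the bipartite incidence graph `incGraph R` of labels and vertices, in which each
label-vertex pair is an edge with probability c/n. As c < 1 this graph is subcritical, and union
bounds over paths describe it. A path on r + 1 nodes occurs with probability at most 2n·c^r, so whp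
all paths have length O(log n) (`matrixLaw_long_path_le`). A path with a chord at either end has one
edge more than nodes, so whp there is none (`matrixLaw_badPath_le`). Every element of the 2-core
ends a path with one chord, which has as many edges as nodes, so the 2-core has bounded expected
size (`sum_mem_core_le`). Without bad paths the 2-core is 2-regular (`core_two_regular`).

Number of rounds: a sequence in `codd` is a cycle of the incidence graph and lies in the 2-core. By
2-regularity, two such cycles that share a label have the same labels and use the same edge at that
label. Hence redrawing a label of a bad cycle creates no new bad label set, and it removes the label
set of this cycle unless the new matching contains one particular edge (`badSets_update_subset`).
For a strong label this has probability at most 1/2, by a swap of two vertices. So the number of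
rounds plus twice the number of bad label sets does not increase in expectation
(`Implements.expect_step_potential_le`), whatever selections are made. Markov's inequality bounds
the probability of more than K rounds by 2^(b + 1)/(K + 1), with b the size of the 2-core. A fixed
K, hence also log n for large n, is enough for any ε, and K → ∞ gives termination with probability
1.

Running time: the program `prog` peels off nodes of degree less than two. A round of peeling is
linear in the input, and each effective round lengthens a path, so there are O(log n) rounds
(`peelDepth_le`). What remains is the 2-core, with N elements. After drawing all matchings, the
program tries all sequences of elements of the 2-core by brute force, in time `inputSize R * tPos
N`, before each round. Since N and the number of rounds are bounded with probability close to 1, the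
searches cost a constant times the input size. For large n this constant is below log n, so C
depends on c only. -/

/-- Every element of `S` has at least two neighbours in `S`. -/
def MinTwo (G : SimpleGraph α) (S : Set α) : Prop :=
  ∀ y ∈ S, ∃ a ∈ S, ∃ b ∈ S, a ≠ b ∧ G.Adj y a ∧ G.Adj y b

/-- The 2-core of a graph. -/
def core (G : SimpleGraph α) : Set α := {x | ∃ S, x ∈ S ∧ MinTwo G S}

theorem MinTwo.subset_core {S : Set α} (h : MinTwo G S) : S ⊆ core G := fun _ hx => ⟨S, hx, h⟩

theorem minTwo_core (G : SimpleGraph α) : MinTwo G (core G) := by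
  rintro y ⟨S, hy, hS⟩
  obtain ⟨a, ha, b, hb, h⟩ := hS y hy
  exact ⟨a, hS.subset_core ha, b, hS.subset_core hb, h⟩

/-- A path whose two ends are joined to the path by two further edges. -/
def BadPath (G : SimpleGraph α) (l : List α) : Prop :=
  l.Nodup ∧ l.IsChain G.Adj ∧ ∃ (i j : ℕ) (hi : i < l.length) (hj : j + 2 < l.length),
    2 ≤ i ∧ (j ≠ 0 ∨ i + 1 < l.length) ∧ G.Adj l[0] l[i] ∧ G.Adj l[l.length - 1] l[j]

/-- A path whose head is joined to the path by a further edge. -/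
def Lasso (G : SimpleGraph α) (l : List α) : Prop :=
  l.Nodup ∧ l.IsChain G.Adj ∧ ∃ (i : ℕ) (hi : i < l.length), 2 ≤ i ∧ G.Adj l[0] l[i]

/-- Prolong the path at its head while the head has a neighbour in `S` off the path. In a finite
graph this stops, and then both neighbours of the head lie on the path, one of them beyond the
second position. -/
theorem MinTwo.exists_extension [Finite α] {S : Set α} (hS : MinTwo G S) (l : List α)
    (hne : l ≠ []) (hnd : l.Nodup) (hch : l.IsChain G.Adj) (hl : ∀ x ∈ l, x ∈ S) :
    ∃ l', Lasso G (l' ++ l) ∧ ∀ x ∈ l' ++ l, x ∈ S := by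
  have := Fintype.ofFinite α
  induction hk : Fintype.card α - l.length using Nat.strong_induction_on generalizing l with
  | _ k ih =>
    obtain ⟨z, t, rfl⟩ := List.exists_cons_of_ne_nil hne
    by_cases hz : ∃ y ∈ S, G.Adj z y ∧ y ∉ z :: t
    · obtain ⟨y, hyS, hzy, hy⟩ := hz
      have hnd' : (y :: z :: t).Nodup := List.nodup_cons.2 ⟨hy, hnd⟩
      have hlen : (y :: z :: t).length ≤ Fintype.card α := hnd'.length_le_card
      obtain ⟨l', h'⟩ := ih (Fintype.card α - (y :: z :: t).length)
        (by simp only [List.length_cons] at *; omega) (y :: z :: t) (by simp) hnd'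
        (List.isChain_cons_cons.2 ⟨hzy.symm, hch⟩) (by
          intro x hx
          rcases List.mem_cons.1 hx with rfl | hx
          · exact hyS
          · exact hl x hx) rfl
      exact ⟨l' ++ [y], by simpa using h'⟩
    · push Not at hz
      refine ⟨[], ⟨hnd, hch, ?_⟩, hl⟩
      obtain ⟨a, ha, b, hb, hab, hza, hzb⟩ := hS z (hl z (by simp))
      -- Of two distinct neighbours, at most one is the next vertex of the path.
      obtain ⟨y, hyS, hzy, hy1⟩ : ∃ y ∈ S, G.Adj z y ∧ t.head? ≠ some y := by
        by_cases h : t.head? = some a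
        · exact ⟨b, hb, hzb, by rw [h]; simpa using hab⟩
        · exact ⟨a, ha, hza, h⟩
      obtain ⟨i, hi, hiy⟩ := List.getElem_of_mem (hz y hyS hzy)
      refine ⟨i, hi, ?_, by simpa [hiy] using hzy⟩
      rcases i with _ | _ | i
      · exact absurd (by simpa using hiy) hzy.ne
      · exfalso
        apply hy1
        cases t with
        | nil => simp at hi
        | cons u t => simpa using hiy
      · omega

/-- The path grows at its head only, so `x` stays at its end and can be read off from the lasso.
This makes it possible to count core elements by lassos. -/
theorem exists_lasso [Finite α] {x : α} (hx : x ∈ core G) :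
    ∃ l, Lasso G l ∧ l.getLast? = some x := by
  obtain ⟨l', h, -⟩ := (minTwo_core G).exists_extension [x] (by simp) (by simp) (by simp)
    (by simpa using hx)
  exact ⟨_, h, by simp⟩

/-- The 2-core of a graph without bad paths is 2-regular. -/
theorem core_two_regular [Finite α] (hG : ∀ l, ¬ BadPath G l) {x a b c : α}
    (hx : x ∈ core G) (ha : a ∈ core G) (hb : b ∈ core G) (hc : c ∈ core G)
    (hxa : G.Adj x a) (hxb : G.Adj x b) (hxc : G.Adj x c) : a = b ∨ a = c ∨ b = c := by
  by_contra! hne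
  obtain ⟨hab, hac, hbc⟩ := hne
  obtain ⟨l', ⟨hnd, hch, i, hi, hi2, hadj⟩, hmem⟩ := (minTwo_core G).exists_extension [x]
    (by simp) (by simp) (by simp) (by simpa using hx)
  -- Read backwards, the path starts at `x` and has a chord at its far end. A third neighbour of `x`
  -- provides the chord at the near end.
  obtain ⟨L, hL⟩ : ∃ L, (l' ++ [x]).reverse = L := ⟨_, rfl⟩
  have hL' : L = x :: l'.reverse := by simp [← hL]
  rw [← List.nodup_reverse, hL] at hnd
  rw [← G.symm.flip_eq, ← List.isChain_reverse, hL] at hch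
  have hlen : L.length = (l' ++ [x]).length := by simp [← hL]
  have hmemL : ∀ z ∈ L, z ∈ core G := fun z hz =>
    hmem z (by rw [← hL] at hz; exact List.mem_reverse.1 hz)
  obtain ⟨j, hj, hlast⟩ : ∃ (j : ℕ) (hj : j + 2 < L.length), G.Adj L[L.length - 1] L[j] := by
    refine ⟨L.length - 1 - i, by omega, ?_⟩
    have e1 : L[L.length - 1] = (l' ++ [x])[0] := by
      simp only [← hL, List.getElem_reverse, List.length_reverse]
      congr 1
      omega
    have e2 : L[L.length - 1 - i] = (l' ++ [x])[i] := by
      simp only [← hL, List.getElem_reverse]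
      congr 1
      simp at hi hlen ⊢; omega
    rw [e1, e2]; exact hadj
  have h0 : L[0] = x := by simp [hL']
  -- One of the three neighbours avoids the second vertex of the path and, if the far chord already
  -- leads to `x`, the last vertex too. So the new edge differs from the path edges and from the far
  -- chord.
  obtain ⟨y, hy, hxy, hy1, hyj⟩ : ∃ y ∈ core G, G.Adj x y ∧ y ≠ L[1] ∧
      (j ≠ 0 ∨ y ≠ L[L.length - 1]) := by
    by_cases hj0 : j = 0
    · by_cases ha1 : a = L[1] ∨ a = L[L.length - 1]
      · by_cases hb1 : b = L[1] ∨ b = L[L.length - 1]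
        · refine ⟨c, hc, hxc, ?_, Or.inr ?_⟩ <;> rintro rfl <;> grind
        · exact ⟨b, hb, hxb, by tauto, by tauto⟩
      · exact ⟨a, ha, hxa, by tauto, by tauto⟩
    · by_cases ha1 : a = L[1]
      · exact ⟨b, hb, hxb, by grind, Or.inl hj0⟩
      · exact ⟨a, ha, hxa, ha1, Or.inl hj0⟩
  by_cases hyL : y ∈ L
  · obtain ⟨k, hk, rfl⟩ := List.getElem_of_mem hyL
    refine hG L ⟨hnd, hch, k, j, hk, hj, ?_, ?_, by rwa [h0], hlast⟩
    · rcases k with _ | _ | k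
      · exact absurd h0.symm hxy.ne
      · exact absurd rfl hy1
      · omega
    · by_contra! h
      rcases hyj with h' | h'
      · exact h' h.1
      · apply h'; congr 1; omega
  -- If `y` is off the path, prolong the path beyond `y` until its new head has a chord. The far
  -- chord persists, with its index shifted and hence nonzero.
  · obtain ⟨l2, ⟨hnd2, hch2, k, hk, hk2, hadj2⟩, -⟩ := (minTwo_core G).exists_extension (y :: L)
      (by simp) (List.nodup_cons.2 ⟨hyL, hnd⟩)
      (by rw [hL'] at hch ⊢; exact List.isChain_cons_cons.2 ⟨hxy.symm, hch⟩)
      (by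
        intro z hz
        rcases List.mem_cons.1 hz with rfl | hz
        · exact hy
        · exact hmemL z hz)
    have e1 : (l2 ++ y :: L)[(l2 ++ y :: L).length - 1]'(by simp) = L[L.length - 1] := by
      rw [List.getElem_append_right (by simp)]
      simp only [List.length_append, List.length_cons]
      rw [List.getElem_cons, dif_neg (by omega)]
      congr 1; omega
    have e2 : (l2 ++ y :: L)[l2.length + 1 + j]'(by simp; omega) = L[j] := by
      rw [List.getElem_append_right (by omega), List.getElem_cons, dif_neg (by omega)]
      congr 1; omega
    refine hG _ ⟨hnd2, hch2, k, l2.length + 1 + j, hk, by simp; omega, hk2, Or.inl (by omega),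
      hadj2, ?_⟩
    rw [e1, e2]; exact hlast

end Core

/-! ### The incidence graph and its peeling -/

section Peeling

variable {m n : ℕ}

/-- The bipartite incidence graph of labels and vertices. -/
def incGraph (R : RepMatrix m n) : SimpleGraph (Fin m ⊕ Fin n) where
  Adj
    | .inl ℓ, .inr v => R ℓ v = true
    | .inr v, .inl ℓ => R ℓ v = true
    | _, _ => False
  symm := by
    constructor
    rintro (a | a) (b | b) h <;> exact h
  loopless := by
    constructor
    rintro (a | a) h <;> exact h

@[simp] theorem incGraph_inl_inr (R : RepMatrix m n) (ℓ : Fin m) (v : Fin n) :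
    (incGraph R).Adj (.inl ℓ) (.inr v) ↔ R ℓ v = true := Iff.rfl

@[simp] theorem incGraph_inr_inl (R : RepMatrix m n) (ℓ : Fin m) (v : Fin n) :
    (incGraph R).Adj (.inr v) (.inl ℓ) ↔ R ℓ v = true := Iff.rfl

@[simp] theorem incGraph_inl_inl (R : RepMatrix m n) (ℓ ℓ' : Fin m) :
    ¬ (incGraph R).Adj (.inl ℓ) (.inl ℓ') := id

@[simp] theorem incGraph_inr_inr (R : RepMatrix m n) (v v' : Fin n) :
    ¬ (incGraph R).Adj (.inr v) (.inr v') := id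

/-- The labels with at least two vertices in `A`. -/
def keepL (R : RepMatrix m n) (A : Finset (Fin n)) : Finset (Fin m) :=
  Finset.univ.filter fun ℓ => 2 ≤ (A.filter fun v => R ℓ v = true).card

/-- The vertices with at least two labels in `B`. -/
def keepV (R : RepMatrix m n) (B : Finset (Fin m)) : Finset (Fin n) :=
  Finset.univ.filter fun v => 2 ≤ (B.filter fun ℓ => R ℓ v = true).card

theorem mem_keepL {R : RepMatrix m n} {A : Finset (Fin n)} {ℓ : Fin m} :
    ℓ ∈ keepL R A ↔ 2 ≤ (A.filter fun v => R ℓ v = true).card := by simp [keepL]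

theorem mem_keepV {R : RepMatrix m n} {B : Finset (Fin m)} {v : Fin n} :
    v ∈ keepV R B ↔ 2 ≤ (B.filter fun ℓ => R ℓ v = true).card := by simp [keepV]

/-- The vertices that are left after `t` rounds of peeling. -/
def aliveV (R : RepMatrix m n) : ℕ → Finset (Fin n)
  | 0 => Finset.univ
  | t + 1 => keepV R (keepL R (aliveV R t))

theorem keepL_mono (R : RepMatrix m n) {A A' : Finset (Fin n)} (h : A ⊆ A') :
    keepL R A ⊆ keepL R A' := by
  intro ℓ hℓ
  rw [mem_keepL] at hℓ ⊢
  exact hℓ.trans (Finset.card_le_card (Finset.filter_subset_filter _ h))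

theorem keepV_mono (R : RepMatrix m n) {B B' : Finset (Fin m)} (h : B ⊆ B') :
    keepV R B ⊆ keepV R B' := by
  intro ℓ hℓ
  rw [mem_keepV] at hℓ ⊢
  exact hℓ.trans (Finset.card_le_card (Finset.filter_subset_filter _ h))

theorem aliveV_succ_subset (R : RepMatrix m n) (t : ℕ) : aliveV R (t + 1) ⊆ aliveV R t := by
  induction t with
  | zero => exact Finset.subset_univ _
  | succ t ih => exact keepV_mono R (keepL_mono R ih)

/-- A vertex goes in a given round because one of its labels has just gone, and the label because
one of its vertices went one round before; this chain of causes is a path. The last two clauses say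
that everything further down the path went earlier, which makes the nodes distinct. -/
theorem exists_path_of_peeled (R : RepMatrix m n) (t : ℕ) (v : Fin n) (hv : v ∈ aliveV R t)
    (hv' : v ∉ aliveV R (t + 1)) :
    ∃ l : List (Fin m ⊕ Fin n), (Sum.inr v :: l).Nodup ∧
      (Sum.inr v :: l).IsChain (incGraph R).Adj ∧ l.length = 2 * t ∧
      (∀ v', Sum.inr v' ∈ Sum.inr v :: l → v' ∉ aliveV R (t + 1)) ∧
      ∀ ℓ, Sum.inl ℓ ∈ Sum.inr v :: l → ℓ ∉ keepL R (aliveV R t) := by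
  induction t generalizing v with
  | zero => exact ⟨[], by simp, by simp, by simp, by simpa using hv', by simp⟩
  | succ t ih =>
    obtain ⟨ℓ, hℓ, hℓ', hℓv⟩ : ∃ ℓ ∈ keepL R (aliveV R t), ℓ ∉ keepL R (aliveV R (t + 1)) ∧
        R ℓ v = true := by
      by_contra! h
      apply hv'
      refine mem_keepV.2 ((mem_keepV.1 hv).trans (Finset.card_le_card fun ℓ hℓ => ?_))
      rw [Finset.mem_filter] at hℓ ⊢
      refine ⟨?_, hℓ.2⟩
      by_contra h'
      exact h ℓ hℓ.1 h' hℓ.2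
    obtain ⟨w, hw, hw', hℓw⟩ : ∃ w ∈ aliveV R t, w ∉ aliveV R (t + 1) ∧ R ℓ w = true := by
      by_contra! h
      apply hℓ'
      rw [mem_keepL] at hℓ ⊢
      refine hℓ.trans (Finset.card_le_card fun w hw => ?_)
      rw [Finset.mem_filter] at hw ⊢
      refine ⟨?_, hw.2⟩
      by_contra h'
      exact h w hw.1 h' hw.2
    obtain ⟨l, hnd, hch, hlen, hV, hL⟩ := ih w hw hw'
    refine ⟨Sum.inl ℓ :: Sum.inr w :: l, ?_, ?_, by simp [hlen]; ring, ?_, ?_⟩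
    · refine List.nodup_cons.2 ⟨?_, List.nodup_cons.2 ⟨fun h => hL ℓ h hℓ, hnd⟩⟩
      intro h
      rcases List.mem_cons.1 h with h | h
      · cases h
      · exact hV v h hv
    · exact List.isChain_cons_cons.2 ⟨hℓv, List.isChain_cons_cons.2 ⟨hℓw, hch⟩⟩
    · intro v' h hmem
      rcases List.mem_cons.1 h with h | h
      · cases h; exact hv' hmem
      rcases List.mem_cons.1 h with h | h
      · cases h
      · exact hV v' h (aliveV_succ_subset R _ hmem)
    · intro ℓ₁ h hmem
      rcases List.mem_cons.1 h with h | h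
      · cases h
      rcases List.mem_cons.1 h with h | h
      · cases h; exact hℓ' hmem
      · exact hL ℓ₁ h (keepL_mono R (aliveV_succ_subset R _) hmem)

theorem two_le_card_filter_of_ne {β : Type*} {s : Finset β} {q : β → Prop} [DecidablePred q]
    {a b : β} (hab : a ≠ b) (ha : a ∈ s) (hb : b ∈ s) (hqa : q a) (hqb : q b) :
    2 ≤ (s.filter q).card :=
  Finset.one_lt_card.2 ⟨a, Finset.mem_filter.2 ⟨ha, hqa⟩, b, Finset.mem_filter.2 ⟨hb, hqb⟩, hab⟩

theorem inl_mem_core_keepL {R : RepMatrix m n} {A : Finset (Fin n)}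
    (hA : ∀ v, Sum.inr v ∈ core (incGraph R) → v ∈ A) {ℓ : Fin m}
    (hℓ : Sum.inl ℓ ∈ core (incGraph R)) : ℓ ∈ keepL R A := by
  obtain ⟨a, ha, b, hb, hab, h1, h2⟩ := minTwo_core _ _ hℓ
  rcases a with a | a
  · exact absurd h1 (by simp)
  rcases b with b | b
  · exact absurd h2 (by simp)
  rw [mem_keepL]
  exact two_le_card_filter_of_ne (a := a) (b := b) (by rintro rfl; exact hab rfl)
    (hA a ha) (hA b hb) h1 h2

theorem inr_mem_core_keepV {R : RepMatrix m n} {B : Finset (Fin m)}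
    (hB : ∀ ℓ, Sum.inl ℓ ∈ core (incGraph R) → ℓ ∈ B) {v : Fin n}
    (hv : Sum.inr v ∈ core (incGraph R)) : v ∈ keepV R B := by
  obtain ⟨a, ha, b, hb, hab, h1, h2⟩ := minTwo_core _ _ hv
  rcases a with a | a
  swap
  · exact absurd h1 (by simp)
  rcases b with b | b
  swap
  · exact absurd h2 (by simp)
  rw [mem_keepV]
  exact two_le_card_filter_of_ne (a := a) (b := b) (by rintro rfl; exact hab rfl)
    (hB a ha) (hB b hb) h1 h2

theorem mem_aliveV_of_mem_core {R : RepMatrix m n} (t : ℕ) {v : Fin n}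
    (hv : Sum.inr v ∈ core (incGraph R)) : v ∈ aliveV R t := by
  induction t generalizing v with
  | zero => exact Finset.mem_univ _
  | succ t ih => exact inr_mem_core_keepV (fun ℓ hℓ => inl_mem_core_keepL (fun v hv => ih hv) hℓ) hv

/-- When the peeling becomes stationary, the 2-core is left. -/
theorem mem_core_of_stable {R : RepMatrix m n} {A : Finset (Fin n)}
    (hA : keepV R (keepL R A) = A) :
    (∀ v ∈ A, Sum.inr v ∈ core (incGraph R)) ∧
      ∀ ℓ ∈ keepL R A, Sum.inl ℓ ∈ core (incGraph R) := by
  have key : MinTwo (incGraph R) {x | Sum.elim (· ∈ keepL R A) (· ∈ A) x} := by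
    rintro (ℓ | v) h
    · obtain ⟨a, ha, b, hb, hab⟩ := Finset.one_lt_card.1 (mem_keepL.1 h)
      rw [Finset.mem_filter] at ha hb
      exact ⟨.inr a, ha.1, .inr b, hb.1, by simpa using hab, ha.2, hb.2⟩
    · have h' : v ∈ A := h
      rw [← hA] at h'
      rw [mem_keepV] at h'
      obtain ⟨a, ha, b, hb, hab⟩ := Finset.one_lt_card.1 h'
      rw [Finset.mem_filter] at ha hb
      exact ⟨.inl a, ha.1, .inl b, hb.1, by simpa using hab, ha.2, hb.2⟩
  exact ⟨fun v hv => key.subset_core hv, fun ℓ hℓ => key.subset_core hℓ⟩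

end Peeling

/-! ### First moments in the random incidence graph -/

section FirstMoment

variable {m n : ℕ}

theorem entryLaw_true (p : ℝ) : entryLaw p {true} = ENNReal.ofReal p := by
  simp [entryLaw]

theorem isProbabilityMeasure_entryLaw {p : ℝ} (h0 : 0 ≤ p) (h1 : p ≤ 1) :
    IsProbabilityMeasure (entryLaw p) := by
  constructor
  simp only [entryLaw, Measure.coe_add, Measure.coe_smul, Pi.add_apply, Pi.smul_apply,
    measure_univ, smul_eq_mul, mul_one]
  rw [← ENNReal.ofReal_add h0 (by linarith)]
  simp

theorem isProbabilityMeasure_matrixLaw {p : ℝ} (h0 : 0 ≤ p) (h1 : p ≤ 1) :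
    IsProbabilityMeasure (matrixLaw m n p) := by
  have := isProbabilityMeasure_entryLaw h0 h1
  unfold matrixLaw
  infer_instance

/-- The event is a box of the product measure, with a factor `p` for each prescribed entry and a
factor 1 for each other one. -/
theorem matrixLaw_entries {p : ℝ} (h0 : 0 ≤ p) (h1 : p ≤ 1) (E : Finset (Fin m × Fin n)) :
    matrixLaw m n p {R | ∀ e ∈ E, R e.1 e.2 = true} = ENNReal.ofReal p ^ E.card := by
  have := isProbabilityMeasure_entryLaw h0 h1
  have hset : {R : RepMatrix m n | ∀ e ∈ E, R e.1 e.2 = true} =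
      Set.pi Set.univ fun ℓ => Set.pi Set.univ fun v =>
        if (ℓ, v) ∈ E then ({true} : Set Bool) else Set.univ := by
    ext R
    simp only [Set.mem_ofPred_eq, Set.mem_pi, Set.mem_univ, true_implies, Prod.forall]
    refine forall_congr' fun ℓ => forall_congr' fun v => ?_
    split_ifs with h <;> simp [h]
  rw [hset, matrixLaw, Measure.pi_pi]
  simp_rw [Measure.pi_pi]
  rw [← Finset.prod_product', Finset.univ_product_univ]
  have : ∀ x : Fin m × Fin n, entryLaw p (if (x.1, x.2) ∈ E then ({true} : Set Bool)
      else Set.univ) = if x ∈ E then ENNReal.ofReal p else 1 := by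
    intro x
    by_cases hx : x ∈ E
    · simp [hx, entryLaw_true]
    · simp only [Prod.mk.eta, if_neg hx, measure_univ]
  simp_rw [this]
  rw [Finset.prod_ite_mem, Finset.univ_inter, Finset.prod_const]

/-- If `F` contains a pair that does not join a label to a vertex, the event is empty; otherwise
distinct edges are distinct matrix entries. -/
theorem matrixLaw_edges_le {p : ℝ} (h0 : 0 ≤ p) (h1 : p ≤ 1) (F : Finset (Sym2 (Fin m ⊕ Fin n))) :
    matrixLaw m n p {R | ∀ e ∈ F, e ∈ (incGraph R).edgeSet} ≤ ENNReal.ofReal p ^ F.card := by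
  classical
  by_cases hF : ∀ e ∈ F, ∃ ℓ v, e = s(Sum.inl ℓ, Sum.inr v)
  · let E : Finset (Fin m × Fin n) :=
      Finset.univ.filter fun e => s(Sum.inl e.1, Sum.inr e.2) ∈ F
    have hFE : F ⊆ E.image fun e => s(Sum.inl e.1, Sum.inr e.2) := by
      intro e he
      obtain ⟨ℓ, v, rfl⟩ := hF e he
      exact Finset.mem_image.2 ⟨(ℓ, v), by simpa [E] using he, rfl⟩
    have hcard : F.card ≤ E.card := (Finset.card_le_card hFE).trans Finset.card_image_le
    calc _ ≤ matrixLaw m n p {R | ∀ e ∈ E, R e.1 e.2 = true} := by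
          refine measure_mono fun R hR e he => ?_
          have := hR _ (Finset.mem_filter.1 he).2
          simpa using this
      _ = ENNReal.ofReal p ^ E.card := matrixLaw_entries h0 h1 E
      _ ≤ _ := pow_le_pow_right_of_le_one' (by simpa using h1) hcard
  · push Not at hF
    obtain ⟨e, he, hne⟩ := hF
    have : {R : RepMatrix m n | ∀ e ∈ F, e ∈ (incGraph R).edgeSet} = ∅ := by
      ext R
      simp only [Set.mem_ofPred_eq, Set.mem_empty_iff_false, iff_false]
      intro h
      have h' := h e he
      induction e using Sym2.ind with
      | _ a b =>
        rcases a with a | a <;> rcases b with b | b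
        · simp at h'
        · exact hne a b rfl
        · exact hne b a Sym2.eq_swap
        · simp at h'
    rw [this]; simp

/-! ### Union bound over alternating sequences. -/

/-- A sequence that takes labels and vertices in turn. -/
def altSeq {r : ℕ} (b : Bool) (f : Fin (r + 1) → Fin n) (k : Fin (r + 1)) : Fin n ⊕ Fin n :=
  if (k : ℕ).bodd = b then .inl (f k) else .inr (f k)

/-- The edges of a path on the indices. -/
def pathIdx (r : ℕ) : Finset (Sym2 (Fin (r + 1))) :=
  Finset.univ.image fun k : Fin r => s(k.castSucc, k.succ)

theorem mem_pathIdx {r : ℕ} {a b : Fin (r + 1)} (hab : a < b) :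
    s(a, b) ∈ pathIdx r ↔ (b : ℕ) = a + 1 := by
  simp only [pathIdx, Finset.mem_image, Finset.mem_univ, true_and, Sym2.eq_iff, Fin.ext_iff,
    Fin.val_castSucc, Fin.val_succ, Fin.lt_def] at *
  constructor
  · rintro ⟨k, h | h⟩ <;> omega
  · intro h
    exact ⟨⟨a, by omega⟩, Or.inl ⟨rfl, h.symm⟩⟩

theorem card_pathIdx (r : ℕ) : (pathIdx r).card = r := by
  rw [pathIdx, Finset.card_image_of_injective, Finset.card_fin]
  intro a b h
  simp only [Sym2.eq_iff, Fin.ext_iff, Fin.val_castSucc, Fin.val_succ] at h ⊢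
  omega

/-- A path is determined by the side on which it starts and by r + 1 numbers. This gives 2·n^(r + 1)
candidates rather than (2n)^(r + 1), without which c < 1 would not suffice. -/
theorem exists_altSeq {R : RepMatrix n n} {r : ℕ} (x : Fin (r + 1) → Fin n ⊕ Fin n)
    (h : ∀ e ∈ pathIdx r, Sym2.map x e ∈ (incGraph R).edgeSet) : ∃ b f, x = altSeq b f := by
  have hadj : ∀ k : Fin r, (incGraph R).Adj (x k.castSucc) (x k.succ) := fun k => by
    simpa using h _ (Finset.mem_image_of_mem _ (Finset.mem_univ k))
  obtain ⟨β, hβ⟩ : ∃ β, (x 0).isLeft = β := ⟨_, rfl⟩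
  -- `altSeq b` starts with a label exactly when `b` is `false`.
  refine ⟨!β, fun k => (x k).elim id id, ?_⟩
  have key : ∀ k : Fin (r + 1), (x k).isLeft = ((k : ℕ).bodd ^^ β) := by
    intro k
    induction k using Fin.induction with
    | zero => simpa using hβ
    | succ k ih =>
      have := hadj k
      rw [Fin.val_succ, Nat.bodd_succ]
      rw [Fin.val_castSucc] at ih
      rcases h1 : x k.castSucc with a | a <;> rcases h2 : x k.succ with b | b <;>
        rw [h1, h2] at this <;> rw [h1] at ih <;> cases β <;> simp_all
  funext k
  have := key k
  rw [altSeq]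
  rcases h1 : x k with a | a <;> rw [h1] at this <;> cases β <;> simp at this <;> simp [this]

theorem matrixLaw_altSeq_le {p : ℝ} (h0 : 0 ≤ p) (h1 : p ≤ 1) {r : ℕ}
    (I : Finset (Sym2 (Fin (r + 1)))) (b : Bool) (f : Fin (r + 1) → Fin n) :
    matrixLaw n n p {R | Function.Injective (altSeq b f) ∧
      ∀ e ∈ I, Sym2.map (altSeq b f) e ∈ (incGraph R).edgeSet} ≤ ENNReal.ofReal p ^ I.card := by
  classical
  by_cases hf : Function.Injective (altSeq b f)
  · refine le_trans (measure_mono ?_) ((matrixLaw_edges_le h0 h1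
      (I.image (Sym2.map (altSeq b f)))).trans_eq ?_)
    · rintro R ⟨-, hR⟩ e he
      obtain ⟨e', he', rfl⟩ := Finset.mem_image.1 he
      exact hR e' he'
    · rw [Finset.card_image_of_injective _ (Sym2.map.injective hf)]
  · simp [hf]

/-- Since `I` contains the path edges, only alternating sequences matter. Each one that is injective
maps `I` to `I.card` different edges. -/
theorem first_moment {p : ℝ} (h0 : 0 ≤ p) (h1 : p ≤ 1) {r : ℕ}
    (I : Finset (Sym2 (Fin (r + 1)))) (hI : pathIdx r ⊆ I) :
    matrixLaw n n p {R | ∃ x : Fin (r + 1) → Fin n ⊕ Fin n, Function.Injective x ∧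
      ∀ e ∈ I, Sym2.map x e ∈ (incGraph R).edgeSet} ≤
      2 * (n : ℝ≥0∞) ^ (r + 1) * ENNReal.ofReal p ^ I.card := by
  calc _ ≤ matrixLaw n n p (⋃ z : Bool × (Fin (r + 1) → Fin n),
        {R | Function.Injective (altSeq z.1 z.2) ∧
          ∀ e ∈ I, Sym2.map (altSeq z.1 z.2) e ∈ (incGraph R).edgeSet}) := by
        refine measure_mono ?_
        rintro R ⟨x, hx, hR⟩
        obtain ⟨b, f, rfl⟩ := exists_altSeq x fun e he => hR e (hI he)
        exact Set.mem_iUnion.2 ⟨(b, f), hx, hR⟩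
    _ ≤ ∑ z : Bool × (Fin (r + 1) → Fin n), ENNReal.ofReal p ^ I.card :=
        (measure_iUnion_fintype_le _ _).trans
          (Finset.sum_le_sum fun z _ => matrixLaw_altSeq_le h0 h1 I z.1 z.2)
    _ = _ := by simp [Fintype.card_prod]

theorem list_get_edges {R : RepMatrix m n} {r : ℕ} {l : List (Fin m ⊕ Fin n)}
    (hl : l.length = r + 1) (hnd : l.Nodup) (hch : l.IsChain (incGraph R).Adj) :
    ∃ x : Fin (r + 1) → Fin m ⊕ Fin n, (∀ k, x k = l[(k : ℕ)]) ∧ Function.Injective x ∧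
      ∀ e ∈ pathIdx r, Sym2.map x e ∈ (incGraph R).edgeSet := by
  refine ⟨fun k => l[(k : ℕ)], fun _ => rfl, ?_, ?_⟩
  · intro a b h
    exact Fin.ext ((hnd.getElem_inj_iff).1 h)
  · intro e he
    obtain ⟨k, -, rfl⟩ := Finset.mem_image.1 he
    simpa using List.isChain_iff_getElem.1 hch k (by omega)

/-! ### Bounds for long paths, bad paths and the 2-core. -/

/-- The number of elements of the 2-core of the incidence graph. -/
def coreCard (R : RepMatrix m n) : ℕ := (core (incGraph R)).ncard

/-- The index edges of a lasso. -/
def lassoIdx (r : ℕ) (i : Fin (r + 1)) : Finset (Sym2 (Fin (r + 1))) :=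
  insert s(0, i) (pathIdx r)

theorem card_lassoIdx {r : ℕ} {i : Fin (r + 1)} (hi : 2 ≤ (i : ℕ)) :
    (lassoIdx r i).card = r + 1 := by
  rw [lassoIdx, Finset.card_insert_of_notMem, card_pathIdx]
  rw [mem_pathIdx (by rw [Fin.lt_def, Fin.val_zero]; omega)]
  simp; omega

/-- The index edges of a bad path. -/
def badIdx (r : ℕ) (i j : Fin (r + 1)) : Finset (Sym2 (Fin (r + 1))) :=
  insert s(j, Fin.last r) (lassoIdx r i)

/-- The bounds on `i` and `j` separate the chords from the path edges; `hij` excludes that both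
chords join the two ends of the path. -/
theorem card_badIdx {r : ℕ} {i j : Fin (r + 1)} (hi : 2 ≤ (i : ℕ)) (hj : (j : ℕ) + 2 ≤ r)
    (hij : (j : ℕ) ≠ 0 ∨ (i : ℕ) < r) : (badIdx r i j).card = r + 2 := by
  rw [badIdx, Finset.card_insert_of_notMem, card_lassoIdx hi]
  rw [lassoIdx, Finset.mem_insert, mem_pathIdx (by rw [Fin.lt_def, Fin.val_last]; omega)]
  simp only [Sym2.eq_iff, Fin.ext_iff, Fin.val_last, Fin.val_zero]
  omega

theorem mul_ofReal_div (c : ℝ) (hn : 0 < n) :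
    (n : ℝ≥0∞) * ENNReal.ofReal (c / n) = ENNReal.ofReal c := by
  rw [← ENNReal.ofReal_natCast, ← ENNReal.ofReal_mul (by positivity)]
  congr 1
  field_simp

theorem matrixLaw_path_le {c : ℝ} (h0 : 0 ≤ c) (h1 : c ≤ 1) (hn : 0 < n) (r : ℕ) :
    matrixLaw n n (c / n) {R | ∃ l : List (Fin n ⊕ Fin n), l.Nodup ∧
      l.IsChain (incGraph R).Adj ∧ l.length = r + 1} ≤ 2 * n * ENNReal.ofReal c ^ r := by
  have hn' : (1 : ℝ) ≤ n := by exact_mod_cast hn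
  refine le_trans (measure_mono ?_) ((first_moment (p := c / n) (by positivity)
    (by rw [div_le_one (by linarith)]; linarith) (pathIdx r) subset_rfl).trans_eq ?_)
  · rintro R ⟨l, hnd, hch, hlen⟩
    obtain ⟨x, -, hx, hp⟩ := list_get_edges hlen hnd hch
    exact ⟨x, hx, hp⟩
  · rw [card_pathIdx, ← mul_ofReal_div c hn, mul_pow]
    ring

/-- With r + 1 nodes and r + 2 edges, each of the (r + 1)² choices of chords contributes 2·n^(r +
1)·(c/n)^(r + 2), that is, 2·c^(r + 2)/n. -/
theorem matrixLaw_badPath_le {c : ℝ} (h0 : 0 ≤ c) (h1 : c ≤ 1) (hn : 0 < n) :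
    (n : ℝ≥0∞) * matrixLaw n n (c / n) {R | ∃ l, BadPath (incGraph R) l} ≤
      ∑' r : ℕ, 2 * ((r : ℝ≥0∞) + 1) ^ 2 * ENNReal.ofReal c ^ (r + 2) := by
  have hn' : (1 : ℝ) ≤ n := by exact_mod_cast hn
  have hp1 : c / n ≤ 1 := by rw [div_le_one (by linarith)]; linarith
  have hsub : {R : RepMatrix n n | ∃ l, BadPath (incGraph R) l} ⊆
      ⋃ r : ℕ, ⋃ z : Fin (r + 1) × Fin (r + 1), {R | (badIdx r z.1 z.2).card = r + 2 ∧
        ∃ x : Fin (r + 1) → Fin n ⊕ Fin n, Function.Injective x ∧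
          ∀ e ∈ badIdx r z.1 z.2, Sym2.map x e ∈ (incGraph R).edgeSet} := by
    rintro R ⟨l, hnd, hch, i, j, hi, hj, hi2, hij, hadj, hadj'⟩
    obtain ⟨r, hr⟩ : ∃ r, l.length = r + 1 := ⟨l.length - 1, by omega⟩
    obtain ⟨x, hxl, hx, hp⟩ := list_get_edges hr hnd hch
    refine Set.mem_iUnion.2 ⟨r, Set.mem_iUnion.2 ⟨(⟨i, by omega⟩, ⟨j, by omega⟩),
      card_badIdx hi2 (by simp only; omega) (by simp only; omega), x, hx, ?_⟩⟩
    intro e he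
    rcases Finset.mem_insert.1 he with rfl | he
    · simpa [hxl, hr] using hadj'.symm
    rcases Finset.mem_insert.1 he with rfl | he
    · simpa [hxl] using hadj
    · exact hp e he
  calc _ ≤ (n : ℝ≥0∞) * ∑' r : ℕ, ∑ z : Fin (r + 1) × Fin (r + 1),
        2 * (n : ℝ≥0∞) ^ (r + 1) * ENNReal.ofReal (c / n) ^ (r + 2) := by
        gcongr
        refine (measure_mono hsub).trans ((measure_iUnion_le _).trans ?_)
        refine ENNReal.tsum_le_tsum fun r => (measure_iUnion_fintype_le _ _).trans ?_
        refine Finset.sum_le_sum fun z _ => ?_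
        -- The cardinality is part of the event, so degenerate or coinciding chords contribute
        -- nothing.
        by_cases hz : (badIdx r z.1 z.2).card = r + 2
        · simp only [hz, true_and]
          exact (first_moment (by positivity) hp1 (badIdx r z.1 z.2)
            ((Finset.subset_insert _ _).trans (Finset.subset_insert _ _))).trans_eq (by rw [hz])
        · simp [hz]
    _ = _ := by
        rw [← ENNReal.tsum_mul_left]
        refine tsum_congr fun r => ?_
        rw [Finset.sum_const, Finset.card_univ, Fintype.card_prod, Fintype.card_fin,
          ← mul_ofReal_div c hn, mul_pow, nsmul_eq_mul]
        push_cast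
        ring

/-- An element of the core ends a lasso. A lasso on r + 1 nodes has r + 1 edges, so all powers of n
cancel and the bound does not depend on n. -/
theorem sum_mem_core_le {c : ℝ} (h0 : 0 ≤ c) (h1 : c ≤ 1) (hn : 0 < n) :
    ∑ x, matrixLaw n n (c / n) {R | x ∈ core (incGraph R)} ≤
      ∑' r : ℕ, 2 * ((r : ℝ≥0∞) + 1) * ENNReal.ofReal c ^ (r + 1) := by
  have hn' : (1 : ℝ) ≤ n := by exact_mod_cast hn
  have hp1 : c / n ≤ 1 := by rw [div_le_one (by linarith)]; linarith
  let ev (r : ℕ) (z : Fin (r + 1) × Bool × (Fin (r + 1) → Fin n)) : Set (RepMatrix n n) :=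
    {R | 2 ≤ (z.1 : ℕ) ∧ Function.Injective (altSeq z.2.1 z.2.2) ∧
      ∀ e ∈ lassoIdx r z.1, Sym2.map (altSeq z.2.1 z.2.2) e ∈ (incGraph R).edgeSet}
  have hsub : ∀ x, {R : RepMatrix n n | x ∈ core (incGraph R)} ⊆ ⋃ r : ℕ,
      ⋃ z : Fin (r + 1) × Bool × (Fin (r + 1) → Fin n),
        {R | R ∈ ev r z ∧ altSeq z.2.1 z.2.2 (Fin.last r) = x} := by
    intro y R hy
    obtain ⟨l, ⟨hnd, hch, i, hi, hi2, hadj⟩, hlast⟩ := exists_lasso (G := incGraph R) hy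
    obtain ⟨r, hr⟩ : ∃ r, l.length = r + 1 := ⟨l.length - 1, by omega⟩
    obtain ⟨x, hxl, hx, hp⟩ := list_get_edges hr hnd hch
    obtain ⟨b, f, hbf⟩ := exists_altSeq x hp
    refine Set.mem_iUnion.2 ⟨r, Set.mem_iUnion.2 ⟨(⟨i, by omega⟩, b, f), ⟨hi2, hbf ▸ hx, ?_⟩, ?_⟩⟩
    · rw [← hbf]
      intro e he
      rcases Finset.mem_insert.1 he with rfl | he
      · simpa [hxl] using hadj
      · exact hp e he
    · rw [← hbf, hxl]
      rw [List.getLast?_eq_getElem?] at hlast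
      rw [List.getElem?_eq_some_iff] at hlast
      obtain ⟨_, hlast⟩ := hlast
      rw [← hlast]
      congr 1
      simp [hr]
  calc _ ≤ ∑ x, ∑' r : ℕ, ∑ z : Fin (r + 1) × Bool × (Fin (r + 1) → Fin n),
        (if altSeq z.2.1 z.2.2 (Fin.last r) = x then
          ENNReal.ofReal (c / n) ^ (r + 1) else 0) := by
        refine Finset.sum_le_sum fun x _ => (measure_mono (hsub x)).trans
          ((measure_iUnion_le _).trans (ENNReal.tsum_le_tsum fun r =>
            (measure_iUnion_fintype_le _ _).trans (Finset.sum_le_sum fun z _ => ?_)))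
        split_ifs with hx
        · by_cases hz : 2 ≤ (z.1 : ℕ)
          · simp only [hx, and_true, ev, hz, true_and, Set.mem_ofPred_eq]
            exact (matrixLaw_altSeq_le (by positivity) hp1 (lassoIdx r z.1) z.2.1 z.2.2).trans_eq
              (by rw [card_lassoIdx hz])
          · simp [ev, hz]
        · simp [hx]
    _ = ∑' r : ℕ, ∑ z : Fin (r + 1) × Bool × (Fin (r + 1) → Fin n),
          ENNReal.ofReal (c / n) ^ (r + 1) := by
        -- Each sequence has only one last element, so the sum over `x` costs no further factor.
        rw [← tsum_fintype (L := .unconditional _), ENNReal.tsum_comm]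
        refine tsum_congr fun r => ?_
        rw [tsum_fintype, Finset.sum_comm]
        simp
    _ = _ := by
        refine tsum_congr fun r => ?_
        rw [Finset.sum_const, Finset.card_univ, Fintype.card_prod, Fintype.card_prod,
          Fintype.card_fin, Fintype.card_bool, Fintype.card_fun, Fintype.card_fin,
          Fintype.card_fin, ← mul_ofReal_div c hn, mul_pow, nsmul_eq_mul]
        push_cast
        ring

/-- Markov's inequality for the size of the core, whose expectation is the sum of the membership
probabilities. -/
theorem matrixLaw_coreCard_le {c : ℝ} (h0 : 0 ≤ c) (h1 : c ≤ 1) (hn : 0 < n) (K : ℕ) :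
    (K : ℝ≥0∞) * matrixLaw n n (c / n) {R | K ≤ coreCard R} ≤
      ∑' r : ℕ, 2 * ((r : ℝ≥0∞) + 1) * ENNReal.ofReal c ^ (r + 1) := by
  classical
  refine le_trans ?_ (sum_mem_core_le h0 h1 hn)
  have hint : ∫⁻ R, (coreCard R : ℝ≥0∞) ∂(matrixLaw n n (c / n)) =
      ∑ x, matrixLaw n n (c / n) {R | x ∈ core (incGraph R)} := by
    have : ∀ R : RepMatrix n n, (coreCard R : ℝ≥0∞) =
        ∑ x, ({R | x ∈ core (incGraph R)} : Set (RepMatrix n n)).indicator 1 R := by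
      intro R
      simp only [coreCard, Set.indicator_apply, Set.mem_ofPred_eq, Pi.one_apply]
      rw [Set.ncard_eq_toFinset_card', Finset.sum_boole]
      congr 2
      ext; simp
    simp_rw [this]
    rw [lintegral_finsetSum _ fun x _ => Measurable.of_discrete]
    exact Finset.sum_congr rfl fun x _ => lintegral_indicator_one MeasurableSet.of_discrete
  rw [← hint]
  simpa using mul_meas_ge_le_lintegral (μ := matrixLaw n n (c / n))
    (f := fun R => (coreCard R : ℝ≥0∞)) Measurable.of_discrete (K : ℝ≥0∞)

theorem tsum_poly_geometric_ne_top {c : ℝ} (h0 : 0 ≤ c) (h1 : c < 1) (k : ℕ) :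
    ∑' r : ℕ, 2 * ((r : ℝ≥0∞) + 1) ^ k * ENNReal.ofReal c ^ (r + k) ≠ ⊤ := by
  have hs : Summable fun r : ℕ => 2 * ((r : ℝ) + 1) ^ k * c ^ (r + k) := by
    have := summable_pow_mul_geometric_of_norm_lt_one k (r := c) (by
      rwa [Real.norm_eq_abs, abs_of_nonneg h0])
    have h2 := ((summable_nat_add_iff 1).2 this)
    by_cases hc : c = 0
    · subst hc
      refine summable_of_ne_finset_zero (s := {0}) fun r hr => ?_
      rw [zero_pow (by simp at hr; omega), mul_zero]
    refine (h2.mul_left (2 * c ^ k * c⁻¹)).congr fun r => ?_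
    push_cast
    rw [pow_add, pow_add]
    field_simp
  have : ∀ r : ℕ, 2 * ((r : ℝ≥0∞) + 1) ^ k * ENNReal.ofReal c ^ (r + k) =
      ENNReal.ofReal (2 * ((r : ℝ) + 1) ^ k * c ^ (r + k)) := by
    intro r
    rw [ENNReal.ofReal_mul (by positivity), ENNReal.ofReal_mul (by positivity),
      ENNReal.ofReal_pow (by positivity), ENNReal.ofReal_pow h0,
      ENNReal.ofReal_add (by positivity) (by positivity)]
    simp
  simp_rw [this]
  exact hs.tsum_ofReal_ne_top

/-- The incidence graph has no bad path, its 2-core has at most `B` elements, and its paths have at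
most `t` elements. -/
structure Typical (R : RepMatrix m n) (B : ℕ) (t : ℝ) : Prop where
  noBad : ∀ l, ¬ BadPath (incGraph R) l
  coreCard_le : coreCard R ≤ B
  length_le : ∀ l : List (Fin m ⊕ Fin n), l.Nodup → l.IsChain (incGraph R).Adj → (l.length : ℝ) ≤ t

/-- The constant 2/log(1/c) is chosen such that c^(A·log n) = n⁻², which beats the factor n in the
bound 2n·c^r; rounding to an integer r costs a factor 1/c. -/
theorem matrixLaw_long_path_le {c : ℝ} (h0 : 0 < c) (h1 : c < 1) (hn : 0 < n) :
    matrixLaw n n (c / n) {R | ¬ ∀ l : List (Fin n ⊕ Fin n), l.Nodup →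
      l.IsChain (incGraph R).Adj → (l.length : ℝ) ≤ 2 / Real.log c⁻¹ * Real.log n} ≤
      ENNReal.ofReal (2 / c) / n := by
  have hn' : (1 : ℝ) ≤ n := by exact_mod_cast hn
  have hlc : 0 < Real.log c⁻¹ := Real.log_pos ((one_lt_inv₀ h0).2 h1)
  set A := 2 / Real.log c⁻¹ with hA
  set r := ⌊A * Real.log n⌋₊ with hr
  have hAn : 0 ≤ A * Real.log n := mul_nonneg (by positivity) (Real.log_nonneg hn')
  refine le_trans (measure_mono ?_) ((matrixLaw_path_le h0.le h1.le hn r).trans ?_)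
  · intro R hR
    simp only [Set.mem_ofPred_eq, not_forall, not_le] at hR
    obtain ⟨l, hnd, hch, hl⟩ := hR
    have : r < l.length := (Nat.floor_lt hAn).2 hl
    -- A longer path contains one on exactly r + 1 nodes.
    exact ⟨l.take (r + 1), hnd.sublist (List.take_sublist _ _), hch.take _, by simp; omega⟩
  · have h2 : c ^ r ≤ c⁻¹ * ((n : ℝ) ^ 2)⁻¹ := by
      have h3 : A * Real.log n - 1 ≤ r := by linarith [Nat.lt_floor_add_one (A * Real.log n)]
      calc c ^ r = c ^ (r : ℝ) := (Real.rpow_natCast _ _).symm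
        _ ≤ c ^ (A * Real.log n - 1) := Real.rpow_le_rpow_of_exponent_ge h0 h1.le h3
        _ = c⁻¹ * c ^ (A * Real.log n) := by
            rw [Real.rpow_sub h0, Real.rpow_one, div_eq_inv_mul]
        _ = c⁻¹ * ((n : ℝ) ^ 2)⁻¹ := by
            congr 1
            rw [Real.rpow_def_of_pos h0]
            have : Real.log c * (A * Real.log n) = -Real.log ((n : ℝ) ^ 2) := by
              rw [hA, Real.log_pow, Real.log_inv]
              rw [Real.log_inv] at hlc
              have : Real.log c ≠ 0 := by linarith
              field_simp
              push_cast
              ring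
            rw [this, Real.exp_neg, Real.exp_log (by positivity)]
    have h3 : 2 * (n : ℝ≥0∞) * ENNReal.ofReal c ^ r = ENNReal.ofReal (2 * n * c ^ r) := by
      rw [ENNReal.ofReal_mul (by positivity), ENNReal.ofReal_mul (by positivity),
        ENNReal.ofReal_pow h0.le]
      simp
    rw [h3, ← ENNReal.ofReal_natCast n, ← ENNReal.ofReal_div_of_pos (by positivity)]
    refine ENNReal.ofReal_le_ofReal ?_
    calc 2 * (n : ℝ) * c ^ r ≤ 2 * n * (c⁻¹ * ((n : ℝ) ^ 2)⁻¹) := by gcongr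
      _ = 2 / c / n := by field_simp

/-- The size of the core is bounded only in probability, so no fixed `B` holds whp. But the events
`E n` do not depend on `B`: their probability has lower limit at least 1 - Y/B for every positive
`B`, hence tends to 1. -/
theorem tendsto_matrixLaw_of_typical {c : ℝ} (h0 : 0 < c) (h1 : c < 1)
    (E : ∀ n : ℕ, Set (RepMatrix n n))
    (hE : ∀ B : ℕ, ∀ᶠ n : ℕ in atTop, ∀ R : RepMatrix n n,
      Typical R B (2 / Real.log c⁻¹ * Real.log n) → R ∈ E n) :
    Tendsto (fun n : ℕ => matrixLaw n n (c / n) (E n)) atTop (𝓝 1) := by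
  obtain ⟨X, hX⟩ : ∃ X, X = ∑' r : ℕ, 2 * ((r : ℝ≥0∞) + 1) ^ 2 * ENNReal.ofReal c ^ (r + 2) :=
    ⟨_, rfl⟩
  obtain ⟨Y, hY⟩ : ∃ Y, Y = ∑' r : ℕ, 2 * ((r : ℝ≥0∞) + 1) * ENNReal.ofReal c ^ (r + 1) :=
    ⟨_, rfl⟩
  have hXt : X ≠ ⊤ := hX ▸ tsum_poly_geometric_ne_top h0.le h1 2
  have hYt : Y ≠ ⊤ := by
    have := tsum_poly_geometric_ne_top h0.le h1 1
    simp only [pow_one] at this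
    rwa [hY]
  have hlim : Tendsto (fun n : ℕ => X / n + ENNReal.ofReal (2 / c) / n) atTop (𝓝 0) := by
    have h := (ENNReal.Tendsto.const_div (a := X) ENNReal.tendsto_nat_nhds_top (Or.inr hXt)).add
      (ENNReal.Tendsto.const_div (a := ENNReal.ofReal (2 / c)) ENNReal.tendsto_nat_nhds_top
        (Or.inr ENNReal.ofReal_ne_top))
    simpa using h
  have hlim' : Tendsto (fun K : ℕ => Y / K) atTop (𝓝 0) := by
    simpa using ENNReal.Tendsto.const_div (a := Y) ENNReal.tendsto_nat_nhds_top (Or.inr hYt)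
  refine tendsto_order.2 ⟨fun a ha => ?_, fun a ha => ?_⟩
  · have hd : 0 < (1 - a) / 2 := ENNReal.half_pos (tsub_pos_of_lt ha).ne'
    -- Half of the allowed error is spent on a core of size at least `B`, half on bad and long
    -- paths.
    obtain ⟨B, hB⟩ := (((tendsto_order.1 hlim').2 _ hd).and (eventually_gt_atTop 0)).exists
    filter_upwards [hE B, (tendsto_order.1 hlim).2 _ hd, eventually_gt_atTop 0] with n hn hn2 hn0
    have hn' : (1 : ℝ) ≤ n := by exact_mod_cast hn0
    have hprob : IsProbabilityMeasure (matrixLaw n n (c / n)) :=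
      isProbabilityMeasure_matrixLaw (by positivity) (by rw [div_le_one (by linarith)]; linarith)
    have hcompl : matrixLaw n n (c / n) (E n)ᶜ < 1 - a := by
      calc matrixLaw n n (c / n) (E n)ᶜ ≤
          matrixLaw n n (c / n) ({R | ∃ l, BadPath (incGraph R) l} ∪
            {R | ¬ ∀ l : List (Fin n ⊕ Fin n), l.Nodup → l.IsChain (incGraph R).Adj →
              (l.length : ℝ) ≤ 2 / Real.log c⁻¹ * Real.log n} ∪ {R | B ≤ coreCard R}) := by
            refine measure_mono fun R hR => ?_
            by_contra hcon
            simp only [Set.mem_union, Set.mem_ofPred_eq, not_or, not_not, not_exists,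
              not_le] at hcon
            exact hR (hn R ⟨hcon.1.1, hcon.2.le, hcon.1.2⟩)
        _ ≤ (X / n + ENNReal.ofReal (2 / c) / n) + Y / B := by
            refine (measure_union_le _ _).trans (add_le_add ((measure_union_le _ _).trans
              (add_le_add ?_ ?_)) ?_)
            · rw [ENNReal.le_div_iff_mul_le (by simp; omega) (by simp), mul_comm, hX]
              exact matrixLaw_badPath_le h0.le h1.le hn0
            · exact matrixLaw_long_path_le h0 h1 hn0
            · rw [ENNReal.le_div_iff_mul_le (by simp; omega) (by simp), mul_comm, hY]
              exact matrixLaw_coreCard_le h0.le h1.le hn0 B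
        _ < (1 - a) / 2 + (1 - a) / 2 := ENNReal.add_lt_add hn2 hB.1
        _ = 1 - a := ENNReal.add_halves _
    rw [prob_compl_eq_one_sub MeasurableSet.of_discrete] at hcompl
    by_contra! h
    exact absurd hcompl (not_lt.2 (tsub_le_tsub_left h 1))
  · filter_upwards [eventually_gt_atTop 0] with n hn0
    have hn' : (1 : ℝ) ≤ n := by exact_mod_cast hn0
    have hprob : IsProbabilityMeasure (matrixLaw n n (c / n)) :=
      isProbabilityMeasure_matrixLaw (by positivity) (by rw [div_le_one (by linarith)]; linarith)
    exact prob_le_one.trans_lt ha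

end FirstMoment

/-! ### Closed sequences in a graph with 2-regular core -/

section Cycles

variable {m n : ℕ} {R : RepMatrix m n}

theorem mem_labelSet {ℓ : Fin m} {v : Fin n} : v ∈ labelSet R ℓ ↔ R ℓ v = true := by
  simp [labelSet]

/-- A closed sequence with distinct vertices, distinct labels, and at least two of them. -/
structure IsCyc (R : RepMatrix m n) (σ : VLSeq m n) : Prop where
  closed : σ.IsClosedIn R
  vert_inj : Function.Injective (fun i : Fin σ.size => σ.vert i.castSucc)
  lab_inj : Function.Injective σ.lab
  two_le : 2 ≤ σ.size

/-- The index after `i` in cyclic order. -/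
def cycSucc {k : ℕ} (i : Fin k) : Fin k := ⟨(i + 1) % k, Nat.mod_lt _ (by have := i.2; omega)⟩

theorem cycSucc_val {k : ℕ} (i : Fin k) :
    ((cycSucc i : Fin k) : ℕ) = if (i : ℕ) + 1 < k then (i : ℕ) + 1 else 0 := by
  have := i.2
  simp only [cycSucc]
  split_ifs with h
  · exact Nat.mod_eq_of_lt h
  · rw [show (i : ℕ) + 1 = k by omega, Nat.mod_self]

theorem exists_cycSucc_eq {k : ℕ} (i : Fin k) : ∃ j, cycSucc j = i := by
  have := i.2
  by_cases h : (i : ℕ) = 0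
  · refine ⟨⟨k - 1, by omega⟩, Fin.ext ?_⟩
    rw [cycSucc_val, if_neg (by simp only; omega), h]
  · refine ⟨⟨i - 1, by omega⟩, Fin.ext ?_⟩
    rw [cycSucc_val, if_pos (by simp only; omega)]
    simp only; omega

theorem cycSucc_ne {k : ℕ} (hk : 2 ≤ k) (i : Fin k) : cycSucc i ≠ i := by
  intro h
  have h' := congrArg Fin.val h
  rw [cycSucc_val] at h'
  split_ifs at h' <;> omega

theorem cycSucc_cycSucc_ne {k : ℕ} (hk : 3 ≤ k) (i : Fin k) : cycSucc (cycSucc i) ≠ i := by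
  intro h
  have h' := congrArg Fin.val h
  rw [cycSucc_val, cycSucc_val] at h'
  split_ifs at h' <;> omega

/-- Every index `j` is reached from `i` by going round in j + k - i steps; the summand `k` keeps the
difference from being truncated. -/
theorem cycSucc_induction {k : ℕ} {P : Fin k → Prop} (h : ∀ i, P i → P (cycSucc i)) {i : Fin k}
    (hi : P i) (j : Fin k) : P j := by
  have key : ∀ t : ℕ, P ⟨(i + t) % k, Nat.mod_lt _ (by have := i.2; omega)⟩ := by
    intro t
    induction t with
    | zero => simpa [Nat.mod_eq_of_lt i.2] using hi
    | succ t ih =>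
      convert h _ ih using 1
      simp [cycSucc, add_assoc]
  have h2 := key (j + k - i)
  have : ((i : ℕ) + (j + k - i)) % k = j := by
    have := i.2
    rw [show (i : ℕ) + (j + k - i) = j + k by omega, Nat.add_mod_right, Nat.mod_eq_of_lt j.2]
  simpa [this] using h2

theorem VLSeq.IsClosedIn.vert_succ {σ : VLSeq m n} (h : σ.IsClosedIn R) (i : Fin σ.size) :
    σ.vert i.succ = σ.vert (cycSucc i).castSucc := by
  by_cases hi : (i : ℕ) + 1 < σ.size
  · congr 1
    apply Fin.ext
    simp [cycSucc_val, hi]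
  · have h1 : i.succ = Fin.last σ.size := by
      have := i.2
      apply Fin.ext; simp; omega
    have h2 : (cycSucc i).castSucc = 0 := by
      apply Fin.ext; simp [cycSucc_val, hi]
    rw [h1, h2, h.1]

/-- The labels and vertices of a sequence. -/
def VLSeq.nodes (σ : VLSeq m n) : Set (Fin m ⊕ Fin n) :=
  (Set.range fun i => Sum.inl (σ.lab i)) ∪
    Set.range fun i : Fin σ.size => Sum.inr (σ.vert i.castSucc)

namespace IsCyc

variable {σ τ : VLSeq m n}

theorem adj_vert (h : IsCyc R σ) (i : Fin σ.size) : R (σ.lab i) (σ.vert i.castSucc) = true :=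
  mem_labelSet.1 (h.closed.2 i).1

theorem adj_vert_succ (h : IsCyc R σ) (i : Fin σ.size) :
    R (σ.lab i) (σ.vert (cycSucc i).castSucc) = true := by
  rw [← h.closed.vert_succ]
  exact mem_labelSet.1 (h.closed.2 i).2

theorem vert_ne (h : IsCyc R σ) (i : Fin σ.size) :
    σ.vert i.castSucc ≠ σ.vert (cycSucc i).castSucc :=
  fun he => cycSucc_ne h.two_le i (h.vert_inj he).symm

/-- Each node is adjacent to the one before and the one after it; these differ because the length is
at least two. So closed sequences live in the 2-core. -/
theorem minTwo (h : IsCyc R σ) : MinTwo (incGraph R) σ.nodes := by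
  rintro y (⟨i, rfl⟩ | ⟨i, rfl⟩)
  · exact ⟨_, Or.inr ⟨i, rfl⟩, _, Or.inr ⟨cycSucc i, rfl⟩, by simpa using h.vert_ne i,
      h.adj_vert i, h.adj_vert_succ i⟩
  · obtain ⟨j, rfl⟩ := exists_cycSucc_eq i
    refine ⟨_, Or.inl ⟨j, rfl⟩, _, Or.inl ⟨cycSucc j, rfl⟩, ?_, h.adj_vert_succ j, h.adj_vert _⟩
    simpa using fun he => cycSucc_ne h.two_le j (h.lab_inj he).symm

theorem lab_mem_core (h : IsCyc R σ) (i : Fin σ.size) : Sum.inl (σ.lab i) ∈ core (incGraph R) :=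
  h.minTwo.subset_core (Or.inl ⟨i, rfl⟩)

theorem vert_mem_core (h : IsCyc R σ) (i : Fin σ.size) :
    Sum.inr (σ.vert i.castSucc) ∈ core (incGraph R) :=
  h.minTwo.subset_core (Or.inr ⟨i, rfl⟩)

/-- The two vertices next to the label on the cycle are already all its neighbours in the 2-regular
core. -/
theorem vert_of_adj (hR : ∀ l, ¬ BadPath (incGraph R) l)
    (h : IsCyc R σ) {i : Fin σ.size} {v : Fin n}
    (hv : Sum.inr v ∈ core (incGraph R)) (hiv : R (σ.lab i) v = true) :
    v = σ.vert i.castSucc ∨ v = σ.vert (cycSucc i).castSucc := by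
  have := core_two_regular hR (h.lab_mem_core i) hv (h.vert_mem_core i)
    (h.vert_mem_core (cycSucc i)) hiv (h.adj_vert i) (h.adj_vert_succ i)
  have hne := h.vert_ne i
  simp only [Sum.inr.injEq] at this
  tauto

theorem lab_of_adj (hR : ∀ l, ¬ BadPath (incGraph R) l)
    (h : IsCyc R σ) {i : Fin σ.size} {ℓ : Fin m}
    (hℓ : Sum.inl ℓ ∈ core (incGraph R)) (hiℓ : R ℓ (σ.vert (cycSucc i).castSucc) = true) :
    ℓ = σ.lab i ∨ ℓ = σ.lab (cycSucc i) := by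
  have := core_two_regular hR (h.vert_mem_core (cycSucc i)) hℓ (h.lab_mem_core i)
    (h.lab_mem_core (cycSucc i)) hiℓ (h.adj_vert_succ i) (h.adj_vert _)
  have hne : σ.lab i ≠ σ.lab (cycSucc i) := fun he => cycSucc_ne h.two_le i (h.lab_inj he).symm
  simp only [Sum.inl.injEq] at this
  tauto

/-- From a common label, walk along `τ`: the next vertex of `τ` is one of the two core neighbours of
the label, hence on `σ`, and in the same way so is the next label. -/
theorem range_lab_subset (hR : ∀ l, ¬ BadPath (incGraph R) l)
    (hσ : IsCyc R σ) (hτ : IsCyc R τ) {i : Fin σ.size} {j : Fin τ.size}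
    (hij : σ.lab i = τ.lab j) : Set.range τ.lab ⊆ Set.range σ.lab := by
  rintro _ ⟨j', rfl⟩
  refine cycSucc_induction (P := fun j => τ.lab j ∈ Set.range σ.lab) ?_ ⟨i, hij⟩ j'
  rintro j ⟨i, hij⟩
  obtain ⟨i₀, hi₀⟩ : ∃ i₀ : Fin σ.size,
      τ.vert (cycSucc j).castSucc = σ.vert (cycSucc i₀).castSucc := by
    rcases hσ.vert_of_adj hR (hτ.vert_mem_core (cycSucc j)) (i := i)
      (by rw [hij]; exact hτ.adj_vert_succ j) with h | h
    · obtain ⟨i₀, rfl⟩ := exists_cycSucc_eq i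
      exact ⟨i₀, h⟩
    · exact ⟨i, h⟩
  rcases hσ.lab_of_adj hR (hτ.lab_mem_core (cycSucc j)) (i := i₀)
    (by rw [← hi₀]; exact hτ.adj_vert _) with h | h
  · exact ⟨_, h.symm⟩
  · exact ⟨_, h.symm⟩

/-- A label has only two neighbours in the core, so both cycles enter and leave it by the same pair.
-/
theorem edge_eq (hR : ∀ l, ¬ BadPath (incGraph R) l)
    (hσ : IsCyc R σ) (hτ : IsCyc R τ) {i : Fin σ.size} {j : Fin τ.size}
    (hij : σ.lab i = τ.lab j) :
    s(σ.vert i.castSucc, σ.vert i.succ) = s(τ.vert j.castSucc, τ.vert j.succ) := by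
  rw [hσ.closed.vert_succ, hτ.closed.vert_succ]
  have h1 := hσ.vert_of_adj hR (hτ.vert_mem_core j) (i := i) (by rw [hij]; exact hτ.adj_vert j)
  have h2 := hσ.vert_of_adj hR (hτ.vert_mem_core (cycSucc j)) (i := i)
    (by rw [hij]; exact hτ.adj_vert_succ j)
  have h3 := hτ.vert_ne j
  rw [Sym2.eq_iff]
  grind

/-- Two consecutive vertices of a closed sequence with at least three labels have only one label in
common. -/
theorem lab_unique (hR : ∀ l, ¬ BadPath (incGraph R) l)
    (h : IsCyc R σ) (h3 : 3 ≤ σ.size) {i : Fin σ.size} {ℓ : Fin m}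
    (h1 : R ℓ (σ.vert i.castSucc) = true) (h2 : R ℓ (σ.vert i.succ) = true) : ℓ = σ.lab i := by
  rw [h.closed.vert_succ] at h2
  obtain ⟨j, rfl⟩ := exists_cycSucc_eq i
  -- Adding `ℓ` to the core keeps the minimum degree at two, as `ℓ` has two neighbours in it.
  have hcore : Sum.inl ℓ ∈ core (incGraph R) := by
    have : MinTwo (incGraph R) (insert (Sum.inl ℓ) (core (incGraph R))) := by
      rintro y (rfl | hy)
      · exact ⟨_, Or.inr (h.vert_mem_core (cycSucc j)), _,
          Or.inr (h.vert_mem_core (cycSucc (cycSucc j))), by simpa using h.vert_ne (cycSucc j),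
          h1, h2⟩
      · obtain ⟨a, ha, b, hb, hab⟩ := minTwo_core _ y hy
        exact ⟨a, Or.inr ha, b, Or.inr hb, hab⟩
    exact this.subset_core (Or.inl rfl)
  -- Otherwise `ℓ` would be both the label before and the label after the wanted one; these differ
  -- when there are at least three labels.
  rcases h.lab_of_adj hR hcore h1 with e1 | e1
  · rcases h.lab_of_adj hR hcore h2 with e2 | e2
    · exact e2
    · exact absurd (h.lab_inj (e2.symm.trans e1)) (cycSucc_cycSucc_ne h3 j)
  · exact e1

end IsCyc

/-- An odd length below three is one, and a sequence of length one would need a loop in a matching.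
-/
theorem isCyc_of_mem_codd {M : Fin m → Finset (Sym2 (Fin n))}
    (hM : ∀ ℓ, IsMatchingOf (labelSet R ℓ) (M ℓ)) {σ : VLSeq m n} (hσ : σ ∈ codd R M) :
    IsCyc R σ ∧ 3 ≤ σ.size := by
  obtain ⟨hcl, hodd, hv, hl, hM', -⟩ := hσ
  have h3 : 3 ≤ σ.size := by
    by_contra! hlt
    have h1 : σ.size = 1 := by
      obtain ⟨k, hk⟩ := hodd; omega
    obtain ⟨ℓ, hℓ⟩ := hM' ⟨0, by omega⟩
    apply ((hM ℓ).1 _ hℓ).1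
    rw [hcl.vert_succ, Sym2.mk_isDiag_iff]
    congr 1
    apply Fin.ext
    simp [cycSucc_val, h1]
  exact ⟨⟨hcl, hv, hl, by omega⟩, h3⟩

/-! ### Bad label sets and the effect of a new matching. -/

/-- The set of the labels of a sequence. -/
def VLSeq.labSet (σ : VLSeq m n) : Finset (Fin m) := Finset.univ.image σ.lab

theorem VLSeq.mem_labSet {σ : VLSeq m n} {ℓ : Fin m} : ℓ ∈ σ.labSet ↔ ∃ i, σ.lab i = ℓ := by
  simp [VLSeq.labSet]

open Classical in
/-- The label sets of the sequences in `C_odd`. -/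
def badSets (R : RepMatrix m n) (M : Fin m → Finset (Sym2 (Fin n))) : Finset (Finset (Fin m)) :=
  Finset.univ.filter fun Λ => ∃ σ ∈ codd R M, σ.labSet = Λ

theorem mem_badSets {M : Fin m → Finset (Sym2 (Fin n))} {Λ : Finset (Fin m)} :
    Λ ∈ badSets R M ↔ ∃ σ ∈ codd R M, σ.labSet = Λ := by simp [badSets]

theorem card_badSets_le {M : Fin m → Finset (Sym2 (Fin n))}
    (hM : ∀ ℓ, IsMatchingOf (labelSet R ℓ) (M ℓ)) : (badSets R M).card ≤ 2 ^ coreCard R := by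
  classical
  let C : Finset (Fin m) := Finset.univ.filter fun ℓ => Sum.inl ℓ ∈ core (incGraph R)
  have h1 : badSets R M ⊆ C.powerset := by
    intro Λ hΛ
    obtain ⟨σ, hσ, rfl⟩ := mem_badSets.1 hΛ
    rw [Finset.mem_powerset]
    intro ℓ hℓ
    obtain ⟨i, rfl⟩ := VLSeq.mem_labSet.1 hℓ
    simpa [C] using (isCyc_of_mem_codd hM hσ).1.lab_mem_core i
  have h2 : C.card ≤ coreCard R := by
    rw [coreCard, ← Set.ncard_coe_finset]
    exact Set.ncard_le_ncard_of_injOn Sum.inl (fun ℓ hℓ => by simpa [C] using hℓ)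
      Sum.inl_injective.injOn
  calc _ ≤ C.powerset.card := Finset.card_le_card h1
    _ = 2 ^ C.card := Finset.card_powerset _
    _ ≤ _ := Nat.pow_le_pow_right (by norm_num) h2

/-- A new odd sequence through the redrawn label has the same labels as `σ`, so its label set was
bad before; one that avoids the label used unchanged matchings only. If `N` lacks the edge of `σ` at
this label, no sequence with the labels of `σ` survives, since it would need just this edge. -/
theorem badSets_update_subset (hR : ∀ l, ¬ BadPath (incGraph R) l)
    {M : Fin m → Finset (Sym2 (Fin n))} (hM : ∀ ℓ, IsMatchingOf (labelSet R ℓ) (M ℓ))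
    {σ : VLSeq m n} (hσ : σ ∈ codd R M) (i : Fin σ.size) {N : Finset (Sym2 (Fin n))}
    (hN : IsMatchingOf (labelSet R (σ.lab i)) N) :
    badSets R (Function.update M (σ.lab i) N) ⊆ badSets R M ∧
      (s(σ.vert i.castSucc, σ.vert i.succ) ∉ N →
        σ.labSet ∉ badSets R (Function.update M (σ.lab i) N)) := by
  have hM' : ∀ ℓ, IsMatchingOf (labelSet R ℓ) (Function.update M (σ.lab i) N ℓ) := by
    intro ℓ
    by_cases h : ℓ = σ.lab i
    · subst h; simpa using hN
    · simpa [h] using hM ℓ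
  have hσc := (isCyc_of_mem_codd hM hσ).1
  -- By `lab_unique`, each edge of the sequence can only come from the matching of its own label.
  have hedge : ∀ τ ∈ codd R (Function.update M (σ.lab i) N), ∀ j : Fin τ.size,
      s(τ.vert j.castSucc, τ.vert j.succ) ∈ Function.update M (σ.lab i) N (τ.lab j) := by
    intro τ hτ j
    obtain ⟨hτc, hτ3⟩ := isCyc_of_mem_codd hM' hτ
    obtain ⟨ℓ, hℓ⟩ := hτ.2.2.2.2.1 j
    have h1 := ((hM' ℓ).1 _ hℓ).2
    have : ℓ = τ.lab j := hτc.lab_unique hR hτ3 (mem_labelSet.1 (h1 _ (by simp)))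
      (mem_labelSet.1 (h1 _ (by simp)))
    rwa [← this]
  constructor
  · intro Λ hΛ
    obtain ⟨τ, hτ, rfl⟩ := mem_badSets.1 hΛ
    have hτc := (isCyc_of_mem_codd hM' hτ).1
    by_cases h : ∃ j, τ.lab j = σ.lab i
    · obtain ⟨j, hj⟩ := h
      refine mem_badSets.2 ⟨σ, hσ, ?_⟩
      ext ℓ
      simp only [VLSeq.mem_labSet]
      exact ⟨fun h => hτc.range_lab_subset hR hσc hj h,
        fun h => hσc.range_lab_subset hR hτc hj.symm h⟩
    · push Not at h
      refine mem_badSets.2 ⟨τ, ⟨hτ.1, hτ.2.1, hτ.2.2.1, hτ.2.2.2.1, fun j => ⟨τ.lab j, ?_⟩,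
        hτ.2.2.2.2.2⟩, rfl⟩
      have := hedge τ hτ j
      rwa [Function.update_of_ne (h j)] at this
  · intro hs hΛ
    obtain ⟨τ, hτ, hτσ⟩ := mem_badSets.1 hΛ
    have hτc := (isCyc_of_mem_codd hM' hτ).1
    obtain ⟨j, hj⟩ := VLSeq.mem_labSet.1 (hτσ ▸ VLSeq.mem_labSet.2 ⟨i, rfl⟩ : σ.lab i ∈ τ.labSet)
    have := hedge τ hτ j
    rw [hj, Function.update_self, hτc.edge_eq hR hσc hj] at this
    exact hs this

end Cycles

/-! ### Random maximal matchings -/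

section Matchings

variable {n : ℕ}

theorem IsMatchingOf.map {S : Finset (Fin n)} {N : Finset (Sym2 (Fin n))} (hN : IsMatchingOf S N)
    (π : Equiv.Perm (Fin n)) (hπ : ∀ v ∈ S, π v ∈ S) :
    IsMatchingOf S (N.image (Sym2.map π)) := by
  constructor
  · intro e he
    obtain ⟨e₀, he₀, rfl⟩ := Finset.mem_image.1 he
    refine ⟨fun h => (hN.1 e₀ he₀).1 ((Sym2.isDiag_map π.injective).1 h), fun v hv => ?_⟩
    obtain ⟨w, hw, rfl⟩ := Sym2.mem_map.1 hv
    exact hπ w ((hN.1 e₀ he₀).2 w hw)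
  · intro e he f hf v hve hvf
    obtain ⟨e₀, he₀, rfl⟩ := Finset.mem_image.1 he
    obtain ⟨f₀, hf₀, rfl⟩ := Finset.mem_image.1 hf
    obtain ⟨w, hw, rfl⟩ := Sym2.mem_map.1 hve
    obtain ⟨w', hw', h⟩ := Sym2.mem_map.1 hvf
    obtain rfl := π.injective h
    rw [hN.2 e₀ he₀ f₀ hf₀ w' hw hw']

theorem image_map_involutive (π : Equiv.Perm (Fin n)) (hπ : Function.Involutive π) :
    Function.Involutive fun N : Finset (Sym2 (Fin n)) => N.image (Sym2.map π) := by
  intro N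
  simp only [Finset.image_image]
  have : Sym2.map π ∘ Sym2.map π = id := by
    rw [← Sym2.map_comp, hπ.comp_self, Sym2.map_id]
  rw [this, Finset.image_id]

theorem mem_maximalMatchings {S : Finset (Fin n)} {N : Finset (Sym2 (Fin n))} :
    N ∈ maximalMatchings S ↔ Maximal (IsMatchingOf S) N := by simp [maximalMatchings]

/-- An involution of `S` acts as an inclusion-preserving involution on matchings, so a larger
matching of the image could be carried back. -/
theorem map_mem_maximalMatchings {S : Finset (Fin n)} {N : Finset (Sym2 (Fin n))}
    (hN : N ∈ maximalMatchings S) (π : Equiv.Perm (Fin n)) (hπ : ∀ v ∈ S, π v ∈ S)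
    (hinv : Function.Involutive π) : N.image (Sym2.map π) ∈ maximalMatchings S := by
  rw [mem_maximalMatchings] at hN ⊢
  refine ⟨hN.1.map π hπ, fun N' hN' hle => ?_⟩
  have h2 := hN.2 (hN'.map π hπ) (by
    have := Finset.image_subset_image (f := Sym2.map π) hle
    exact (image_map_involutive π hinv N).symm.subset.trans this)
  have := Finset.image_subset_image (f := Sym2.map π) h2
  exact (image_map_involutive π hinv N').symm.subset.trans this

open Classical in
/-- A given edge of a clique on at least three vertices lies in at most half of the maximal
matchings. -/
theorem two_mul_card_maximalMatchings_mem_le {S : Finset (Fin n)} (hS : 3 ≤ S.card) {a b : Fin n}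
    (hb : b ∈ S) :
    2 * ((maximalMatchings S).filter (s(a, b) ∈ ·)).card ≤ (maximalMatchings S).card := by
  by_cases hab : a = b
  · subst hab
    have : (maximalMatchings S).filter (s(a, a) ∈ ·) = ∅ := by
      refine Finset.filter_eq_empty_iff.2 fun N hN h => ?_
      exact ((mem_maximalMatchings.1 hN).1.1 _ h).1 (by simp)
    simp [this]
  obtain ⟨x, hx, hxa, hxb⟩ : ∃ x ∈ S, x ≠ a ∧ x ≠ b := by
    by_contra! h
    have : S ⊆ {a, b} := fun x hx => by
      rw [Finset.mem_insert, Finset.mem_singleton]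
      by_cases hxa : x = a
      · exact Or.inl hxa
      · exact Or.inr (h x hx hxa)
    have := (Finset.card_le_card this).trans Finset.card_le_two
    omega
  -- Swapping `b` with a third vertex `x` injects the matchings that contain `ab` into those that
  -- contain `ax`, and the latter do not contain `ab`.
  set π := Equiv.swap b x
  have hinv : Function.Involutive π := Equiv.swap_apply_self b x
  have hπ : ∀ v ∈ S, π v ∈ S := by
    intro v hv
    simp only [π, Equiv.swap_apply_def]
    split_ifs <;> assumption
  have hle : ((maximalMatchings S).filter (s(a, b) ∈ ·)).card ≤
      ((maximalMatchings S).filter (¬ s(a, b) ∈ ·)).card := by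
    refine Finset.card_le_card_of_injOn (fun N => N.image (Sym2.map π)) ?_
      (image_map_involutive π hinv).injective.injOn
    intro N hN
    rw [Finset.mem_coe, Finset.mem_filter] at hN ⊢
    have hmem := map_mem_maximalMatchings hN.1 π hπ hinv
    refine ⟨hmem, fun h => ?_⟩
    have h2 : s(a, x) ∈ N.image (Sym2.map π) :=
      Finset.mem_image.2 ⟨_, hN.2, by
        rw [Sym2.map_mk, Equiv.swap_apply_left, Equiv.swap_apply_of_ne_of_ne hab (Ne.symm hxa)]⟩
    have := (mem_maximalMatchings.1 hmem).1.2 _ h _ h2 a (by simp) (by simp)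
    rw [Sym2.eq_iff] at this
    rcases this with ⟨-, h⟩ | ⟨h, -⟩
    · exact hxb h.symm
    · exact hxa h.symm
  have := Finset.card_filter_add_card_filter_not (s := maximalMatchings S) (s(a, b) ∈ ·)
  omega

end Matchings

/-! ### Expectations -/

section Expect

variable {α β : Type*}

/-- The expectation of a nonnegative function. -/
def expect (p : PMF α) (f : α → ℝ≥0∞) : ℝ≥0∞ := ∑' a, p a * f a

theorem expect_pure (a : α) (f : α → ℝ≥0∞) : expect (PMF.pure a) f = f a := by
  classical
  rw [expect, tsum_eq_single a]
  · simp
  · intro b hb; simp [PMF.pure_apply, hb]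

theorem expect_bind (p : PMF α) (q : α → PMF β) (f : β → ℝ≥0∞) :
    expect (p.bind q) f = expect p fun a => expect (q a) f := by
  simp only [expect, PMF.bind_apply, ← ENNReal.tsum_mul_right, ← ENNReal.tsum_mul_left]
  rw [ENNReal.tsum_comm]
  simp_rw [mul_assoc]

theorem expect_map (p : PMF α) (g : α → β) (f : β → ℝ≥0∞) :
    expect (p.map g) f = expect p (f ∘ g) := by
  rw [PMF.map, expect_bind]
  simp only [Function.comp_apply, expect_pure]
  rfl

theorem expect_mono (p : PMF α) {f g : α → ℝ≥0∞} (h : ∀ a ∈ p.support, f a ≤ g a) :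
    expect p f ≤ expect p g := by
  refine ENNReal.tsum_le_tsum fun a => ?_
  by_cases ha : a ∈ p.support
  · exact mul_le_mul_right (h a ha) _
  · simp [(PMF.apply_eq_zero_iff p a).2 ha]

theorem expect_add (p : PMF α) (f g : α → ℝ≥0∞) :
    expect p (fun a => f a + g a) = expect p f + expect p g := by
  simp only [expect, mul_add, ENNReal.tsum_add]

theorem expect_const (p : PMF α) (c : ℝ≥0∞) : expect p (fun _ => c) = c := by
  rw [expect, ENNReal.tsum_mul_right, p.tsum_coe, one_mul]

theorem expect_const_mul (p : PMF α) (c : ℝ≥0∞) (f : α → ℝ≥0∞) :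
    expect p (fun a => c * f a) = c * expect p f := by
  rw [expect, expect, ← ENNReal.tsum_mul_left]
  exact tsum_congr fun a => by ring

/-- Markov's inequality. -/
theorem mul_toOuterMeasure_le_expect (p : PMF α) (f : α → ℝ≥0∞) (c : ℝ≥0∞) :
    c * p.toOuterMeasure {a | c ≤ f a} ≤ expect p f := by
  rw [PMF.toOuterMeasure_apply, ← ENNReal.tsum_mul_left]
  refine ENNReal.tsum_le_tsum fun a => ?_
  rw [Set.indicator_apply]
  split_ifs with h
  · rw [mul_comm]; exact mul_le_mul_right h _
  · simp

open Classical in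
theorem expect_randomMatching_mem_le {n : ℕ} {S : Finset (Fin n)} (hS : 3 ≤ S.card) {a b : Fin n}
    (hb : b ∈ S) :
    2 * expect (randomMatching S) (fun N => if s(a, b) ∈ N then 1 else 0) ≤ 1 := by
  have h := two_mul_card_maximalMatchings_mem_le hS (a := a) hb
  have hne : (maximalMatchings S).card ≠ 0 := (maximalMatchings_nonempty S).card_pos.ne'
  have : expect (randomMatching S) (fun N => if s(a, b) ∈ N then 1 else 0) =
      ((maximalMatchings S).filter (s(a, b) ∈ ·)).card * ((maximalMatchings S).card : ℝ≥0∞)⁻¹ := by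
    rw [expect, tsum_eq_sum (s := (maximalMatchings S).filter (s(a, b) ∈ ·))]
    · rw [← nsmul_eq_mul, ← Finset.sum_const]
      refine Finset.sum_congr rfl fun N hN => ?_
      rw [Finset.mem_filter] at hN
      rw [randomMatching, PMF.uniformOfFinset_apply_of_mem _ hN.1, if_pos hN.2, mul_one]
    · intro N hN
      by_cases h1 : s(a, b) ∈ N
      · rw [randomMatching, PMF.uniformOfFinset_apply_of_notMem, zero_mul]
        exact fun h2 => hN (Finset.mem_filter.2 ⟨h2, h1⟩)
      · simp [h1]
  rw [this, ← mul_assoc, ← div_eq_mul_inv]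
  refine ENNReal.div_le_of_le_mul ?_
  rw [one_mul]
  exact_mod_cast h

end Expect

/-! ### The number of repeated draws -/

section RandomRuns

variable {m n : ℕ} {R : RepMatrix m n}

/-- The next configuration, when no matching is drawn. -/
def next (R : RepMatrix m n) (s : Config m n) : Config m n :=
  match s.stack with
  | [] => s
  | .assign x e :: rest =>
      { s with stack := rest, time := s.time + 1, vars := Function.update s.vars x (s.eval R e) }
  | .store a i e :: rest =>
      { s with
        stack := rest
        time := s.time + 1
        arrs := Function.update s.arrs a
          (Function.update (s.arrs a) (s.eval R i) (s.eval R e)) }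
  | .seq c d :: rest => { s with stack := c :: d :: rest, time := s.time + 1 }
  | .ite e c d :: rest =>
      { s with stack := (if s.eval R e ≠ 0 then c else d) :: rest, time := s.time + 1 }
  | .loop e c :: rest =>
      { s with
        stack := if s.eval R e ≠ 0 then c :: .loop e c :: rest else rest, time := s.time + 1 }
  | .draw _ :: _ => s

/-- The configuration is about to draw a matching. -/
def AtDraw (s : Config m n) : Prop := ∃ e rest, s.stack = .draw e :: rest

theorem step_eq_pure_next {s : Config m n} (h : ¬ AtDraw s) : step R s = PMF.pure (next R s) := by
  unfold step next
  rcases hs : s.stack with _ | ⟨c, rest⟩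
  · rfl
  · cases c <;> first | rfl | exact absurd ⟨_, _, hs⟩ h

theorem next_fields (R : RepMatrix m n) (s : Config m n) :
    (next R s).matching = s.matching ∧ (next R s).drawn = s.drawn ∧
      (next R s).rounds = s.rounds := by
  unfold next
  rcases hs : s.stack with _ | ⟨c, rest⟩
  · exact ⟨rfl, rfl, rfl⟩
  · cases c <;> exact ⟨rfl, rfl, rfl⟩

theorem step_draw {s : Config m n} {e : Expr} {rest : List Cmd} (hs : s.stack = .draw e :: rest)
    (h : s.eval R e < m) :
    step R s = (randomMatching (labelSet R ⟨s.eval R e, h⟩)).map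
      (s.redraw R rest ⟨s.eval R e, h⟩) := by
  unfold step
  rw [hs]
  simp [h]

theorem step_halted {s : Config m n} (hs : s.stack = []) : step R s = PMF.pure s := by
  unfold step
  rw [hs]

theorem mem_support_randomMatching {S : Finset (Fin n)} {N : Finset (Sym2 (Fin n))} :
    N ∈ (randomMatching S).support ↔ N ∈ maximalMatchings S := by
  simp [randomMatching]

theorem runFrom_add (s : Config m n) (t u : ℕ) :
    runFrom R s (t + u) = (runFrom R s t).bind fun s' => runFrom R s' u := by
  induction u with
  | zero => simp [runFrom]
  | succ u ih => rw [← add_assoc, runFrom, ih, PMF.bind_bind]; rfl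

theorem runFrom_halted {s : Config m n} (hs : s.stack = []) (t : ℕ) :
    runFrom R s t = PMF.pure s := by
  induction t with
  | zero => rfl
  | succ t ih => rw [runFrom, ih, PMF.pure_bind, step_halted hs]

variable {P : Cmd}

theorem Reachable.of_runFrom {s s' : Config m n} (hs : Reachable R P s) {t : ℕ}
    (h : s' ∈ (runFrom R s t).support) : Reachable R P s' := by
  obtain ⟨u, hu⟩ := hs
  refine ⟨u + t, ?_⟩
  rw [run, runFrom_add]
  exact (PMF.mem_support_bind_iff _ _ _).2 ⟨s, hu, h⟩

theorem reachable_induction {Q : Config m n → Prop} (h0 : Q (start P m n))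
    (hstep : ∀ s, Reachable R P s → Q s → ∀ s' ∈ (step R s).support, Q s') {s : Config m n}
    (hs : Reachable R P s) : Q s := by
  obtain ⟨t, ht⟩ := hs
  induction t generalizing s with
  | zero =>
    have : s = start P m n := by simpa [run, runFrom] using ht
    rwa [this]
  | succ t ih =>
    obtain ⟨s₀, h₀, h1⟩ := (PMF.mem_support_bind_iff _ _ _).1 ht
    exact hstep s₀ ⟨t, h₀⟩ (ih h₀) s h1

theorem Config.redraw_matching_isMatchingOf {s : Config m n}
    (hM : ∀ ℓ, IsMatchingOf (labelSet R ℓ) (s.matching ℓ)) (rest : List Cmd) {ℓ : Fin m}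
    {N : Finset (Sym2 (Fin n))} (hN : N ∈ maximalMatchings (labelSet R ℓ)) (ℓ' : Fin m) :
    IsMatchingOf (labelSet R ℓ') ((s.redraw R rest ℓ N).matching ℓ') := by
  by_cases h : ℓ' = ℓ
  · subst h
    simpa [Config.redraw] using (mem_maximalMatchings.1 hN).1
  · simpa [Config.redraw, h] using hM ℓ'

theorem Implements.exists_mayDraw (hP : Implements P) {s : Config m n} (hs : Reachable R P s)
    (hd : AtDraw s) : ∃ ℓ rest, MayDraw R s ℓ ∧
      step R s = (randomMatching (labelSet R ℓ)).map (s.redraw R rest ℓ) := by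
  obtain ⟨e, rest, h⟩ := hd
  obtain ⟨hlt, hmay⟩ := hP.draws m n R s hs e rest h
  exact ⟨_, rest, hmay, step_draw h hlt⟩

theorem Implements.isMatchingOf (hP : Implements P) {s : Config m n} (hs : Reachable R P s)
    (ℓ : Fin m) : IsMatchingOf (labelSet R ℓ) (s.matching ℓ) := by
  revert ℓ
  refine reachable_induction (P := P) (R := R)
    (Q := fun s => ∀ ℓ, IsMatchingOf (labelSet R ℓ) (s.matching ℓ)) ?_ ?_ hs
  · intro ℓ
    constructor <;> simp [start]
  · intro s hs hM s' hs'
    by_cases hd : AtDraw s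
    · obtain ⟨ℓ, rest, -, hstep⟩ := hP.exists_mayDraw hs hd
      rw [hstep, PMF.mem_support_map_iff] at hs'
      obtain ⟨N, hN, rfl⟩ := hs'
      exact Config.redraw_matching_isMatchingOf hM rest (mem_support_randomMatching.1 hN)
    · rw [step_eq_pure_next hd] at hs'
      obtain rfl : s' = next R s := by simpa using hs'
      rw [(next_fields R s).1]
      exact hM

open Classical in
/-- The number of rounds so far plus a bound for the expected number of further rounds. -/
def potential (R : RepMatrix m n) (s : Config m n) : ℝ≥0∞ :=
  s.rounds + 2 * (if s.drawn = Finset.univ then ((badSets R s.matching).card : ℝ≥0∞)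
    else 2 ^ coreCard R)

theorem potential_le {s : Config m n} (hM : ∀ ℓ, IsMatchingOf (labelSet R ℓ) (s.matching ℓ)) :
    potential R s ≤ s.rounds + 2 * 2 ^ coreCard R := by
  unfold potential
  gcongr
  split_ifs
  · exact_mod_cast card_badSets_le hM
  · exact le_rfl

/-- A repeated draw adds one to the number of rounds, and with probability at least 1/2 it removes a
bad label set, which counts twice. So the potential is a supermartingale for every rule of
selection. -/
theorem Implements.expect_step_potential_le (hP : Implements P)
    (hR : ∀ l, ¬ BadPath (incGraph R) l) {s : Config m n} (hs : Reachable R P s) :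
    expect (step R s) (potential R) ≤ potential R s := by
  classical
  by_cases hd : AtDraw s
  swap
  · rw [step_eq_pure_next hd, expect_pure]
    obtain ⟨h1, h2, h3⟩ := next_fields R s
    simp [potential, h1, h2, h3]
  have hM := hP.isMatchingOf hs
  obtain ⟨ℓ, rest, hmay, hstep⟩ := hP.exists_mayDraw hs hd
  rw [hstep, expect_map]
  rcases hmay with hℓ | ⟨hdr, hstr, σ, hσ, i, rfl⟩
  · have hne : s.drawn ≠ Finset.univ := fun h => hℓ (h ▸ Finset.mem_univ _)
    -- Before all matchings are drawn, the potential contains the largest possible number of bad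
    -- label sets, so a first draw cannot raise it.
    refine (expect_mono _ fun N hN => ?_).trans_eq (expect_const _ (potential R s))
    have hN' := Config.redraw_matching_isMatchingOf hM rest (mem_support_randomMatching.1 hN)
    have hrounds : (s.redraw R rest ℓ N).rounds = s.rounds := by simp [Config.redraw, hℓ]
    refine (potential_le hN').trans_eq ?_
    rw [potential, if_neg hne, hrounds]
  · obtain ⟨b, hb⟩ : ∃ b, (badSets R s.matching).card = b + 1 :=
      Nat.exists_eq_succ_of_ne_zero (Finset.card_ne_zero_of_mem (mem_badSets.2 ⟨σ, hσ, rfl⟩))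
    let f : Finset (Sym2 (Fin n)) → ℝ≥0∞ :=
      fun N => if s(σ.vert i.castSucc, σ.vert i.succ) ∈ N then 1 else 0
    have hle : ∀ N ∈ (randomMatching (labelSet R (σ.lab i))).support,
        (potential R ∘ s.redraw R rest (σ.lab i)) N ≤
          (s.rounds + 1 + 2 * b : ℝ≥0∞) + 2 * f N := by
      intro N hN
      have hNm := (mem_maximalMatchings.1 (mem_support_randomMatching.1 hN)).1
      obtain ⟨h1, h2⟩ := badSets_update_subset hR hM hσ i hNm
      have e1 : (s.redraw R rest (σ.lab i) N).rounds = s.rounds + 1 := by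
        simp [Config.redraw, hdr]
      have e2 : (s.redraw R rest (σ.lab i) N).drawn = Finset.univ := by
        simp [Config.redraw, hdr]
      have e3 : (s.redraw R rest (σ.lab i) N).matching =
        Function.update s.matching (σ.lab i) N := rfl
      simp only [Function.comp_apply, potential, e1, e2, e3, if_true, f]
      rw [add_assoc _ (2 * (b : ℝ≥0∞)), ← mul_add]
      push_cast
      gcongr
      split_ifs with hmem
      · have := Finset.card_le_card h1
        rw [hb] at this
        exact_mod_cast this
      · have : (badSets R (Function.update s.matching (σ.lab i) N)).card < b + 1 := by
          rw [← hb]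
          exact Finset.card_lt_card ⟨h1, fun h => h2 hmem (h (mem_badSets.2 ⟨σ, hσ, rfl⟩))⟩
        rw [add_zero]
        exact_mod_cast Nat.lt_succ_iff.1 this
    refine (expect_mono _ hle).trans ?_
    rw [expect_add, expect_const, expect_const_mul]
    refine (add_le_add_right (expect_randomMatching_mem_le hstr (hσ.1.2 i).2) _).trans_eq ?_
    simp only [potential, hdr, if_true, hb]
    push_cast
    ring

/-- Markov's inequality for the potential, whose expectation never exceeds the bound for its initial
value. -/
theorem Implements.rounds_tail (hP : Implements P) (hR : ∀ l, ¬ BadPath (incGraph R) l)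
    (t K : ℕ) :
    (K : ℝ≥0∞) * (run R P t).toOuterMeasure {s | K ≤ s.rounds} ≤ 2 ^ (coreCard R + 1) := by
  have hexp : expect (run R P t) (potential R) ≤ 2 ^ (coreCard R + 1) := by
    induction t with
    | zero =>
      rw [run, runFrom, expect_pure]
      refine (potential_le fun ℓ => ?_).trans_eq (by simp [start, pow_succ'])
      constructor <;> simp [start]
    | succ t ih =>
      refine le_trans ?_ ih
      rw [run, runFrom, expect_bind]
      exact expect_mono _ fun s hs => hP.expect_step_potential_le hR ⟨t, hs⟩
  refine le_trans ?_ hexp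
  refine le_trans ?_ (mul_toOuterMeasure_le_expect _ _ (K : ℝ≥0∞))
  refine mul_le_mul_right ((run R P t).toOuterMeasure.mono fun s (hs : K ≤ s.rounds) => ?_) _
  exact ((Nat.cast_le (α := ℝ≥0∞)).2 hs).trans le_self_add

/-! ### Termination with probability one. -/

/-- The number of draws so far. -/
def Config.draws (s : Config m n) : ℕ := s.drawn.card + s.rounds

theorem Config.draws_redraw (s : Config m n) (rest : List Cmd) (ℓ : Fin m)
    (N : Finset (Sym2 (Fin n))) : (s.redraw R rest ℓ N).draws = s.draws + 1 := by
  by_cases h : ℓ ∈ s.drawn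
  · simp [Config.draws, Config.redraw, h]; ring
  · simp [Config.draws, Config.redraw, h]; ring

theorem Config.draws_next (s : Config m n) : (next R s).draws = s.draws := by
  simp [Config.draws, next_fields]

theorem finite_support_step (R : RepMatrix m n) (s : Config m n) : (step R s).support.Finite := by
  by_cases hd : AtDraw s
  · obtain ⟨e, rest, hs⟩ := hd
    by_cases h : s.eval R e < m
    · rw [step_draw hs h, PMF.support_map]
      exact (Set.toFinite _).image _
    · unfold step
      rw [hs]
      simp [h]
  · rw [step_eq_pure_next hd]
    simp

theorem finite_support_runFrom (R : RepMatrix m n) (s : Config m n) (t : ℕ) :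
    (runFrom R s t).support.Finite := by
  induction t with
  | zero => simp [runFrom]
  | succ t ih =>
    rw [runFrom, PMF.support_bind]
    exact ih.biUnion fun s _ => finite_support_step R s

theorem Implements.draws_le_of_step (hP : Implements P) {s : Config m n} (hs : Reachable R P s)
    {s' : Config m n} (hs' : s' ∈ (step R s).support) : s.draws ≤ s'.draws := by
  by_cases hd : AtDraw s
  · obtain ⟨ℓ, rest, -, hstep⟩ := hP.exists_mayDraw hs hd
    rw [hstep, PMF.mem_support_map_iff] at hs'
    obtain ⟨N, -, rfl⟩ := hs'
    rw [Config.draws_redraw]; omega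
  · rw [step_eq_pure_next hd] at hs'
    obtain rfl : s' = next R s := by simpa using hs'
    rw [Config.draws_next]

theorem Implements.persist (hP : Implements P) {s : Config m n} (hs : Reachable R P s) {k : ℕ}
    (h : s.stack = [] ∨ k ≤ s.draws) (t : ℕ) {s' : Config m n}
    (hs' : s' ∈ (runFrom R s t).support) : s'.stack = [] ∨ k ≤ s'.draws := by
  induction t generalizing s' with
  | zero =>
    obtain rfl : s' = s := by simpa [runFrom] using hs'
    exact h
  | succ t ih =>
    obtain ⟨s₀, h₀, h1⟩ := (PMF.mem_support_bind_iff _ _ _).1 hs'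
    rcases ih h₀ with h2 | h2
    · rw [step_halted h2] at h1
      obtain rfl : s' = s₀ := by simpa using h1
      exact Or.inl h2
    · exact Or.inr (h2.trans (hP.draws_le_of_step (hs.of_runFrom h₀) h1))

theorem runFrom_eq_pure_iterate {s : Config m n} {t : ℕ}
    (h : ∀ i < t, ¬ AtDraw ((next R)^[i] s)) : runFrom R s t = PMF.pure ((next R)^[t] s) := by
  induction t with
  | zero => rfl
  | succ t ih =>
    rw [runFrom, ih fun i hi => h i (by omega), PMF.pure_bind, step_eq_pure_next (h t (by omega)),
      Function.iterate_succ_apply']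

theorem Config.draws_iterate (s : Config m n) (t : ℕ) : ((next R)^[t] s).draws = s.draws := by
  induction t with
  | zero => rfl
  | succ t ih => rw [Function.iterate_succ_apply', Config.draws_next, ih]

/-- Between draws the machine is deterministic, so the configuration provided by `progress` lies on
the only possible run, and the first halt or draw on it comes at a fixed time. -/
theorem Implements.exists_next_draw (hP : Implements P) {s : Config m n} (hs : Reachable R P s) :
    ∃ T, ∀ s' ∈ (runFrom R s T).support, s'.stack = [] ∨ s.draws + 1 ≤ s'.draws := by
  classical
  have hex : ∃ t, ((next R)^[t] s).stack = [] ∨ AtDraw ((next R)^[t] s) := by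
    by_contra! hcon
    obtain ⟨t, s', hs', h⟩ := hP.progress m n R s hs
    rw [runFrom_eq_pure_iterate fun i _ => (hcon i).2] at hs'
    obtain rfl : s' = (next R)^[t] s := by simpa using hs'
    rcases h with h | h
    · exact (hcon t).1 h
    · exact (hcon t).2 h
  obtain ⟨ht, hmin⟩ := And.intro (Nat.find_spec hex) fun i => Nat.find_min (m := i) hex
  set t := Nat.find hex
  have hpure : runFrom R s t = PMF.pure ((next R)^[t] s) :=
    runFrom_eq_pure_iterate fun i hi h => hmin i hi (Or.inr h)
  by_cases hh : ((next R)^[t] s).stack = []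
  · refine ⟨t, fun s' hs' => Or.inl ?_⟩
    rw [hpure] at hs'
    obtain rfl : s' = (next R)^[t] s := by simpa using hs'
    exact hh
  · have hd := ht.resolve_left hh
    have hreach : Reachable R P ((next R)^[t] s) := hs.of_runFrom (t := t) (by rw [hpure]; simp)
    obtain ⟨ℓ, rest, -, hstep⟩ := hP.exists_mayDraw hreach hd
    refine ⟨t + 1, fun s' hs' => Or.inr ?_⟩
    rw [runFrom, hpure, PMF.pure_bind, hstep, PMF.mem_support_map_iff] at hs'
    obtain ⟨N, -, rfl⟩ := hs'
    rw [Config.draws_redraw, Config.draws_iterate]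

/-- After finitely many steps only finitely many configurations are possible, so their waiting times
for the next draw have a common bound. -/
theorem Implements.exists_time (hP : Implements P) (R : RepMatrix m n) (k : ℕ) :
    ∃ T, ∀ s ∈ (run R P T).support, s.stack = [] ∨ k ≤ s.draws := by
  induction k with
  | zero => exact ⟨0, fun _ _ => Or.inr (Nat.zero_le _)⟩
  | succ k ih =>
    obtain ⟨T, hT⟩ := ih
    have hfin := finite_support_runFrom R (start P m n) T
    have hch : ∀ s : Config m n, ∃ u, s ∈ (run R P T).support →
        ∀ s' ∈ (runFrom R s u).support, s'.stack = [] ∨ s.draws + 1 ≤ s'.draws := by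
      intro s
      by_cases hs : s ∈ (run R P T).support
      · obtain ⟨u, hu⟩ := hP.exists_next_draw ⟨T, hs⟩
        exact ⟨u, fun _ => hu⟩
      · exact ⟨0, fun h => absurd h hs⟩
    choose u hu using hch
    obtain ⟨U, hU⟩ := (hfin.image u).bddAbove
    refine ⟨T + U, fun s' hs' => ?_⟩
    rw [run, runFrom_add] at hs'
    obtain ⟨s, hs, hs'⟩ := (PMF.mem_support_bind_iff _ _ _).1 hs'
    have hle : u s ≤ U := hU ⟨s, hs, rfl⟩
    obtain ⟨w, rfl⟩ := Nat.exists_eq_add_of_le hle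
    rw [runFrom_add] at hs'
    obtain ⟨s₁, hs₁, hs'⟩ := (PMF.mem_support_bind_iff _ _ _).1 hs'
    have hreach : Reachable R P s := ⟨T, hs⟩
    refine hP.persist (hreach.of_runFrom hs₁) ?_ w hs'
    rcases hT s hs with h | h
    · rw [runFrom_halted h] at hs₁
      obtain rfl : s₁ = s := by simpa using hs₁
      exact Or.inl h
    · rcases hu s hs s₁ hs₁ with h' | h'
      · exact Or.inl h'
      · exact Or.inr (by omega)

theorem one_le_toOuterMeasure_add {α : Type*} (p : PMF α) {A B : Set α}
    (h : ∀ a ∈ p.support, a ∈ A ∨ a ∈ B) : 1 ≤ p.toOuterMeasure A + p.toOuterMeasure B := by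
  calc (1 : ℝ≥0∞) = p.toOuterMeasure (A ∪ B) :=
        ((PMF.toOuterMeasure_apply_eq_one_iff _ _).2 h).symm
    _ ≤ _ := measure_union_le _ _

theorem toOuterMeasure_halted_mono (R : RepMatrix m n) (P : Cmd) (T t u : ℕ) :
    (run R P t).toOuterMeasure {s | s.stack = [] ∧ s.time ≤ T} ≤
      (run R P (t + u)).toOuterMeasure {s | s.stack = [] ∧ s.time ≤ T} := by
  rw [run, run, runFrom_add, PMF.toOuterMeasure_bind_apply, PMF.toOuterMeasure_apply]
  refine ENNReal.tsum_le_tsum fun s => ?_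
  rw [Set.indicator_apply]
  split_ifs with h
  · rw [runFrom_halted h.1, PMF.toOuterMeasure_pure_apply, if_pos h, mul_one]
  · exact zero_le

theorem toOuterMeasure_halted_le_terminationProb (R : RepMatrix m n) (P : Cmd) (t : ℕ) :
    (run R P t).toOuterMeasure {s | s.stack = []} ≤ terminationProb R P := by
  obtain ⟨T, hT⟩ := ((finite_support_runFrom R (start P m n) t).image Config.time).bddAbove
  calc (run R P t).toOuterMeasure {s | s.stack = []} ≤
      (run R P t).toOuterMeasure {s | s.stack = [] ∧ s.time ≤ T + t} := by
        refine PMF.toOuterMeasure_mono _ ?_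
        rintro s ⟨h, hs⟩
        exact ⟨h, (hT ⟨s, hs, rfl⟩).trans (by omega)⟩
    _ ≤ haltProb R P (T + t) := by
        rw [haltProb]
        conv_rhs => rw [add_comm T t]
        exact (toOuterMeasure_halted_mono R P _ t T).trans (by rw [add_comm T t])
    _ ≤ _ := le_iSup (haltProb R P) _

theorem Implements.one_le_haltRoundsProb_add (hP : Implements P)
    (hR : ∀ l, ¬ BadPath (incGraph R) l) (K : ℕ) :
    1 ≤ haltRoundsProb R P K + 2 ^ (coreCard R + 1) / ((K + 1 : ℕ) : ℝ≥0∞) ∧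
    1 ≤ terminationProb R P + 2 ^ (coreCard R + 1) / ((K + 1 : ℕ) : ℝ≥0∞) := by
  -- At most `m` draws are first draws, so m + K + 1 draws include at least K + 1 rounds.
  obtain ⟨T, hT⟩ := hP.exists_time R (m + K + 1)
  have h1 := one_le_toOuterMeasure_add (run R P T) (A := {s | s.stack = [] ∧ s.rounds ≤ K})
    (B := {s | K + 1 ≤ s.rounds}) (by
      intro s hs
      by_cases hK : K + 1 ≤ s.rounds
      · exact Or.inr hK
      · refine Or.inl ⟨(hT s hs).resolve_right fun h => hK ?_, by omega⟩
        have := Finset.card_le_univ s.drawn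
        simp only [Fintype.card_fin] at this
        simp only [Config.draws] at h
        omega)
  have h2 : (run R P T).toOuterMeasure {s | K + 1 ≤ s.rounds} ≤
      2 ^ (coreCard R + 1) / ((K + 1 : ℕ) : ℝ≥0∞) := by
    rw [ENNReal.le_div_iff_mul_le (by simp) (by simp), mul_comm]
    exact hP.rounds_tail hR T (K + 1)
  refine ⟨h1.trans (add_le_add (le_iSup (fun t => (run R P t).toOuterMeasure
    {s | s.stack = [] ∧ s.rounds ≤ K}) T) h2), h1.trans (add_le_add ?_ h2)⟩
  refine le_trans ?_ (toOuterMeasure_halted_le_terminationProb R P T)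
  exact (run R P T).toOuterMeasure.mono fun s hs => hs.1

theorem terminationProb_le_one (R : RepMatrix m n) (P : Cmd) : terminationProb R P ≤ 1 := by
  refine iSup_le fun T => ?_
  calc haltProb R P T ≤ (run R P T).toOuterMeasure Set.univ :=
        (run R P T).toOuterMeasure.mono (Set.subset_univ _)
    _ = 1 := (PMF.toOuterMeasure_apply_eq_one_iff _ _).2 (Set.subset_univ _)

/-- For fixed `R` the probability of more than `K` rounds tends to 0 as `K` grows. -/
theorem Implements.terminationProb_eq_one (hP : Implements P)
    (hR : ∀ l, ¬ BadPath (incGraph R) l) : terminationProb R P = 1 := by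
  refine le_antisymm (terminationProb_le_one R P) ?_
  have hlim : Tendsto (fun K : ℕ => terminationProb R P +
      2 ^ (coreCard R + 1) / ((K + 1 : ℕ) : ℝ≥0∞)) atTop (𝓝 (terminationProb R P + 0)) := by
    refine tendsto_const_nhds.add ?_
    have := ENNReal.Tendsto.const_div (a := (2 : ℝ≥0∞) ^ (coreCard R + 1))
      (ENNReal.tendsto_nat_nhds_top.comp (tendsto_add_atTop_nat 1))
      (Or.inr (ENNReal.pow_ne_top (by simp)))
    simpa [Function.comp_def] using this
  rw [add_zero] at hlim
  exact ge_of_tendsto' hlim fun K => (hP.one_le_haltRoundsProb_add hR K).2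

end RandomRuns

/-! ### Deterministic runs of the machine -/

section Machine

variable {m n : ℕ} {R : RepMatrix m n}

/-- The next step is neither a draw nor a halt. -/
def Quiet (s : Config m n) : Prop := s.stack ≠ [] ∧ ¬ AtDraw s

/-- The machine passes from `s` to `s'` in `t` steps without drawing or halting in between. -/
def Leads (R : RepMatrix m n) (s s' : Config m n) (t : ℕ) : Prop :=
  (∀ i < t, Quiet ((next R)^[i] s)) ∧ (next R)^[t] s = s'

theorem Leads.refl (s : Config m n) : Leads R s s 0 := ⟨by simp, rfl⟩

theorem Leads.trans {s s' s'' : Config m n} {t u : ℕ} (h : Leads R s s' t) (h' : Leads R s' s'' u) :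
    Leads R s s'' (t + u) := by
  obtain ⟨h1, rfl⟩ := h
  obtain ⟨h2, rfl⟩ := h'
  refine ⟨fun i hi => ?_, by rw [add_comm, Function.iterate_add_apply]⟩
  by_cases hit : i < t
  · exact h1 i hit
  · have := h2 (i - t) (by omega)
    rwa [← Function.iterate_add_apply, Nat.sub_add_cancel (by omega)] at this

theorem Leads.single {s : Config m n} (h : Quiet s) : Leads R s (next R s) 1 :=
  ⟨fun i hi => by obtain rfl : i = 0 := by omega
                  exact h, rfl⟩

/-- The value of an expression. -/
def value (R : RepMatrix m n) (M : Fin m → Finset (Sym2 (Fin n))) (v : ℕ → ℕ) (A : ℕ → ℕ → ℕ) :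
    Expr → ℕ
  | .const k => k
  | .var x => v x
  | .get a i => A a (value R M v A i)
  | .table t i j => tableValue R M t (value R M v A i) (value R M v A j)
  | .add e f => value R M v A e + value R M v A f
  | .sub e f => value R M v A e - value R M v A f

theorem Config.eval_eq (s : Config m n) (e : Expr) :
    s.eval R e = value R s.matching s.vars s.arrs e := by
  induction e with
  | const k => rfl
  | var x => rfl
  | get a i ih => simp [Config.eval, value, ih]
  | table t i j ih1 ih2 => simp [Config.eval, value, ih1, ih2]
  | add e f ih1 ih2 => simp [Config.eval, value, ih1, ih2]
  | sub e f ih1 ih2 => simp [Config.eval, value, ih1, ih2]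

/-- The command `c` takes the memory `v, A` to `v', A'` in time `t`, without drawing. -/
def Runs (R : RepMatrix m n) (M : Fin m → Finset (Sym2 (Fin n))) (c : Cmd) (v : ℕ → ℕ)
    (A : ℕ → ℕ → ℕ) (v' : ℕ → ℕ) (A' : ℕ → ℕ → ℕ) (t : ℕ) : Prop :=
  ∀ (s : Config m n) (rest : List Cmd), s.stack = c :: rest → s.matching = M → s.vars = v →
    s.arrs = A →
      Leads R s { s with stack := rest, vars := v', arrs := A', time := s.time + t } t

variable {M : Fin m → Finset (Sym2 (Fin n))} {v v₁ v₂ : ℕ → ℕ} {A A₁ A₂ : ℕ → ℕ → ℕ}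

theorem runs_assign (x : ℕ) (e : Expr) :
    Runs R M (.assign x e) v A (Function.update v x (value R M v A e)) A 1 := by
  rintro s rest hs rfl rfl rfl
  have hq : Quiet s := ⟨by simp [hs], by rintro ⟨e, r, h⟩; rw [hs] at h; cases h⟩
  convert Leads.single (R := R) hq using 1
  unfold next
  rw [hs]
  simp only [Config.eval_eq]

theorem runs_store (a : ℕ) (i e : Expr) :
    Runs R M (.store a i e) v A v (Function.update A a
      (Function.update (A a) (value R M v A i) (value R M v A e))) 1 := by
  rintro s rest hs rfl rfl rfl
  have hq : Quiet s := ⟨by simp [hs], by rintro ⟨e, r, h⟩; rw [hs] at h; cases h⟩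
  convert Leads.single (R := R) hq using 1
  unfold next
  rw [hs]
  simp only [Config.eval_eq]

theorem Runs.seq {c d : Cmd} {t u : ℕ} (h₁ : Runs R M c v A v₁ A₁ t)
    (h₂ : Runs R M d v₁ A₁ v₂ A₂ u) : Runs R M (.seq c d) v A v₂ A₂ (1 + t + u) := by
  rintro s rest hs rfl rfl rfl
  have hq : Quiet s := ⟨by simp [hs], by rintro ⟨e, r, h⟩; rw [hs] at h; cases h⟩
  have hn : next R s = { s with stack := c :: d :: rest, time := s.time + 1 } := by
    unfold next; rw [hs]
  have l1 := Leads.single (R := R) hq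
  rw [hn] at l1
  convert (l1.trans (h₁ _ (d :: rest) rfl rfl rfl rfl)).trans (h₂ _ rest rfl rfl rfl rfl) using 2
  ring

theorem Runs.loop_false {e : Expr} {c : Cmd} (h : value R M v A e = 0) :
    Runs R M (.loop e c) v A v A 1 := by
  rintro s rest hs rfl rfl rfl
  have hq : Quiet s := ⟨by simp [hs], by rintro ⟨e, r, h⟩; rw [hs] at h; cases h⟩
  convert Leads.single (R := R) hq using 1
  unfold next
  rw [hs]
  simp only [Config.eval_eq, h]
  simp

theorem Runs.loop_true {e : Expr} {c : Cmd} {t u : ℕ} (h : value R M v A e ≠ 0)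
    (h₁ : Runs R M c v A v₁ A₁ t) (h₂ : Runs R M (.loop e c) v₁ A₁ v₂ A₂ u) :
    Runs R M (.loop e c) v A v₂ A₂ (1 + t + u) := by
  rintro s rest hs rfl rfl rfl
  have hq : Quiet s := ⟨by simp [hs], by rintro ⟨e, r, h⟩; rw [hs] at h; cases h⟩
  have hn : next R s = { s with stack := c :: .loop e c :: rest, time := s.time + 1 } := by
    unfold next
    rw [hs]
    simp only [Config.eval_eq]
    rw [if_pos h]
  have l1 := Leads.single (R := R) hq
  rw [hn] at l1
  convert (l1.trans (h₁ _ (_ :: rest) rfl rfl rfl rfl)).trans (h₂ _ rest rfl rfl rfl rfl) using 2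
  ring

/-! ### Evaluation of compound expressions -/

/-- A program that computes a number; the argument is the variable for the result, and the program
may also use the variables that follow it. -/
abbrev Code : Type := ℕ → Cmd

/-- In every memory that agrees with `v, A` up to the variables from `d` on, the code computes `x`
within time `t`. -/
def Comp (R : RepMatrix m n) (M : Fin m → Finset (Sym2 (Fin n))) (d : ℕ) (v : ℕ → ℕ)
    (A : ℕ → ℕ → ℕ) (c : Code) (x t : ℕ) : Prop :=
  ∀ d' ≥ d, ∀ v₁, (∀ y < d, v₁ y = v y) → ∃ v₂ u, u ≤ t ∧ Runs R M (c d') v₁ A v₂ A u ∧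
    v₂ d' = x ∧ ∀ y < d', v₂ y = v₁ y

variable {d d₁ d₂ : ℕ}

/-- The memory `d₁, v₁` extends `d, v`. -/
def Ext (d : ℕ) (v : ℕ → ℕ) (d₁ : ℕ) (v₁ : ℕ → ℕ) : Prop := d ≤ d₁ ∧ ∀ y < d, v₁ y = v y

theorem Comp.mono {c : Code} {x t : ℕ} (h : Comp R M d v A c x t) (he : Ext d v d₁ v₁) :
    Comp R M d₁ v₁ A c x t := fun d' hd' w hw =>
  h d' (he.1.trans hd') w fun y hy => (hw y (hy.trans_le he.1)).trans (he.2 y hy)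

theorem Comp.le {c : Code} {x t t' : ℕ} (h : Comp R M d v A c x t) (ht : t ≤ t') :
    Comp R M d v A c x t' := by
  intro d' hd' w hw
  obtain ⟨v₂, u, hu, h'⟩ := h d' hd' w hw
  exact ⟨v₂, u, hu.trans ht, h'⟩

/-- A constant. -/
def cConst (k : ℕ) : Code := fun d => .assign d (.const k)

/-- The value of a variable. -/
def cVar (x : ℕ) : Code := fun d => .assign d (.var x)

/-- An array entry. -/
def cGet (a : ℕ) (i : Code) : Code := fun d => .seq (i d) (.assign d (.get a (.var d)))

/-- A table entry. -/
def cTable (t : Table) (i j : Code) : Code := fun d =>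
  .seq (i d) (.seq (j (d + 1)) (.assign d (.table t (.var d) (.var (d + 1)))))

/-- A sum of two numbers. -/
def cAdd (e f : Code) : Code := fun d =>
  .seq (e d) (.seq (f (d + 1)) (.assign d (.add (.var d) (.var (d + 1)))))

/-- A truncated difference. -/
def cSub (e f : Code) : Code := fun d =>
  .seq (e d) (.seq (f (d + 1)) (.assign d (.sub (.var d) (.var (d + 1)))))

/-- Primitive recursion. -/
def cRec (b base : Code) (body : Code → Code → Code) : Code := fun d =>
  .seq (base d) (.seq (b (d + 1)) (.seq (.assign (d + 2) (.const 0))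
    (.loop (.sub (.var (d + 1)) (.var (d + 2)))
      (.seq (body (cVar (d + 2)) (cVar d) (d + 3))
        (.seq (.assign d (.var (d + 3)))
          (.assign (d + 2) (.add (.var (d + 2)) (.const 1))))))))

theorem comp_const (k : ℕ) : Comp R M d v A (cConst k) k 1 := by
  intro d' hd' w hw
  refine ⟨_, 1, le_rfl, runs_assign _ _, by simp [value], fun y hy => ?_⟩
  rw [Function.update_of_ne hy.ne]

theorem comp_var {x : ℕ} (hx : x < d) : Comp R M d v A (cVar x) (v x) 1 := by
  intro d' hd' w hw
  refine ⟨_, 1, le_rfl, runs_assign _ _, by simp [value, hw x hx], fun y hy => ?_⟩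
  rw [Function.update_of_ne hy.ne]

theorem comp_get {i : Code} {x t : ℕ} (hi : Comp R M d v A i x t) (a : ℕ) :
    Comp R M d v A (cGet a i) (A a x) (t + 2) := by
  intro d' hd' w hw
  obtain ⟨v₁, u, hu, hr, hx, hy⟩ := hi d' hd' w hw
  refine ⟨_, _, ?_, hr.seq (runs_assign _ _), by simp [value, hx], fun y h => ?_⟩
  · omega
  · rw [Function.update_of_ne h.ne, hy y h]

/-- The second operand is computed one variable further up, so that it does not overwrite the first.
-/
theorem comp_binary {e f : Code} {x y t u : ℕ} (he : Comp R M d v A e x t)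
    (hf : Comp R M d v A f y u) (op : Expr → Expr → Expr) (g : ℕ → ℕ → ℕ)
    (hop : ∀ v A e f, value R M v A (op e f) = g (value R M v A e) (value R M v A f)) :
    Comp R M d v A (fun d => .seq (e d) (.seq (f (d + 1)) (.assign d (op (.var d) (.var (d + 1))))))
      (g x y) (t + u + 3) := by
  intro d' hd' w hw
  obtain ⟨v₁, t', ht', hr, hx, hxy⟩ := he d' hd' w hw
  obtain ⟨v₂, u', hu', hr', hx', hxy'⟩ := hf (d' + 1) (by omega) v₁
    fun z hz => (hxy z (by omega)).trans (hw z hz)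
  refine ⟨_, _, ?_, hr.seq (hr'.seq (runs_assign _ _)), ?_, fun z hz => ?_⟩
  · omega
  · rw [Function.update_self, hop, value, value, hxy' d' (by omega), hx, hx']
  · rw [Function.update_of_ne hz.ne, hxy' z (by omega), hxy z hz]

theorem comp_table {i j : Code} {x y t u : ℕ} (hi : Comp R M d v A i x t)
    (hj : Comp R M d v A j y u) (T : Table) :
    Comp R M d v A (cTable T i j) (tableValue R M T x y) (t + u + 3) :=
  comp_binary hi hj (.table T) (tableValue R M T) fun _ _ _ _ => rfl

theorem comp_add {e f : Code} {x y t u : ℕ} (he : Comp R M d v A e x t)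
    (hf : Comp R M d v A f y u) : Comp R M d v A (cAdd e f) (x + y) (t + u + 3) :=
  comp_binary he hf .add (· + ·) fun _ _ _ _ => rfl

theorem comp_sub {e f : Code} {x y t u : ℕ} (he : Comp R M d v A e x t)
    (hf : Comp R M d v A f y u) : Comp R M d v A (cSub e f) (x - y) (t + u + 3) :=
  comp_binary he hf .sub (· - ·) fun _ _ _ _ => rfl

/-- Variable `d` holds the accumulator, `d + 1` the bound, `d + 2` the counter, and everything from
`d + 3` on is free for the body. -/
theorem comp_rec {b base : Code} {body : Code → Code → Code} {B tb ti : ℕ} {x g : ℕ → ℕ}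
    (hb : Comp R M d v A b B tb) (hi : Comp R M d v A base (x 0) ti)
    (hbody : ∀ j < B, ∀ d₁ v₁, Ext d v d₁ v₁ → ∀ cj cx, Comp R M d₁ v₁ A cj j 1 →
      Comp R M d₁ v₁ A cx (x j) 1 → Comp R M d₁ v₁ A (body cj cx) (x (j + 1)) (g j)) :
    Comp R M d v A (cRec b base body) (x B) (∑ j ∈ Finset.range B, (g j + 5) + tb + ti + 5) := by
  intro d' hd' w hw
  obtain ⟨v₁, t₁, ht₁, hr₁, hx₁, hy₁⟩ := hi d' hd' w hw
  obtain ⟨v₂, t₂, ht₂, hr₂, hx₂, hy₂⟩ := hb (d' + 1) (by omega) v₁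
    fun z hz => (hy₁ z (by omega)).trans (hw z hz)
  -- Induction on the number `k` of iterations that are still to come; the counter stands at `B -
  -- k`.
  have key : ∀ k ≤ B, ∀ u, (∀ y < d', u y = w y) → u d' = x (B - k) → u (d' + 1) = B →
      u (d' + 2) = B - k → ∃ u' t, t ≤ ∑ j ∈ Finset.Ico (B - k) B, (g j + 5) + 1 ∧
        Runs R M (.loop (.sub (.var (d' + 1)) (.var (d' + 2)))
      (.seq (body (cVar (d' + 2)) (cVar d') (d' + 3))
        (.seq (.assign d' (.var (d' + 3)))
          (.assign (d' + 2) (.add (.var (d' + 2)) (.const 1)))))) u A u' A t ∧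
        u' d' = x B ∧ ∀ y < d', u' y = w y := by
    intro k
    induction k with
    | zero =>
      intro _ u h1 h2 h3 h4
      exact ⟨u, 1, by simp, Runs.loop_false (by simp [value, h3, h4]), by simpa using h2, h1⟩
    | succ k ih =>
      intro hk u h1 h2 h3 h4
      have hext : Ext d v (d' + 3) u := ⟨by omega, fun y hy => (h1 y (by omega)).trans (hw y hy)⟩
      have hc := hbody (B - (k + 1)) (by omega) (d' + 3) u hext (cVar (d' + 2)) (cVar d')
        (h4 ▸ comp_var (by omega)) (h2 ▸ comp_var (by omega))
      obtain ⟨u₁, t, ht, hr, hx, hy⟩ := hc (d' + 3) le_rfl u fun _ _ => rfl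
      rw [show B - (k + 1) + 1 = B - k by omega] at hx
      set u₂ := Function.update u₁ d' (value R M u₁ A (.var (d' + 3))) with hu₂
      set u₃ := Function.update u₂ (d' + 2) (value R M u₂ A (.add (.var (d' + 2)) (.const 1)))
        with hu₃
      have e0 : u₂ (d' + 2) = B - (k + 1) := by
        rw [hu₂, Function.update_of_ne (by omega), hy _ (by omega), h4]
      obtain ⟨u', t', ht', hr', hx', hy'⟩ := ih (by omega) u₃
        (fun y hyy => by
          rw [hu₃, Function.update_of_ne (by omega), hu₂, Function.update_of_ne (by omega),
            hy y (by omega), h1 y hyy])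
        (by rw [hu₃, Function.update_of_ne (by omega), hu₂, Function.update_self, value, hx])
        (by rw [hu₃, Function.update_of_ne (by omega), hu₂, Function.update_of_ne (by omega),
            hy _ (by omega), h3])
        (by rw [hu₃, Function.update_self, value, value, value, e0]; omega)
      refine ⟨u', _, ?_, Runs.loop_true (by simp only [value, h3, h4]; omega)
        (hr.seq ((runs_assign _ _).seq (runs_assign _ _))) hr', hx', hy'⟩
      rw [Finset.sum_eq_sum_Ico_succ_bot (by omega), show B - (k + 1) + 1 = B - k by omega]
      omega
  set v₃ := Function.update v₂ (d' + 2) (value R M v₂ A (.const 0)) with hv₃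
  obtain ⟨u', t, ht, hr, hx, hy⟩ := key B le_rfl v₃
    (fun y hyy => by
      rw [hv₃, Function.update_of_ne (by omega), hy₂ y (by omega), hy₁ y hyy])
    (by rw [hv₃, Function.update_of_ne (by omega), hy₂ d' (by omega), hx₁, Nat.sub_self])
    (by rw [hv₃, Function.update_of_ne (by omega), hx₂])
    (by rw [hv₃, Function.update_self, value, Nat.sub_self])
  refine ⟨u', _, ?_, hr₁.seq (hr₂.seq ((runs_assign _ _).seq hr)), hx, hy⟩
  rw [Nat.sub_self, Nat.Ico_zero_eq_range] at ht
  omega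

end Machine

/-! ### Arithmetic -/

section Arithmetic

variable {m n : ℕ} {R : RepMatrix m n} {M : Fin m → Finset (Sym2 (Fin n))} {d : ℕ} {v : ℕ → ℕ}
  {A : ℕ → ℕ → ℕ}

/-- A sum over the numbers below a bound. -/
def cSum (b : Code) (body : Code → Code) : Code :=
  cRec b (cConst 0) fun j acc => cAdd acc (body j)

theorem comp_sum {b : Code} {body : Code → Code} {B tb : ℕ} {f g : ℕ → ℕ}
    (hb : Comp R M d v A b B tb)
    (hbody : ∀ j < B, ∀ d₁ v₁, Ext d v d₁ v₁ → ∀ cj, Comp R M d₁ v₁ A cj j 1 →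
      Comp R M d₁ v₁ A (body cj) (f j) (g j)) :
    Comp R M d v A (cSum b body) (∑ j ∈ Finset.range B, f j)
      (∑ j ∈ Finset.range B, (g j + 9) + tb + 6) := by
  refine (comp_rec (x := fun k => ∑ j ∈ Finset.range k, f j) (g := fun j => g j + 4) hb
    (comp_const 0) ?_).le (by simp only [add_assoc, Nat.reduceAdd, le_refl])
  intro j hj d₁ v₁ he cj cx hcj hcx
  rw [Finset.sum_range_succ]
  exact (comp_add hcx (hbody j hj d₁ v₁ he cj hcj)).le (by omega)

theorem comp_sum_le {b : Code} {body : Code → Code} {B tb T : ℕ} {f : ℕ → ℕ}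
    (hb : Comp R M d v A b B tb)
    (hbody : ∀ j < B, ∀ d₁ v₁, Ext d v d₁ v₁ → ∀ cj, Comp R M d₁ v₁ A cj j 1 →
      Comp R M d₁ v₁ A (body cj) (f j) T) :
    Comp R M d v A (cSum b body) (∑ j ∈ Finset.range B, f j) (B * (T + 9) + tb + 6) :=
  (comp_sum (g := fun _ => T) hb hbody).le (by simp)

/-- The indicator of `x = y`. -/
def eqn (x y : ℕ) : ℕ := 1 - ((x - y) + (y - x))

theorem eqn_eq (x y : ℕ) : eqn x y = if x = y then 1 else 0 := by
  unfold eqn; split_ifs <;> omega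

/-- The indicator of an equality. -/
def cEq (e f : Code) : Code := cSub (cConst 1) (cAdd (cSub e f) (cSub f e))

theorem comp_eq {e f : Code} {x y t u : ℕ} (he : Comp R M d v A e x t)
    (hf : Comp R M d v A f y u) : Comp R M d v A (cEq e f) (eqn x y) (2 * t + 2 * u + 13) :=
  (comp_sub (comp_const 1) (comp_add (comp_sub he hf) (comp_sub hf he))).le (by omega)

/-- A product. -/
def cMul (e f : Code) : Code := cSum e fun _ => f

theorem comp_mul {e f : Code} {x y t u : ℕ} (he : Comp R M d v A e x t)
    (hf : Comp R M d v A f y u) : Comp R M d v A (cMul e f) (x * y) (x * (u + 9) + t + 6) := by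
  rw [cMul]
  have := comp_sum_le (body := fun _ => f) he fun j _ d₁ v₁ hx _ _ => hf.mono hx
  simpa using this

/-- A quotient. -/
def cDiv (e f : Code) : Code :=
  cSum e fun q => cSub (cConst 1) (cSub (cMul (cAdd q (cConst 1)) f) e)

/-- The summand is 1 exactly when (q + 1)·y ≤ x, which happens for x / y values of `q`. The slowness
of this division is harmless, since the search applies it only to numbers bounded in terms of `N`.
-/
theorem sum_indicator_eq_div (x y : ℕ) (hy : 0 < y) :
    ∑ q ∈ Finset.range x, (1 - ((q + 1) * y - x)) = x / y := by
  have h : ∀ q ∈ Finset.range x, (1 - ((q + 1) * y - x)) = if q < x / y then 1 else 0 := by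
    intro q _
    have := Nat.le_div_iff_mul_le hy (x := q + 1) (y := x)
    split_ifs with hq <;> omega
  rw [Finset.sum_congr rfl h, Finset.sum_boole, Nat.cast_id]
  have : (Finset.range x).filter (· < x / y) = Finset.range (x / y) := by
    ext q
    have := Nat.div_le_self x y
    simp only [Finset.mem_filter, Finset.mem_range]; omega
  rw [this, Finset.card_range]

/-- A time bound for `cDiv`. -/
def tDiv (x t u : ℕ) : ℕ := x * (x * (u + 9) + t + 27) + t + 6

theorem comp_div {e f : Code} {x y t u : ℕ} (he : Comp R M d v A e x t)
    (hf : Comp R M d v A f y u) (hy : 0 < y) :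
    Comp R M d v A (cDiv e f) (x / y) (tDiv x t u) := by
  rw [← sum_indicator_eq_div x y hy]
  refine (comp_sum_le (T := x * (u + 9) + t + 18) he ?_).le (by unfold tDiv; rw [add_assoc _ 18 9])
  intro q hq d₁ v₁ hx cq hcq
  refine (comp_sub (comp_const 1) (comp_sub (comp_mul (comp_add hcq (comp_const 1)) (hf.mono hx))
    (he.mono hx))).le ?_
  have : (q + 1) * (u + 9) ≤ x * (u + 9) := Nat.mul_le_mul_right _ hq
  omega

/-- A remainder. -/
def cMod (e f : Code) : Code := cSub e (cMul (cDiv e f) f)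

/-- A time bound for `cMod`. -/
def tMod (x t u : ℕ) : ℕ := x * (u + 9) + t + tDiv x t u + 9

theorem comp_mod {e f : Code} {x y t u : ℕ} (he : Comp R M d v A e x t)
    (hf : Comp R M d v A f y u) (hy : 0 < y) :
    Comp R M d v A (cMod e f) (x % y) (tMod x t u) := by
  have h : x - x / y * y = x % y := by
    have := Nat.div_add_mod x y
    rw [mul_comm] at this; omega
  rw [← h]
  refine (comp_sub he (comp_mul (comp_div he hf hy) hf)).le ?_
  have : x / y * (u + 9) ≤ x * (u + 9) := Nat.mul_le_mul_right _ (Nat.div_le_self x y)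
  unfold tMod
  omega

/-- A power. -/
def cPow (e f : Code) : Code := cRec f (cConst 1) fun _ acc => cMul acc e

theorem comp_pow {e f : Code} {x y t u : ℕ} (hx : 0 < x) (he : Comp R M d v A e x t)
    (hf : Comp R M d v A f y u) :
    Comp R M d v A (cPow e f) (x ^ y) (y * (x ^ y * (t + 9) + 12) + u + 6) := by
  refine (comp_rec (x := fun k => x ^ k) (g := fun _ => x ^ y * (t + 9) + 7) hf
    (comp_const 1) ?_).le (by simp)
  intro j hj d₁ v₁ hext cj cx _ hcx
  rw [pow_succ]
  refine (comp_mul hcx (he.mono hext)).le ?_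
  have : x ^ j * (t + 9) ≤ x ^ y * (t + 9) :=
    Nat.mul_le_mul_right _ (Nat.pow_le_pow_right hx hj.le)
  omega

theorem tMod_mono {x x' t t' u : ℕ} (hx : x ≤ x') (ht : t ≤ t') : tMod x t u ≤ tMod x' t' u := by
  unfold tMod tDiv; gcongr

theorem tDiv_mono {x x' t u u' : ℕ} (hx : x ≤ x') (hu : u ≤ u') : tDiv x t u ≤ tDiv x' t u' := by
  unfold tDiv; gcongr

end Arithmetic

/-! ### The search for an odd closed sequence -/

section Search

variable {m n : ℕ} {R : RepMatrix m n} {M : Fin m → Finset (Sym2 (Fin n))} {d : ℕ} {v : ℕ → ℕ}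
  {A : ℕ → ℕ → ℕ} {N : ℕ}

/-- The variables `0` and `5` hold the numbers `m` and `N`. -/
structure Ctx (m N d : ℕ) (v : ℕ → ℕ) : Prop where
  le : 6 ≤ d
  zero : v 0 = m
  five : v 5 = N

theorem Ctx.mono {d₁ : ℕ} {v₁ : ℕ → ℕ} (h : Ctx m N d v) (he : Ext d v d₁ v₁) :
    Ctx m N d₁ v₁ where
  le := h.le.trans he.1
  zero := (he.2 0 (by have := h.le; omega)).trans h.zero
  five := (he.2 5 (by have := h.le; omega)).trans h.five

theorem Ctx.comp_zero (h : Ctx m N d v) : Comp R M d v A (cVar 0) m 1 := by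
  have := comp_var (R := R) (M := M) (A := A) (v := v) (show 0 < d by have := h.le; omega)
  rwa [h.zero] at this

theorem Ctx.comp_five (h : Ctx m N d v) : Comp R M d v A (cVar 5) N 1 := by
  have := comp_var (R := R) (M := M) (A := A) (v := v) (show 5 < d by have := h.le; omega)
  rwa [h.five] at this

/-- The digit `i` of `w` in base `N + 1`. -/
def dig (N w i : ℕ) : ℕ := w / (N + 1) ^ i % (N + 1)

/-- The number of codes. -/
def codes (N : ℕ) : ℕ := (N + 1) ^ (2 * N + 2)

/-- The base of the digits. -/
def cBase : Code := cAdd (cVar 5) (cConst 1)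

/-- A digit. -/
def cDig (w i : Code) : Code := cMod (cDiv w (cPow cBase i)) cBase

/-- A time bound for powers of the base. -/
def tPow (N u : ℕ) : ℕ := (2 * N + 2) * (codes N * 14 + 12) + u + 6

/-- A time bound for `cDig`. -/
def tDig (N u : ℕ) : ℕ := tMod (codes N) (tDiv (codes N) 1 (tPow N u)) 5

theorem Ctx.comp_base (h : Ctx m N d v) : Comp R M d v A cBase (N + 1) 5 :=
  comp_add h.comp_five (comp_const 1)

theorem Ctx.comp_pow (h : Ctx m N d v) {i : Code} {y u : ℕ} (hi : Comp R M d v A i y u)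
    (hy : y ≤ 2 * N + 2) : Comp R M d v A (cPow cBase i) ((N + 1) ^ y) (tPow N u) := by
  refine (WeakBip.comp_pow (by omega) h.comp_base hi).le ?_
  have : (N + 1) ^ y ≤ codes N := Nat.pow_le_pow_right (by omega) hy
  unfold tPow
  gcongr

theorem Ctx.comp_dig (h : Ctx m N d v) {w i : Code} {x y u : ℕ} (hw : Comp R M d v A w x 1)
    (hx : x < codes N) (hi : Comp R M d v A i y u) (hy : y ≤ 2 * N + 2) :
    Comp R M d v A (cDig w i) (dig N x y) (tDig N u) := by
  refine (comp_mod (comp_div hw (h.comp_pow hi hy) (by positivity)) h.comp_base (by omega)).le ?_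
  exact tMod_mono ((Nat.div_le_self _ _).trans hx.le) (tDiv_mono hx.le le_rfl)

/-- The vertex with index `i` of the sequence with code `w`. -/
def vOf (A : ℕ → ℕ → ℕ) (N w i : ℕ) : ℕ := A 2 (dig N w (1 + i))

/-- The label with index `i` of the sequence with code `w`. -/
def lOf (A : ℕ → ℕ → ℕ) (N w i : ℕ) : ℕ := A 2 (dig N w (N + 2 + i))

/-- Program for `vOf`. -/
def cV (w i : Code) : Code := cGet 2 (cDig w (cAdd (cConst 1) i))

/-- Program for `lOf`. -/
def cL (w i : Code) : Code := cGet 2 (cDig w (cAdd (cAdd (cVar 5) (cConst 2)) i))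

/-- A time bound for `cV` and `cL`. -/
def tSeq (N : ℕ) : ℕ := tDig N 13 + 2

/-- Digit 0 of a code is the length, digits 1 to N + 1 are the positions of the vertices in the
array `2`, and digits N + 2 to 2N + 1 those of the labels. The vertex index `N` is allowed because
the closing vertex is stored as well. -/
theorem Ctx.comp_v (h : Ctx m N d v) {w i : Code} {x y : ℕ} (hw : Comp R M d v A w x 1)
    (hx : x < codes N) (hi : Comp R M d v A i y 5) (hy : y ≤ N) :
    Comp R M d v A (cV w i) (vOf A N x y) (tSeq N) :=
  comp_get (h.comp_dig hw hx ((comp_add (comp_const 1) hi).le (by omega)) (by omega)) 2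

theorem Ctx.comp_l (h : Ctx m N d v) {w i : Code} {x y : ℕ} (hw : Comp R M d v A w x 1)
    (hx : x < codes N) (hi : Comp R M d v A i y 5) (hy : y < N) :
    Comp R M d v A (cL w i) (lOf A N x y) (tSeq N) :=
  comp_get (h.comp_dig hw hx
    ((comp_add (comp_add h.comp_five (comp_const 2)) hi).le (by omega)) (by omega)) 2

/-- The size of a label. -/
def tsize (R : RepMatrix m n) (ℓ : ℕ) : ℕ := if h : ℓ < m then (memberList R ⟨ℓ, h⟩).length else 0

/-- Counts the occurrences of the vertex `x` in the label `ℓ`. -/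
def inc (R : RepMatrix m n) (M : Fin m → Finset (Sym2 (Fin n))) (ℓ x : ℕ) : ℕ :=
  ∑ j ∈ Finset.range (tsize R ℓ), eqn (tableValue R M .member ℓ j) x

/-- Counts the labels in which `y` is the partner of `x`. -/
def adjc (R : RepMatrix m n) (M : Fin m → Finset (Sym2 (Fin n))) (x y : ℕ) : ℕ :=
  ∑ ℓ ∈ Finset.range m, ∑ j ∈ Finset.range (tsize R ℓ),
    (eqn (tableValue R M .member ℓ j) x + eqn (tableValue R M .mate ℓ j) y - 1)

/-- Counts the violated conditions at the index `i` of the sequence with code `w`. -/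
def errAt (R : RepMatrix m n) (M : Fin m → Finset (Sym2 (Fin n))) (A : ℕ → ℕ → ℕ) (N w i : ℕ) : ℕ :=
  (1 - inc R M (lOf A N w i) (vOf A N w i)) + ((1 - inc R M (lOf A N w i) (vOf A N w (i + 1))) +
    (eqn (vOf A N w i) (vOf A N w (i + 1)) + ((1 - adjc R M (vOf A N w i) (vOf A N w (i + 1))) +
      ∑ j ∈ Finset.range i, (eqn (vOf A N w j) (vOf A N w i) + eqn (lOf A N w j) (lOf A N w i)))))

/-- Counts the violated conditions of the sequence with code `w`. -/
def err (R : RepMatrix m n) (M : Fin m → Finset (Sym2 (Fin n))) (A : ℕ → ℕ → ℕ) (N w : ℕ) : ℕ :=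
  (1 - dig N w 0 % 2) + ((1 - eqn (vOf A N w (dig N w 0)) (vOf A N w 0)) +
    ∑ i ∈ Finset.range (dig N w 0), errAt R M A N w i)

/-- Counts the occurrences of the label with index `q`, if it is strong, in odd closed sequences. -/
def bad (R : RepMatrix m n) (M : Fin m → Finset (Sym2 (Fin n))) (A : ℕ → ℕ → ℕ) (N q : ℕ) : ℕ :=
  ∑ w ∈ Finset.range (codes N), (1 - err R M A N w) * ∑ i ∈ Finset.range (dig N w 0),
    (eqn (lOf A N w i) (A 2 q) + (1 - (3 - tsize R (A 2 q))) - 1)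

/-- The first index `q` with `bad q ≠ 0`, or `N` if there is none. -/
def pos (R : RepMatrix m n) (M : Fin m → Finset (Sym2 (Fin n))) (A : ℕ → ℕ → ℕ) (N : ℕ) : ℕ :=
  ∑ q ∈ Finset.range N, (1 - ∑ q' ∈ Finset.range (q + 1), bad R M A N q')

/-- Program for `tsize`. -/
def cSize (l : Code) : Code := cTable .size l (cConst 0)

/-- Program for `inc`. -/
def cInc (l x : Code) : Code := cSum (cSize l) fun j => cEq (cTable .member l j) x

/-- Program for `adjc`. -/
def cAdj (x y : Code) : Code := cSum (cVar 0) fun l => cSum (cSize l) fun j =>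
  cSub (cAdd (cEq (cTable .member l j) x) (cEq (cTable .mate l j) y)) (cConst 1)

/-- The complement of an indicator. -/
def cNot (e : Code) : Code := cSub (cConst 1) e

/-- Program for `errAt`. -/
def cErrAt (w i : Code) : Code :=
  cAdd (cNot (cInc (cL w i) (cV w i))) (cAdd (cNot (cInc (cL w i) (cV w (cAdd i (cConst 1)))))
    (cAdd (cEq (cV w i) (cV w (cAdd i (cConst 1))))
      (cAdd (cNot (cAdj (cV w i) (cV w (cAdd i (cConst 1)))))
        (cSum i fun j => cAdd (cEq (cV w j) (cV w i)) (cEq (cL w j) (cL w i))))))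

/-- The length of the sequence with code `w`. -/
def cLen (w : Code) : Code := cDig w (cConst 0)

/-- Program for `err`. -/
def cErr (w : Code) : Code :=
  cAdd (cNot (cMod (cLen w) (cConst 2)))
    (cAdd (cNot (cEq (cGet 2 (cDig w (cAdd (cConst 1) (cLen w)))) (cV w (cConst 0))))
      (cSum (cLen w) fun i => cErrAt w i))

/-- Program for `bad`. -/
def cBad (q : Code) : Code :=
  cSum (cPow cBase (cAdd (cAdd (cVar 5) (cVar 5)) (cConst 2))) fun w =>
    cMul (cNot (cErr w)) (cSum (cLen w) fun i =>
      cSub (cAdd (cEq (cL w i) (cGet 2 q)) (cNot (cSub (cConst 3) (cSize (cGet 2 q)))))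
        (cConst 1))

/-- Program for `pos`. -/
def cPos : Code := cSum (cVar 5) fun q => cNot (cSum (cAdd q (cConst 1)) fun q' => cBad q')

theorem comp_not {e : Code} {x t : ℕ} (he : Comp R M d v A e x t) :
    Comp R M d v A (cNot e) (1 - x) (t + 4) :=
  (comp_sub (comp_const 1) he).le (by omega)

theorem comp_size {l : Code} {x t : ℕ} (hl : Comp R M d v A l x t) :
    Comp R M d v A (cSize l) (tsize R x) (t + 4) :=
  comp_table hl (comp_const 0) .size

theorem tsize_eq (ℓ : Fin m) : tsize R ℓ = (labelSet R ℓ).card := by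
  rw [tsize, dif_pos ℓ.2, memberList, labelSet, ← List.toFinset_card_of_nodup
    ((List.nodup_finRange n).filter _)]
  congr 1
  ext w; simp

theorem sum_tsize (R : RepMatrix m n) : ∑ ℓ ∈ Finset.range m, tsize R ℓ = totalSize R := by
  rw [Finset.sum_range, totalSize]
  exact Finset.sum_congr rfl fun ℓ _ => tsize_eq ℓ

theorem tsize_le (R : RepMatrix m n) (ℓ : ℕ) : tsize R ℓ ≤ totalSize R := by
  by_cases h : ℓ < m
  · rw [← sum_tsize]
    exact Finset.single_le_sum (f := tsize R) (fun _ _ => Nat.zero_le _) (Finset.mem_range.2 h)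
  · simp [tsize, h]

/-- The size of the input. -/
def inputSize (R : RepMatrix m n) : ℕ := m + n + totalSize R + 1

/-- The summand 1 in the input size lets additive constants be absorbed, so that time bounds take
the form input size times a function of `N`. -/
theorem le_inputSize_mul (R : RepMatrix m n) (c : ℕ) : c ≤ inputSize R * c :=
  Nat.le_mul_of_pos_left _ (by unfold inputSize; omega)

theorem comp_inc {l x : Code} {a b D : ℕ} (hl : Comp R M d v A l a D) (hx : Comp R M d v A x b D) :
    Comp R M d v A (cInc l x) (inc R M a b) (inputSize R * (5 * D + 40)) := by
  refine (comp_sum_le (T := 4 * D + 21) (comp_size hl) fun j hj d₁ v₁ he cj hcj =>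
    (comp_eq (comp_table (hl.mono he) hcj .member) (hx.mono he)).le (by omega)).le ?_
  have h1 : tsize R a ≤ inputSize R := (tsize_le R a).trans (by unfold inputSize; omega)
  have h2 := le_inputSize_mul R (D + 10)
  calc _ = tsize R a * (4 * D + 30) + (D + 10) := by ring
    _ ≤ inputSize R * (4 * D + 30) + inputSize R * (D + 10) := by gcongr
    _ = _ := by ring

/-- The inner loop runs over the members of a label, and these numbers add up to `totalSize R`; so
scanning all labels is linear in the input. -/
theorem Ctx.comp_adj (h : Ctx m N d v) {x y : Code} {a b D : ℕ} (hx : Comp R M d v A x a D)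
    (hy : Comp R M d v A y b D) :
    Comp R M d v A (cAdj x y) (adjc R M a b) (inputSize R * (4 * D + 89)) := by
  refine (comp_sum (g := fun ℓ => tsize R ℓ * (4 * D + 62) + 11) h.comp_zero
    fun ℓ _ d₁ v₁ he cl hcl => ?_).le ?_
  · refine (comp_sum_le (T := 4 * D + 53) (comp_size hcl) fun j hj d₂ v₂ he' cj hcj => ?_).le
      (le_of_eq (by ring))
    exact (comp_sub (comp_add
      (comp_eq (comp_table (hcl.mono he') hcj .member) ((hx.mono he).mono he'))
      (comp_eq (comp_table (hcl.mono he') hcj .mate) ((hy.mono he).mono he')))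
      (comp_const 1)).le (by omega)
  · have e : ∑ ℓ ∈ Finset.range m, (tsize R ℓ * (4 * D + 62) + 11 + 9) =
        totalSize R * (4 * D + 62) + m * 20 := by
      simp only [add_assoc, Finset.sum_add_distrib, ← Finset.sum_mul, sum_tsize, Finset.sum_const,
        Finset.card_range, smul_eq_mul]
      ring
    rw [e]
    have h1 : totalSize R ≤ inputSize R := by unfold inputSize; omega
    have h2 : m ≤ inputSize R := by unfold inputSize; omega
    have h3 := le_inputSize_mul R 7
    calc _ = totalSize R * (4 * D + 62) + m * 20 + 7 := by ring
      _ ≤ inputSize R * (4 * D + 62) + inputSize R * 20 + inputSize R * 7 := by gcongr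
      _ = _ := by ring

/-- A time bound for `cErrAt`. -/
def tErrAt (N : ℕ) : ℕ := (N + 3) * (18 * tSeq N + 250)

theorem Ctx.comp_errAt (h : Ctx m N d v) {w i : Code} {x y : ℕ} (hw : Comp R M d v A w x 1)
    (hx : x < codes N) (hi : Comp R M d v A i y 1) (hy : y < N) :
    Comp R M d v A (cErrAt w i) (errAt R M A N x y) (inputSize R * tErrAt N) := by
  have hv := h.comp_v hw hx (hi.le (by omega)) hy.le
  have hv' := h.comp_v hw hx ((comp_add hi (comp_const 1)).le (by omega)) (show y + 1 ≤ N from hy)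
  have hl := h.comp_l hw hx (hi.le (by omega)) hy
  have hs := comp_sum_le (T := 8 * tSeq N + 29) (f := fun j => eqn (vOf A N x j) (vOf A N x y) +
      eqn (lOf A N x j) (lOf A N x y))
    (body := fun j => cAdd (cEq (cV w j) (cV w i)) (cEq (cL w j) (cL w i))) hi
    fun j hj d₁ v₁ he cj hcj => (comp_add
      (comp_eq ((h.mono he).comp_v (hw.mono he) hx (hcj.le (by omega)) (hj.trans hy).le)
        (hv.mono he))
      (comp_eq ((h.mono he).comp_l (hw.mono he) hx (hcj.le (by omega)) (hj.trans hy))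
        (hl.mono he))).le (by omega)
  refine (comp_add (comp_not (comp_inc hl hv)) (comp_add (comp_not (comp_inc hl hv'))
    (comp_add (comp_eq hv hv') (comp_add (comp_not (h.comp_adj hv hv')) hs)))).le ?_
  have h1 := le_inputSize_mul R (y * (8 * tSeq N + 29 + 9) + 4 * tSeq N + 44)
  have h2 : inputSize R * (y * (8 * tSeq N + 38)) ≤ inputSize R * (N * (8 * tSeq N + 38)) := by
    gcongr
  unfold tErrAt
  nlinarith

theorem dig_le (N w i : ℕ) : dig N w i ≤ N := Nat.lt_succ_iff.1 (Nat.mod_lt _ (Nat.succ_pos N))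

theorem Ctx.comp_len (h : Ctx m N d v) {w : Code} {x : ℕ} (hw : Comp R M d v A w x 1)
    (hx : x < codes N) : Comp R M d v A (cLen w) (dig N x 0) (tDig N 1) :=
  h.comp_dig hw hx (comp_const 0) (by omega)

/-- A time bound for `cErr`. -/
def tErr (N : ℕ) : ℕ :=
  tMod N (tDig N 1) 1 + 2 * (tDig N (tDig N 1 + 4) + 2) + 2 * tSeq N + tDig N 1 +
    N * (tErrAt N + 9) + 50

theorem Ctx.comp_err (h : Ctx m N d v) {w : Code} {x : ℕ} (hw : Comp R M d v A w x 1)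
    (hx : x < codes N) : Comp R M d v A (cErr w) (err R M A N x) (inputSize R * tErr N) := by
  have hlen := h.comp_len hw hx
  have hk := dig_le N x 0
  have hs := comp_sum_le (T := inputSize R * tErrAt N) (f := errAt R M A N x)
    (body := fun i => cErrAt w i) hlen fun i hi d₁ v₁ he ci hci =>
      (h.mono he).comp_errAt (hw.mono he) hx hci (by omega)
  -- Computing the length is too slow for the index allowed in `comp_v`, so the closing vertex is
  -- looked up directly.
  have hv := comp_get (h.comp_dig hw hx ((comp_add (comp_const 1) hlen).le
    (show _ ≤ tDig N 1 + 4 by omega)) (by omega)) 2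
  refine (comp_add (comp_not ((comp_mod hlen (comp_const 2) (by omega)).le (tMod_mono hk le_rfl)))
    (comp_add (comp_not (comp_eq hv (h.comp_v hw hx (comp_const 0 |>.le (by omega))
      (by omega)))) hs)).le ?_
  have h1 := le_inputSize_mul R (tMod N (tDig N 1) 1 + 2 * (tDig N (tDig N 1 + 4) + 2) +
    2 * tSeq N + tDig N 1 + N * 9 + 50)
  have h2 : dig N x 0 * (inputSize R * tErrAt N + 9) ≤ N * (inputSize R * tErrAt N + 9) := by
    gcongr
  unfold tErr
  nlinarith

/-- A time bound for `cBad`. -/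
def tBad (N : ℕ) : ℕ :=
  codes N * (N * (2 * tSeq N + 50) + tDig N 1 + tErr N + 60) + tPow N 9 + 60

theorem Ctx.comp_bad (h : Ctx m N d v) {q : Code} {x : ℕ} (hq : Comp R M d v A q x 1) :
    Comp R M d v A (cBad q) (bad R M A N x) (inputSize R * tBad N) := by
  have hW : Comp R M d v A (cPow cBase (cAdd (cAdd (cVar 5) (cVar 5)) (cConst 2))) (codes N)
      (tPow N 9) :=
    h.comp_pow (two_mul N ▸ comp_add (comp_add h.comp_five h.comp_five) (comp_const 2)) le_rfl
  refine (comp_sum_le (T := N * (2 * tSeq N + 50) + tDig N 1 + inputSize R * tErr N + 25) hW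
    fun w hw d₁ v₁ he cw hcw => ?_).le ?_
  · have hc := h.mono he
    have hlen := hc.comp_len hcw hw
    have hk := dig_le N w 0
    refine (comp_mul (comp_not (hc.comp_err hcw hw)) (comp_sum_le (T := 2 * tSeq N + 41) hlen
      fun i hi d₂ v₂ he' ci hci => ?_)).le ?_
    · have hq' := comp_get ((hq.mono he).mono he') 2
      exact (comp_sub (comp_add (comp_eq ((hc.mono he').comp_l (hcw.mono he') hw
        (hci.le (by omega)) (by omega)) hq') (comp_not (comp_sub (comp_const 3)
          (comp_size hq')))) (comp_const 1)).le (by omega)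
    · have h1 : dig N w 0 * (2 * tSeq N + 41 + 9) ≤ N * (2 * tSeq N + 50) := by gcongr
      -- A product repeats its second factor as often as the first one says, here at most once.
      have h2 : (1 - err R M A N w) * (dig N w 0 * (2 * tSeq N + 41 + 9) + tDig N 1 + 6 + 9) ≤
          1 * (dig N w 0 * (2 * tSeq N + 41 + 9) + tDig N 1 + 6 + 9) := by gcongr; omega
      omega
  · have h1 := le_inputSize_mul R (codes N * (N * (2 * tSeq N + 50) + tDig N 1 + 34) +
      tPow N 9 + 6)
    unfold tBad
    nlinarith

/-- A time bound for `cPos`. -/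
def tPos (N : ℕ) : ℕ := N * (N * (tBad N + 9) + 30) + 10

theorem Ctx.comp_pos (h : Ctx m N d v) :
    Comp R M d v A cPos (pos R M A N) (inputSize R * tPos N) := by
  refine (comp_sum_le (T := N * (inputSize R * tBad N + 9) + 15) h.comp_five
    fun q hq d₁ v₁ he cq hcq => ?_).le ?_
  · refine (comp_not (comp_sum_le (comp_add hcq (comp_const 1)) fun q' hq' d₂ v₂ he' cq' hcq' =>
      ((h.mono he).mono he').comp_bad hcq')).le ?_
    have : (q + 1) * (inputSize R * tBad N + 9) ≤ N * (inputSize R * tBad N + 9) := by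
      gcongr; omega
    omega
  · have h1 := le_inputSize_mul R (N * (N * 9 + 24) + 7)
    unfold tPos
    nlinarith

/-! ### Correctness of the search -/

/-- The summand is 1 as long as `f` has vanished up to and including `q`, and 0 from then on. So the
sum counts the positions before the first nonzero value. -/
theorem first_position_spec (f : ℕ → ℕ) (N : ℕ) :
    let p := ∑ q ∈ Finset.range N, (1 - ∑ q' ∈ Finset.range (q + 1), f q')
    (p = N ∧ ∀ q < N, f q = 0) ∨ (p < N ∧ f p ≠ 0) := by
  induction N with
  | zero => left; simp
  | succ N ih =>
    simp only [Finset.sum_range_succ _ N] at ih ⊢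
    rcases ih with ⟨h1, h2⟩ | ⟨h1, h2⟩
    · have h0 : ∑ q' ∈ Finset.range N, f q' = 0 :=
        Finset.sum_eq_zero fun q hq => h2 q (Finset.mem_range.1 hq)
      rw [h0, h1, zero_add]
      by_cases hf : f N = 0
      · left
        refine ⟨by omega, fun q hq => ?_⟩
        rcases Nat.lt_succ_iff_lt_or_eq.1 hq with h | rfl
        · exact h2 q h
        · exact hf
      · right
        have : N + (1 - f N) = N := by omega
        rw [this]
        exact ⟨by omega, hf⟩
    · right
      have h3 : 1 ≤ ∑ q' ∈ Finset.range N, f q' :=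
        (Nat.one_le_iff_ne_zero.2 h2).trans (Finset.single_le_sum (f := f)
          (fun _ _ => Nat.zero_le _) (Finset.mem_range.2 h1))
      rw [show 1 - (∑ q' ∈ Finset.range N, f q' + f N) = 0 by omega, add_zero]
      exact ⟨by omega, h2⟩

theorem eqn_ne_zero {x y : ℕ} : eqn x y ≠ 0 ↔ x = y := by simp [eqn_eq]

theorem mem_memberList {ℓ : Fin m} {w : Fin n} : w ∈ memberList R ℓ ↔ R ℓ w = true := by
  simp [memberList]

theorem exists_member_iff {ℓ : ℕ} {Q : ℕ → Prop} :
    (∃ j < tsize R ℓ, Q j) ↔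
      ∃ h : ℓ < m, ∃ j, ∃ _ : j < (memberList R ⟨ℓ, h⟩).length, Q j := by
  by_cases h : ℓ < m
  · simp [tsize, h]
  · simp [tsize, h]

theorem tableValue_member {ℓ j : ℕ} (h : ℓ < m) (hj : j < (memberList R ⟨ℓ, h⟩).length) :
    tableValue R M .member ℓ j = (memberList R ⟨ℓ, h⟩)[j] := by
  simp [tableValue, h, List.getElem?_eq_getElem hj]

theorem tableValue_mate {ℓ j : ℕ} (h : ℓ < m) (hj : j < (memberList R ⟨ℓ, h⟩).length) :
    tableValue R M .mate ℓ j = partner (M ⟨ℓ, h⟩) (memberList R ⟨ℓ, h⟩)[j] := by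
  simp [tableValue, h, List.getElem?_eq_getElem hj]

theorem inc_ne_zero {ℓ x : ℕ} :
    inc R M ℓ x ≠ 0 ↔ ∃ (hℓ : ℓ < m) (hx : x < n), R ⟨ℓ, hℓ⟩ ⟨x, hx⟩ = true := by
  simp only [inc, ne_eq, Finset.sum_eq_zero_iff, Finset.mem_range, not_forall, exists_prop]
  rw [exists_member_iff]
  constructor
  · rintro ⟨h, j, hj, he⟩
    have he' := eqn_ne_zero.1 he
    rw [tableValue_member h hj] at he'
    subst he'
    exact ⟨h, (memberList R ⟨ℓ, h⟩)[j].2, mem_memberList.1 (List.getElem_mem hj)⟩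
  · rintro ⟨h, hx, hR⟩
    obtain ⟨j, hj, he⟩ := List.getElem_of_mem (mem_memberList.2 hR)
    refine ⟨h, j, hj, eqn_ne_zero.2 ?_⟩
    rw [tableValue_member h hj, he]

/-- In a matching at most one pair contains `x`, so the search finds the right one. An unmatched
vertex is its own partner, hence `hxy`. -/
theorem partner_eq_iff {S : Finset (Fin n)} {N : Finset (Sym2 (Fin n))} (hN : IsMatchingOf S N)
    {x y : Fin n} (hxy : x ≠ y) : partner N x = y ↔ s(x, y) ∈ N := by
  unfold partner
  rcases hf : (List.finRange n).find? (fun w => decide (s(x, w) ∈ N)) with _ | w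
  · simp only [Option.getD_none, hxy, false_iff]
    intro h
    simpa [h] using List.find?_eq_none.1 hf y (List.mem_finRange y)
  · have hw : s(x, w) ∈ N := by simpa using List.find?_some hf
    simp only [Option.getD_some]
    constructor
    · rintro rfl; exact hw
    · intro h
      have := hN.2 _ hw _ h x (by simp) (by simp)
      rw [Sym2.eq_iff] at this
      rcases this with ⟨-, h⟩ | ⟨h, -⟩
      · exact h
      · exact absurd h hxy

theorem adjc_ne_zero (hM : ∀ ℓ, IsMatchingOf (labelSet R ℓ) (M ℓ)) {x y : Fin n} (hxy : x ≠ y) :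
    adjc R M x y ≠ 0 ↔ ∃ ℓ, s(x, y) ∈ M ℓ := by
  -- The truncated difference turns a sum of two indicators into their conjunction.
  have hconj : ∀ a b c d : ℕ, eqn a b + eqn c d - 1 ≠ 0 ↔ a = b ∧ c = d := by
    intro a b c d
    simp only [eqn_eq]
    split_ifs <;> simp_all
  simp only [adjc, ne_eq, Finset.sum_eq_zero_iff, Finset.mem_range, not_forall, exists_prop]
  simp only [hconj]
  constructor
  · rintro ⟨ℓ, hℓ, h⟩
    obtain ⟨h', j, hj, h1, h2⟩ := exists_member_iff.1 h
    rw [tableValue_member h' hj, Fin.val_inj] at h1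
    rw [tableValue_mate h' hj, Fin.val_inj, h1, partner_eq_iff (hM _) hxy] at h2
    exact ⟨_, h2⟩
  · rintro ⟨ℓ, h⟩
    have hx : R ℓ x = true := mem_labelSet.1 (((hM ℓ).1 _ h).2 x (by simp))
    obtain ⟨j, hj, he⟩ := List.getElem_of_mem (mem_memberList.2 hx)
    refine ⟨ℓ, ℓ.2, exists_member_iff.2 ⟨ℓ.2, j, hj, ?_⟩⟩
    rw [tableValue_member ℓ.2 hj, tableValue_mate ℓ.2 hj, he, (partner_eq_iff (hM ℓ) hxy).2 h]
    exact ⟨rfl, rfl⟩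

/-- The conditions at the index `i` hold. -/
structure GoodAt (R : RepMatrix m n) (M : Fin m → Finset (Sym2 (Fin n))) (A : ℕ → ℕ → ℕ)
    (N w i : ℕ) : Prop where
  inc : inc R M (lOf A N w i) (vOf A N w i) ≠ 0
  inc' : WeakBip.inc R M (lOf A N w i) (vOf A N w (i + 1)) ≠ 0
  ne : vOf A N w i ≠ vOf A N w (i + 1)
  adj : adjc R M (vOf A N w i) (vOf A N w (i + 1)) ≠ 0
  inj : ∀ j < i, vOf A N w j ≠ vOf A N w i ∧ lOf A N w j ≠ lOf A N w i

theorem errAt_eq_zero {w i : ℕ} : errAt R M A N w i = 0 ↔ GoodAt R M A N w i := by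
  have h1 : ∀ x : ℕ, 1 - x = 0 ↔ x ≠ 0 := by intro x; omega
  have h2 : ∀ x y : ℕ, eqn x y = 0 ↔ x ≠ y := by intro x y; simp [eqn_eq]
  simp only [errAt, Nat.add_eq_zero_iff, h1, h2, Finset.sum_eq_zero_iff, Finset.mem_range]
  exact ⟨fun ⟨a, b, c, d, e⟩ => ⟨a, b, c, d, e⟩, fun ⟨a, b, c, d, e⟩ => ⟨a, b, c, d, e⟩⟩

theorem err_eq_zero {w : ℕ} : err R M A N w = 0 ↔ Odd (dig N w 0) ∧
    vOf A N w (dig N w 0) = vOf A N w 0 ∧ ∀ i < dig N w 0, GoodAt R M A N w i := by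
  have h1 : ∀ x : ℕ, 1 - x = 0 ↔ x ≠ 0 := by intro x; omega
  simp only [err, Nat.add_eq_zero_iff, h1, eqn_ne_zero, Finset.sum_eq_zero_iff, Finset.mem_range,
    errAt_eq_zero, Nat.odd_iff]
  rw [show dig N w 0 % 2 ≠ 0 ↔ dig N w 0 % 2 = 1 by omega]

theorem bad_ne_zero {q : ℕ} : bad R M A N q ≠ 0 ↔ ∃ w < codes N, err R M A N w = 0 ∧
    ∃ i < dig N w 0, lOf A N w i = A 2 q ∧ 3 ≤ tsize R (A 2 q) := by
  have h1 : ∀ x : ℕ, 1 - x ≠ 0 ↔ x = 0 := by intro x; omega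
  have h2 : ∀ a b s : ℕ, eqn a b + (1 - (3 - s)) - 1 ≠ 0 ↔ a = b ∧ 3 ≤ s := by
    intro a b s
    simp only [eqn_eq]
    split_ifs with h <;> simp only [h, true_and, false_and, iff_false] <;> omega
  simp only [bad, ne_eq, Finset.sum_eq_zero_iff, Finset.mem_range, not_forall, exists_prop,
    mul_eq_zero, not_or]
  simp only [h1, h2]

/-- The array `2` lists the elements of the 2-core. -/
structure Covers (R : RepMatrix m n) (A : ℕ → ℕ → ℕ) (N : ℕ) : Prop where
  vert : ∀ w : Fin n, Sum.inr w ∈ core (incGraph R) → ∃ q < N, A 2 q = w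
  lab : ∀ ℓ : Fin m, Sum.inl ℓ ∈ core (incGraph R) → ∃ q < N, A 2 q = ℓ

/-- The sequence with a code without errors belongs to `C_odd`, if it has a strong label. -/
theorem exists_codd_of_err (hM : ∀ ℓ, IsMatchingOf (labelSet R ℓ) (M ℓ)) {w : ℕ}
    (hw : err R M A N w = 0) {i : ℕ} (hi : i < dig N w 0) (h3 : 3 ≤ tsize R (lOf A N w i)) :
    ∃ h : lOf A N w i < m, IsStrong R ⟨lOf A N w i, h⟩ ∧
      ∃ σ ∈ codd R M, ∃ j : Fin σ.size, σ.lab j = ⟨lOf A N w i, h⟩ := by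
  obtain ⟨hodd, hcl, hgood⟩ := err_eq_zero.1 hw
  set k := dig N w 0 with hk
  have hl : ∀ j < k, lOf A N w j < m := fun j hj => (inc_ne_zero.1 (hgood j hj).inc).1
  have hv : ∀ j < k + 1, vOf A N w j < n := by
    intro j hj
    rcases Nat.lt_succ_iff_lt_or_eq.1 hj with h | rfl
    · exact (inc_ne_zero.1 (hgood j h).inc).2.1
    · rw [hcl]
      exact (inc_ne_zero.1 (hgood 0 (by omega)).inc).2.1
  let σ : VLSeq m n := ⟨k, fun j => ⟨vOf A N w j, hv j j.2⟩, fun j => ⟨lOf A N w j, hl j j.2⟩⟩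
  have hstrong : IsStrong R ⟨lOf A N w i, hl i hi⟩ := by
    rw [IsStrong, ← tsize_eq]; exact h3
  refine ⟨hl i hi, hstrong, σ, ⟨⟨?_, ?_⟩, hodd, ?_, ?_, ?_, ?_⟩, ⟨i, hi⟩, rfl⟩
  · exact Fin.ext hcl
  · intro j
    exact ⟨mem_labelSet.2 (inc_ne_zero.1 (hgood j j.2).inc).2.2,
      mem_labelSet.2 (inc_ne_zero.1 (hgood j j.2).inc').2.2⟩
  · intro a b hab
    have hab' : vOf A N w a = vOf A N w b := congrArg Fin.val hab
    rcases lt_trichotomy (a : ℕ) b with h | h | h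
    · exact absurd hab' ((hgood b b.2).inj a h).1
    · exact Fin.ext h
    · exact absurd hab'.symm ((hgood a a.2).inj b h).1
  · intro a b hab
    have hab' : lOf A N w a = lOf A N w b := congrArg Fin.val hab
    rcases lt_trichotomy (a : ℕ) b with h | h | h
    · exact absurd hab' ((hgood b b.2).inj a h).2
    · exact Fin.ext h
    · exact absurd hab'.symm ((hgood a a.2).inj b h).2
  · intro j
    refine (adjc_ne_zero hM ?_).1 (hgood j j.2).adj
    intro h
    exact (hgood j j.2).ne (congrArg Fin.val h)
  · exact Finset.card_pos.2 ⟨⟨i, hi⟩, by simpa [σ] using hstrong⟩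

theorem exists_code (N : ℕ) (e : ℕ → ℕ) (he : ∀ i, e i ≤ N) :
    ∃ w < codes N, ∀ i < 2 * N + 2, dig N w i = e i := by
  let f : Fin (2 * N + 2) → Fin (N + 1) := fun i => ⟨e i, Nat.lt_succ_of_le (he i)⟩
  refine ⟨finFunctionFinEquiv f, (finFunctionFinEquiv f).2, fun i hi => ?_⟩
  -- The inverse of `finFunctionFinEquiv` extracts digits by the formula that defines `dig`.
  have := congrArg Fin.val (congrFun (finFunctionFinEquiv.symm_apply_apply f) ⟨i, hi⟩)
  exact this

/-- All nodes of an odd sequence lie in the 2-core, so their positions in the list can serve as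
digits. The length fits into a digit because distinct vertices have distinct positions below `N`. -/
theorem exists_err_of_codd (hM : ∀ ℓ, IsMatchingOf (labelSet R ℓ) (M ℓ)) (hQ : Covers R A N)
    {σ : VLSeq m n} (hσ : σ ∈ codd R M) : ∃ w < codes N, err R M A N w = 0 ∧
      dig N w 0 = σ.size ∧ ∀ i : Fin σ.size, lOf A N w i = σ.lab i := by
  obtain ⟨hc, h3⟩ := isCyc_of_mem_codd hM hσ
  have hvq : ∀ i : Fin (σ.size + 1), ∃ q < N, A 2 q = σ.vert i := by
    intro i
    refine hQ.vert _ ?_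
    induction i using Fin.lastCases with
    | last =>
      rw [hc.closed.1]
      exact hc.vert_mem_core ⟨0, by omega⟩
    | cast i => exact hc.vert_mem_core i
  choose qv hqv hqv' using hvq
  choose ql hql hql' using fun i : Fin σ.size => hQ.lab _ (hc.lab_mem_core i)
  have hsize : σ.size ≤ N := by
    have hinj : Function.Injective fun i : Fin σ.size => (⟨qv i.castSucc, hqv _⟩ : Fin N) := by
      intro a b hab
      apply hc.vert_inj
      apply Fin.ext
      have : qv a.castSucc = qv b.castSucc := congrArg Fin.val hab
      simp only [← hqv', this]
    simpa using Fintype.card_le_of_injective _ hinj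
  -- Digits that belong neither to the length nor to an index of the sequence are never read; their
  -- values do not matter.
  obtain ⟨w, hw, hdig⟩ := exists_code N (fun i => if i = 0 then σ.size else
    if h : i - 1 < σ.size + 1 then qv ⟨i - 1, h⟩ else
      if h : i - (N + 2) < σ.size then ql ⟨i - (N + 2), h⟩ else 0) (by
        intro i
        split_ifs
        · exact hsize
        · exact (hqv _).le
        · exact (hql _).le
        · exact Nat.zero_le _)
  have h0 : dig N w 0 = σ.size := by rw [hdig 0 (by omega)]; simp
  have hv : ∀ i : Fin (σ.size + 1), vOf A N w i = σ.vert i := by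
    intro i
    have hi := i.2
    rw [vOf, hdig _ (by omega), if_neg (by omega), dif_pos (by omega), ← hqv' i]
    congr 2
    exact Fin.ext (by simp)
  have hl : ∀ i : Fin σ.size, lOf A N w i = σ.lab i := by
    intro i
    have hi := i.2
    rw [lOf, hdig _ (by omega), if_neg (by omega), dif_neg (by omega), dif_pos (by omega),
      ← hql' i]
    congr 2
    exact Fin.ext (by simp)
  refine ⟨w, hw, err_eq_zero.2 ⟨h0 ▸ hσ.2.1, ?_, ?_⟩, h0, hl⟩
  · have h1 := hv (Fin.last _)
    have h2 := hv 0
    rw [Fin.val_last] at h1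
    rw [h0, h1, hc.closed.1, ← h2, Fin.val_zero]
  · rw [h0]
    intro i hi
    have e1 : vOf A N w i = σ.vert (Fin.castSucc ⟨i, hi⟩) := hv (Fin.castSucc ⟨i, hi⟩)
    have e2 : vOf A N w (i + 1) = σ.vert (Fin.succ ⟨i, hi⟩) := hv (Fin.succ ⟨i, hi⟩)
    have e3 : lOf A N w i = σ.lab ⟨i, hi⟩ := hl ⟨i, hi⟩
    have hne : σ.vert (Fin.castSucc ⟨i, hi⟩) ≠ σ.vert (Fin.succ ⟨i, hi⟩) := by
      rw [hc.closed.vert_succ]; exact hc.vert_ne _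
    refine ⟨?_, ?_, ?_, ?_, fun j hj => ⟨?_, ?_⟩⟩
    · rw [e1, e3, inc_ne_zero]
      exact ⟨Fin.is_lt _, Fin.is_lt _, mem_labelSet.1 (hc.closed.2 ⟨i, hi⟩).1⟩
    · rw [e2, e3, inc_ne_zero]
      exact ⟨Fin.is_lt _, Fin.is_lt _, mem_labelSet.1 (hc.closed.2 ⟨i, hi⟩).2⟩
    · rw [e1, e2]
      exact fun h => hne (Fin.ext h)
    · rw [e1, e2, adjc_ne_zero hM hne]
      exact hσ.2.2.2.2.1 ⟨i, hi⟩
    · have e4 : vOf A N w j = σ.vert (Fin.castSucc ⟨j, hj.trans hi⟩) :=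
        hv (Fin.castSucc ⟨j, hj.trans hi⟩)
      rw [e1, e4]
      intro h
      have := congrArg Fin.val (hc.vert_inj (Fin.ext h))
      simp only at this
      omega
    · have e4 : lOf A N w j = σ.lab ⟨j, hj.trans hi⟩ := hl ⟨j, hj.trans hi⟩
      rw [e3, e4]
      intro h
      have := congrArg Fin.val (hc.lab_inj (Fin.ext h))
      simp only at this
      omega

/-- The search finds a strong label of a sequence in `C_odd`, if there is one. -/
theorem pos_spec (hM : ∀ ℓ, IsMatchingOf (labelSet R ℓ) (M ℓ)) (hQ : Covers R A N) :
    (pos R M A N = N ∧ codd R M = ∅) ∨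
      (pos R M A N < N ∧ ∃ h : A 2 (pos R M A N) < m, IsStrong R ⟨A 2 (pos R M A N), h⟩ ∧
        ∃ σ ∈ codd R M, ∃ j : Fin σ.size, σ.lab j = ⟨A 2 (pos R M A N), h⟩) := by
  rcases first_position_spec (bad R M A N) N with ⟨h1, h2⟩ | ⟨h1, h2⟩
  · refine Or.inl ⟨h1, ?_⟩
    by_contra hne
    obtain ⟨σ, hσ⟩ := Set.nonempty_iff_ne_empty.2 hne
    obtain ⟨w, hw, herr, h0, hl⟩ := exists_err_of_codd hM hQ hσ
    obtain ⟨i, hi⟩ := Finset.card_pos.1 hσ.2.2.2.2.2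
    have hstr : IsStrong R (σ.lab i) := by simpa using hi
    obtain ⟨q, hq, hq'⟩ := hQ.lab _ ((isCyc_of_mem_codd hM hσ).1.lab_mem_core i)
    refine bad_ne_zero.2 ⟨w, hw, herr, i, by rw [h0]; exact i.2, ?_, ?_⟩ (h2 q hq)
    · rw [hl, hq']
    · rw [hq', tsize_eq]; exact hstr
  · refine Or.inr ⟨h1, ?_⟩
    obtain ⟨w, -, herr, i, hi, hli, h3⟩ := bad_ne_zero.1 h2
    rw [← hli] at h3
    obtain ⟨h, hstr, σ, hσ, j, hj⟩ := exists_codd_of_err hM herr hi h3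
    have e : A 2 (pos R M A N) = lOf A N w i := hli.symm
    simp only [e]
    exact ⟨h, hstr, σ, hσ, j, hj⟩

end Search

/-! ### Commands -/

section Commands

variable {m n : ℕ} {R : RepMatrix m n} {M : Fin m → Finset (Sym2 (Fin n))} {v v₁ v₂ : ℕ → ℕ}
  {A A₁ A₂ : ℕ → ℕ → ℕ}

/-- The command takes `v, A` to `v₁, A₁` within time `t`, where only the variables below `10`
count. -/
def Eff (R : RepMatrix m n) (M : Fin m → Finset (Sym2 (Fin n))) (c : Cmd) (v : ℕ → ℕ)
    (A : ℕ → ℕ → ℕ) (v₁ : ℕ → ℕ) (A₁ : ℕ → ℕ → ℕ) (t : ℕ) : Prop :=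
  ∀ w, (∀ y < 10, w y = v y) → ∃ w₁ u, u ≤ t ∧ Runs R M c w A w₁ A₁ u ∧ ∀ y < 10, w₁ y = v₁ y

theorem Eff.le {c : Cmd} {t t' : ℕ} (h : Eff R M c v A v₁ A₁ t) (ht : t ≤ t') :
    Eff R M c v A v₁ A₁ t' := by
  intro w hw
  obtain ⟨w₁, u, hu, h'⟩ := h w hw
  exact ⟨w₁, u, hu.trans ht, h'⟩

theorem Eff.seq {c d : Cmd} {t u : ℕ} (h₁ : Eff R M c v A v₁ A₁ t)
    (h₂ : Eff R M d v₁ A₁ v₂ A₂ u) : Eff R M (.seq c d) v A v₂ A₂ (t + u + 1) := by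
  intro w hw
  obtain ⟨w₁, t', ht, hr, hw₁⟩ := h₁ w hw
  obtain ⟨w₂, u', hu, hr', hw₂⟩ := h₂ w₁ hw₁
  exact ⟨w₂, _, by omega, hr.seq hr', hw₂⟩

/-- Assignment of a compound expression. -/
def cSet (x : ℕ) (c : Code) : Cmd := .seq (c 10) (.assign x (.var 10))

theorem eff_set {c : Code} {k t : ℕ} (x : ℕ) (h : Comp R M 10 v A c k t) :
    Eff R M (cSet x c) v A (Function.update v x k) A (t + 2) := by
  intro w hw
  obtain ⟨w₁, u, hu, hr, hx, hy⟩ := h 10 le_rfl w hw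
  refine ⟨_, _, ?_, hr.seq (runs_assign x (.var 10)), fun y hyy => ?_⟩
  · omega
  · rw [value, hx]
    by_cases hyx : y = x
    · subst hyx; simp
    · rw [Function.update_of_ne hyx, Function.update_of_ne hyx, hy y hyy, hw y hyy]

/-- Storing a compound expression. -/
def cStore (a : ℕ) (i e : Code) : Cmd :=
  .seq (i 10) (.seq (e 11) (.store a (.var 10) (.var 11)))

theorem eff_store {i e : Code} {x k t u : ℕ} (a : ℕ) (hi : Comp R M 10 v A i x t)
    (he : Comp R M 10 v A e k u) :
    Eff R M (cStore a i e) v A v (Function.update A a (Function.update (A a) x k)) (t + u + 3) := by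
  intro w hw
  obtain ⟨w₁, t', ht', hr, hx, hy⟩ := hi 10 le_rfl w hw
  obtain ⟨w₂, u', hu', hr', hx', hy'⟩ := he 11 (by omega) w₁ fun y hyy =>
    (hy y hyy).trans (hw y hyy)
  have hs := hr.seq (hr'.seq (runs_store a (.var 10) (.var 11)))
  rw [value, value, hx', hy' 10 (by omega), hx] at hs
  exact ⟨_, _, by omega, hs, fun y hyy => by rw [hy' y (by omega), hy y hyy, hw y hyy]⟩

/-- The test for `x < y`, for variables `x` and `y`. -/
def ltTest (x y : ℕ) : Expr := .sub (.var y) (.var x)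

theorem eff_loop_false {x y : ℕ} (hx : x < 10) (hy : y < 10) {c : Cmd} (h : v y ≤ v x) :
    Eff R M (.loop (ltTest x y) c) v A v A 1 := fun w hw =>
  ⟨w, 1, le_rfl, Runs.loop_false (by simp only [ltTest, value, hw x hx, hw y hy]; omega), hw⟩

theorem eff_loop_true {x y : ℕ} (hx : x < 10) (hy : y < 10) {c : Cmd} {t u : ℕ} (h : v x < v y)
    (h₁ : Eff R M c v A v₁ A₁ t) (h₂ : Eff R M (.loop (ltTest x y) c) v₁ A₁ v₂ A₂ u) :
    Eff R M (.loop (ltTest x y) c) v A v₂ A₂ (t + u + 1) := by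
  intro w hw
  obtain ⟨w₁, t', ht, hr, hw₁⟩ := h₁ w hw
  obtain ⟨w₂, u', hu, hr', hw₂⟩ := h₂ w₁ hw₁
  exact ⟨w₂, _, by omega, Runs.loop_true (by simp only [ltTest, value, hw x hx, hw y hy]; omega)
    hr hr', hw₂⟩

/-- The loop in which the variable `x` runs through the numbers below the variable `y`. -/
def cFor (x y : ℕ) (c : Cmd) : Cmd :=
  .seq (cSet x (cConst 0)) (.loop (ltTest x y) (.seq c (cSet x (cAdd (cVar x) (cConst 1)))))

/-- The invariant is required right after the counter has been set, and the cost of an iteration may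
depend on the counter; this is what makes sums over label sizes linear in the input. -/
theorem eff_for {x y : ℕ} (hx : x < 10) (hy : y < 10) (hxy : x ≠ y) {c : Cmd} {T : ℕ → ℕ} {B : ℕ}
    (hB : v y = B) (I : ℕ → (ℕ → ℕ) → (ℕ → ℕ → ℕ) → Prop) (h0 : I 0 (Function.update v x 0) A)
    (hI : ∀ j < B, ∀ v A, v x = j → v y = B → I j v A → ∃ v₁ A₁, Eff R M c v A v₁ A₁ (T j) ∧
      v₁ x = j ∧ v₁ y = B ∧ I (j + 1) (Function.update v₁ x (j + 1)) A₁) :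
    ∃ v₁ A₁, Eff R M (cFor x y c) v A v₁ A₁ (∑ j ∈ Finset.range B, (T j + 9) + 5) ∧
      v₁ x = B ∧ v₁ y = B ∧ I B v₁ A₁ := by
  have key : ∀ k ≤ B, ∀ v A, v x = B - k → v y = B → I (B - k) v A → ∃ v₁ A₁,
      Eff R M (.loop (ltTest x y) (.seq c (cSet x (cAdd (cVar x) (cConst 1))))) v A v₁ A₁
        (∑ j ∈ Finset.Ico (B - k) B, (T j + 9) + 1) ∧ v₁ x = B ∧ v₁ y = B ∧ I B v₁ A₁ := by
    intro k
    induction k with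
    | zero =>
      intro _ v A h1 h2 h3
      exact ⟨v, A, (eff_loop_false hx hy (by omega)).le (by simp), h1, h2, h3⟩
    | succ k ih =>
      intro hk v A h1 h2 h3
      obtain ⟨v₁, A₁, he, hx₁, hy₁, hI₁⟩ := hI _ (by omega) v A h1 h2 h3
      have hset := eff_set (R := R) (M := M) (A := A₁) x
        (comp_add (comp_var (v := v₁) hx) (comp_const 1))
      rw [hx₁] at hset
      rw [show B - (k + 1) + 1 = B - k by omega] at hI₁ hset
      obtain ⟨v₂, A₂, he₂, h4⟩ := ih (by omega) _ _ (Function.update_self _ _ _)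
        (by rw [Function.update_of_ne (Ne.symm hxy), hy₁]) hI₁
      refine ⟨v₂, A₂, (eff_loop_true hx hy (by omega) (he.seq hset) he₂).le ?_, h4⟩
      have hs := Finset.sum_eq_sum_Ico_succ_bot (show B - (k + 1) < B by omega) fun j => T j + 9
      rw [show B - (k + 1) + 1 = B - k by omega] at hs
      rw [hs]
      omega
  obtain ⟨v₁, A₁, he, h4⟩ := key B le_rfl (Function.update v x 0) A (by simp)
    (by rw [Function.update_of_ne (Ne.symm hxy), hB]) (by simpa using h0)
  refine ⟨v₁, A₁, ((eff_set x (comp_const 0)).seq he).le ?_, h4⟩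
  rw [Nat.sub_self, Nat.Ico_zero_eq_range]
  omega

end Commands

/-! ### Peeling -/

section Peel

variable {m n : ℕ} {R : RepMatrix m n} {M : Fin m → Finset (Sym2 (Fin n))} {v : ℕ → ℕ}
  {A : ℕ → ℕ → ℕ}

/-- The array `f` is zero exactly on `S`. -/
def Marks {k : ℕ} (S : Finset (Fin k)) (f : ℕ → ℕ) : Prop := ∀ i : Fin k, f i = 0 ↔ i ∈ S

/-- A summand is 1 when the list entry lies in `S` and 0 otherwise, and no entry occurs twice. -/
theorem sum_list_marks {k : ℕ} {S : Finset (Fin k)} {f : ℕ → ℕ} (hf : Marks S f)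
    (l : List (Fin k)) (hl : l.Nodup) {g : ℕ → ℕ} (hg : ∀ j (hj : j < l.length), g j = l[j]) :
    ∑ j ∈ Finset.range l.length, (1 - f (g j)) = (S.filter (· ∈ l)).card := by
  rw [Finset.sum_range]
  have h1 : ∀ j : Fin l.length, 1 - f (g j) = if l[j] ∈ S then 1 else 0 := by
    intro j
    rw [hg j j.2]
    have := hf l[j]
    simp only [Fin.getElem_fin] at this ⊢
    split_ifs with h
    · rw [this.2 h]
    · have := mt this.1 h; omega
  rw [Finset.sum_congr rfl fun j _ => h1 j, Finset.sum_boole, Nat.cast_id]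
  refine Finset.card_bij (fun j _ => l[j]) ?_ ?_ ?_
  · intro j hj
    simp only [Finset.mem_filter, Finset.mem_univ, true_and] at hj ⊢
    exact ⟨hj, List.getElem_mem _⟩
  · intro a _ b _ hab
    exact Fin.ext ((hl.getElem_inj_iff).1 hab)
  · intro b hb
    rw [Finset.mem_filter] at hb
    obtain ⟨j, hj, rfl⟩ := List.getElem_of_mem hb.2
    exact ⟨⟨j, hj⟩, by simpa using hb.1, rfl⟩

/-- The number of labels of a vertex. -/
def tdegree (R : RepMatrix m n) (w : ℕ) : ℕ := if h : w < n then (choiceList R ⟨w, h⟩).length else 0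

/-- Double counting of the entries of `R` that are `true`. -/
theorem sum_tdegree (R : RepMatrix m n) : ∑ w ∈ Finset.range n, tdegree R w = totalSize R := by
  have h1 : ∀ w : Fin n, tdegree R w = ∑ ℓ, if R ℓ w = true then 1 else 0 := by
    intro w
    rw [tdegree, dif_pos w.2, choiceList, ← List.toFinset_card_of_nodup
      ((List.nodup_finRange m).filter _), Finset.sum_boole, Nat.cast_id]
    congr 1
    ext ℓ; simp
  rw [Finset.sum_range, Finset.sum_congr rfl fun w _ => h1 w, Finset.sum_comm, totalSize]
  refine Finset.sum_congr rfl fun ℓ _ => ?_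
  rw [Finset.sum_boole, Nat.cast_id, labelSet]

/-- The new mark of the label `ℓ`. -/
def markL (R : RepMatrix m n) (M : Fin m → Finset (Sym2 (Fin n))) (f : ℕ → ℕ) (ℓ : ℕ) : ℕ :=
  2 - ∑ j ∈ Finset.range (tsize R ℓ), (1 - f (tableValue R M .member ℓ j))

/-- The new mark of the vertex `w`. -/
def markV (R : RepMatrix m n) (M : Fin m → Finset (Sym2 (Fin n))) (f : ℕ → ℕ) (w : ℕ) : ℕ :=
  2 - ∑ j ∈ Finset.range (tdegree R w), (1 - f (tableValue R M .label w j))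

theorem tableValue_label {w j : ℕ} (h : w < n) (hj : j < (choiceList R ⟨w, h⟩).length) :
    tableValue R M .label w j = (choiceList R ⟨w, h⟩)[j] := by
  simp [tableValue, h, List.getElem?_eq_getElem hj]

/-- The truncated difference of 2 and a count vanishes exactly when the count is at least 2. -/
theorem marks_markL {S : Finset (Fin n)} {f : ℕ → ℕ} (hf : Marks S f) :
    Marks (keepL R S) (markL R M f) := by
  intro ℓ
  rw [mem_keepL, markL, tsize, dif_pos ℓ.2, sum_list_marks hf (memberList R ℓ)
    ((List.nodup_finRange n).filter _) fun j hj => tableValue_member (M := M) ℓ.2 hj]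
  simp only [mem_memberList]
  omega

theorem marks_markV {S : Finset (Fin m)} {f : ℕ → ℕ} (hf : Marks S f) :
    Marks (keepV R S) (markV R M f) := by
  intro w
  rw [mem_keepV, markV, tdegree, dif_pos w.2, sum_list_marks hf (choiceList R w)
    ((List.nodup_finRange m).filter _) fun j hj => tableValue_label (M := M) w.2 hj]
  have : ∀ ℓ, ℓ ∈ choiceList R w ↔ R ℓ w = true := fun ℓ => by simp [choiceList]
  simp only [this]
  omega

/-- Program for `markL`. -/
def cMarkL (l : Code) : Code :=
  cSub (cConst 2) (cSum (cSize l) fun j => cNot (cGet 1 (cTable .member l j)))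

/-- Program for `markV`. -/
def cMarkV (w : Code) : Code :=
  cSub (cConst 2) (cSum (cTable .degree w (cConst 0)) fun j => cNot (cGet 0 (cTable .label w j)))

theorem comp_markL {d : ℕ} {l : Code} {x : ℕ} (hl : Comp R M d v A l x 1) :
    Comp R M d v A (cMarkL l) (markL R M (A 1) x) (tsize R x * 20 + 15) :=
  (comp_sub (comp_const 2) (comp_sum_le (T := 11) (comp_size hl) fun _ _ _ _ he _ hj =>
    comp_not (comp_get (comp_table (hl.mono he) hj .member) 1))).le (by omega)

theorem comp_markV {d : ℕ} {w : Code} {x : ℕ} (hw : Comp R M d v A w x 1) :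
    Comp R M d v A (cMarkV w) (markV R M (A 0) x) (tdegree R x * 20 + 15) :=
  (comp_sub (comp_const 2) (comp_sum_le (T := 11) (comp_table hw (comp_const 0) .degree)
    fun _ _ _ _ he _ hj => comp_not (comp_get (comp_table (hw.mono he) hj .label) 0))).le
      (by unfold tdegree; simp only [tableValue]; omega)

/-- One round of peeling. -/
def peelBody : Cmd :=
  .seq (cFor 2 0 (cStore 0 (cVar 2) (cMarkL (cVar 2))))
    (.seq (cFor 2 1 (cStore 1 (cVar 2) (cMarkV (cVar 2))))
      (.seq (cSet 4 (cVar 3)) (cSet 3 (cSum (cVar 1) fun w => cNot (cGet 1 w)))))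

/-- Peeling until the number of vertices that are left does not change. -/
def peelCmd : Cmd :=
  .seq (cSet 3 (cVar 1)) (.seq (cSet 4 (cAdd (cVar 1) (cConst 1)))
    (.loop (ltTest 3 4) peelBody))

/-- The value to be stored depends on the other arrays only, so overwriting the array `a` does not
disturb later iterations. -/
theorem eff_for_store {a y B : ℕ} (hy : y < 10) (hy2 : 2 ≠ y) (hB : v y = B) {e : Code}
    {F T : ℕ → ℕ} (he : ∀ j < B, ∀ v₁ A₁, v₁ 2 = j → (∀ b ≠ a, A₁ b = A b) →
      Comp R M 10 v₁ A₁ e (F j) (T j)) :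
    ∃ v₁ A₁, Eff R M (cFor 2 y (cStore a (cVar 2) e)) v A v₁ A₁
        (∑ j ∈ Finset.range B, (T j + 13) + 5) ∧
      (∀ y ≠ 2, v₁ y = v y) ∧ (∀ b ≠ a, A₁ b = A b) ∧ ∀ i < B, A₁ a i = F i := by
  obtain ⟨v₁, A₁, h1, -, -, h2⟩ := eff_for (R := R) (M := M) (v := v) (A := A) (x := 2) (y := y)
    (c := cStore a (cVar 2) e) (T := fun j => T j + 4) (by omega) hy hy2 hB
    (fun j v₁ A₁ => (∀ y ≠ 2, v₁ y = v y) ∧ (∀ b ≠ a, A₁ b = A b) ∧ ∀ i < j, A₁ a i = F i)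
    ⟨fun y hy => by rw [Function.update_of_ne hy], fun _ _ => rfl, fun i hi => by omega⟩ (by
      rintro j hj v₁ A₁ h2 hyB ⟨hI1, hI2, hI3⟩
      have hs := eff_store (R := R) (M := M) a (comp_var (A := A₁) (v := v₁) (show 2 < 10 by omega))
        (he j hj v₁ A₁ h2 hI2)
      rw [h2] at hs
      refine ⟨_, _, hs.le (by omega), h2, hyB, ?_, ?_, ?_⟩
      · intro y hy
        rw [Function.update_of_ne hy, hI1 y hy]
      · intro b hb
        rw [Function.update_of_ne hb, hI2 b hb]
      · intro i hi
        rw [Function.update_self]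
        rcases Nat.lt_succ_iff_lt_or_eq.1 hi with h | rfl
        · rw [Function.update_of_ne (by omega), hI3 i h]
        · rw [Function.update_self])
  exact ⟨v₁, A₁, h1.le (by simp only [add_assoc, Nat.reduceAdd, le_refl]), h2⟩

/-- The state of the memory after `t` rounds of peeling. -/
structure PeelState (R : RepMatrix m n) (t : ℕ) (v : ℕ → ℕ) (A : ℕ → ℕ → ℕ) : Prop where
  zero : v 0 = m
  one : v 1 = n
  three : v 3 = (aliveV R t).card
  four : v 4 = if t = 0 then n + 1 else (aliveV R (t - 1)).card
  marksV : Marks (aliveV R t) (A 1)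
  marksL : t ≠ 0 → Marks (keepL R (aliveV R (t - 1))) (A 0)

theorem sum_marks {k : ℕ} {S : Finset (Fin k)} {f : ℕ → ℕ} (hf : Marks S f) :
    ∑ j ∈ Finset.range k, (1 - f j) = S.card := by
  have := sum_list_marks hf (List.finRange k) (List.nodup_finRange k) (g := id)
    fun j hj => by simp
  simpa using this

theorem eff_peelBody {t : ℕ} (h : PeelState R t v A) : ∃ v₁ A₁,
    Eff R M peelBody v A v₁ A₁ (inputSize R * 60) ∧ PeelState R (t + 1) v₁ A₁ := by
  obtain ⟨v₁, A₁, e₁, hv₁, hA₁, hF₁⟩ := eff_for_store (R := R) (M := M) (v := v) (A := A) (a := 0)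
    (y := 0) (e := cMarkL (cVar 2)) (F := markL R M (A 1)) (T := fun j => tsize R j * 20 + 15)
    (by omega) (by omega) h.zero (by
      intro j hj v₁ A₁ h2 hA
      have := comp_markL (R := R) (M := M) (A := A₁) (comp_var (v := v₁) (show 2 < 10 by omega))
      rwa [h2, hA 1 (by omega)] at this)
  have hm₁ : Marks (keepL R (aliveV R t)) (A₁ 0) := fun i => by
    rw [hF₁ i i.2]; exact marks_markL h.marksV i
  obtain ⟨v₂, A₂, e₂, hv₂, hA₂, hF₂⟩ := eff_for_store (R := R) (M := M) (v := v₁) (A := A₁) (a := 1)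
    (y := 1) (e := cMarkV (cVar 2)) (F := markV R M (A₁ 0)) (T := fun j => tdegree R j * 20 + 15)
    (by omega) (by omega) ((hv₁ 1 (by omega)).trans h.one) (by
      intro j hj v₁ A₁ h2 hA
      have := comp_markV (R := R) (M := M) (A := A₁) (comp_var (v := v₁) (show 2 < 10 by omega))
      rwa [h2, hA 0 (by omega)] at this)
  have hm₂ : Marks (aliveV R (t + 1)) (A₂ 1) := fun i => by
    rw [hF₂ i i.2]; exact marks_markV hm₁ i
  have e₃ := eff_set (R := R) (M := M) (A := A₂) 4 (comp_var (v := v₂) (show 3 < 10 by omega))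
  set v₃ := Function.update v₂ 4 (v₂ 3) with hv₃
  have h31 : v₃ 1 = n := by
    rw [hv₃, Function.update_of_ne (by omega), hv₂ 1 (by omega), hv₁ 1 (by omega), h.one]
  have e₄ := eff_set (R := R) (M := M) (A := A₂) 3 (comp_sum_le (T := 7) (f := fun w => 1 - A₂ 1 w)
    (body := fun w => cNot (cGet 1 w)) (comp_var (v := v₃) (show 1 < 10 by omega))
    fun _ _ _ _ _ _ hj => comp_not (comp_get hj 1))
  rw [h31, sum_marks hm₂] at e₄
  refine ⟨_, _, (e₁.seq (e₂.seq (e₃.seq e₄))).le ?_, ?_⟩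
  · simp only [add_assoc, Finset.sum_add_distrib, ← Finset.sum_mul, sum_tsize, sum_tdegree,
      Finset.sum_const, Finset.card_range, smul_eq_mul, inputSize]
    omega
  · have hk : ∀ y, y ≠ 2 → y ≠ 3 → y ≠ 4 →
        Function.update v₃ 3 (aliveV R (t + 1)).card y = v y := by
      intro y h2 h3 h4
      rw [Function.update_of_ne h3, hv₃, Function.update_of_ne h4, hv₂ y h2, hv₁ y h2]
    refine ⟨(hk 0 (by omega) (by omega) (by omega)).trans h.zero,
      (hk 1 (by omega) (by omega) (by omega)).trans h.one, Function.update_self _ _ _, ?_, hm₂, ?_⟩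
    · rw [Function.update_of_ne (by omega), hv₃, Function.update_self, hv₂ 3 (by omega),
        hv₁ 3 (by omega), h.three]
      simp
    · intro _
      rw [hA₂ 0 (by omega)]
      simpa using hm₁

theorem exists_stable (R : RepMatrix m n) :
    ∃ K, aliveV R (K + 1) = aliveV R K ∧ ∀ t < K, aliveV R (t + 1) ≠ aliveV R t := by
  classical
  have hex : ∃ K, aliveV R (K + 1) = aliveV R K := by
    by_contra! hne
    have hlt : ∀ t, (aliveV R t).card + t ≤ n := by
      intro t
      induction t with
      | zero => simpa using Finset.card_le_univ (aliveV R 0)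
      | succ t ih =>
        have := Finset.card_lt_card ((aliveV_succ_subset R t).ssubset_of_ne (hne t))
        omega
    have := hlt (n + 1)
    omega
  exact ⟨Nat.find hex, Nat.find_spec hex, fun t ht => Nat.find_min hex ht⟩

/-- The loop makes K + 1 rounds; the last one changes nothing and is needed to notice this.
Comparing cardinalities is enough, since the sets decrease. -/
theorem eff_peelCmd (hA : A = fun _ _ => 0) (h0 : v 0 = m) (h1 : v 1 = n) {K : ℕ}
    (hK : aliveV R (K + 1) = aliveV R K) (hK' : ∀ t < K, aliveV R (t + 1) ≠ aliveV R t) :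
    ∃ v₁ A₁, Eff R M peelCmd v A v₁ A₁ ((K + 2) * (inputSize R * 61)) ∧
      v₁ 0 = m ∧ v₁ 1 = n ∧ Marks (aliveV R K) (A₁ 1) ∧ Marks (keepL R (aliveV R K)) (A₁ 0) := by
  have hX : 1 ≤ inputSize R := by unfold inputSize; omega
  have key : ∀ k ≤ K + 1, ∀ v A, PeelState R (K + 1 - k) v A → ∃ v₁ A₁,
      Eff R M (.loop (ltTest 3 4) peelBody) v A v₁ A₁ (k * (inputSize R * 61) + 1) ∧
        PeelState R (K + 1) v₁ A₁ := by
    intro k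
    induction k with
    | zero =>
      intro _ v A h
      refine ⟨v, A, (eff_loop_false (by omega) (by omega) ?_).le (by omega), h⟩
      rw [h.three, h.four]
      simp [hK]
    | succ k ih =>
      intro hk v A h
      obtain ⟨v₁, A₁, e₁, h₁⟩ := eff_peelBody (M := M) h
      rw [show K + 1 - (k + 1) + 1 = K + 1 - k by omega] at h₁
      obtain ⟨v₂, A₂, e₂, h₂⟩ := ih (by omega) v₁ A₁ h₁
      refine ⟨v₂, A₂, (eff_loop_true (by omega) (by omega) ?_ e₁ e₂).le ?_, h₂⟩
      · rw [h.three, h.four]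
        split_ifs with ht
        -- The fictitious earlier count n + 1 makes the loop start.
        · exact Nat.lt_succ_of_le ((Finset.card_le_univ _).trans_eq (Fintype.card_fin n))
        · obtain ⟨t, ht'⟩ := Nat.exists_eq_succ_of_ne_zero ht
          rw [ht', Nat.succ_sub_one]
          exact Finset.card_lt_card ((aliveV_succ_subset R t).ssubset_of_ne (hK' t (by omega)))
      · rw [add_mul]; omega
  have e₁ := eff_set (R := R) (M := M) (A := A) 3 (comp_var (v := v) (show 1 < 10 by omega))
  set v₁ := Function.update v 3 (v 1) with hv₁
  have e₂ := eff_set (R := R) (M := M) (A := A) 4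
    (comp_add (comp_var (v := v₁) (show 1 < 10 by omega)) (comp_const 1))
  set v₂ := Function.update v₁ 4 (v₁ 1 + 1) with hv₂
  have hst : PeelState R (K + 1 - (K + 1)) v₂ A := by
    rw [Nat.sub_self]
    refine ⟨by simp [hv₂, hv₁, h0], by simp [hv₂, hv₁, h1], by simp [hv₂, hv₁, h1, aliveV],
      by simp [hv₂, hv₁, h1], fun i => by simp [hA, aliveV], fun h => absurd rfl h⟩
  obtain ⟨v₃, A₃, e₃, h₃⟩ := key (K + 1) le_rfl v₂ A hst
  refine ⟨v₃, A₃, (e₁.seq (e₂.seq e₃)).le ?_, h₃.zero, h₃.one, ?_, ?_⟩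
  · rw [show K + 2 = K + 1 + 1 by omega, add_mul (K + 1) 1, one_mul]
    omega
  · have := h₃.marksV
    rwa [hK] at this
  · exact h₃.marksL (by omega)

end Peel

/-! ### The list of the 2-core -/

section Collect

variable {m n : ℕ} {R : RepMatrix m n} {M : Fin m → Finset (Sym2 (Fin n))} {v : ℕ → ℕ}
  {A : ℕ → ℕ → ℕ}

/-- Appends the zeros of the array `a` below the variable `y` to the list in the array `2`, whose
length is in the variable `5`. -/
def cCollect (y a : ℕ) : Cmd :=
  cFor 2 y (.seq (cStore 2 (cVar 5) (cVar 2)) (cSet 5 (cAdd (cVar 5) (cNot (cGet a (cVar 2))))))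

/-- Every number is written at the end of the list, but the end moves only past elements of `S`; the
next number overwrites a rejected one. -/
theorem eff_collect {y a B : ℕ} (hy : y < 10) (hy2 : 2 ≠ y) (hy5 : y ≠ 5) (ha : a ≠ 2)
    (hB : v y = B) {S : Finset (Fin B)} (hS : Marks S (A a)) :
    ∃ v₁ A₁, Eff R M (cCollect y a) v A v₁ A₁ (B * 28 + 5) ∧
      (∀ y, y ≠ 2 → y ≠ 5 → v₁ y = v y) ∧ (∀ b ≠ 2, A₁ b = A b) ∧ v₁ 5 = v 5 + S.card ∧
      (∀ q < v 5, A₁ 2 q = A 2 q) ∧ ∀ i ∈ S, ∃ q < v₁ 5, A₁ 2 q = i := by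
  obtain ⟨v₁, A₁, h1, -, -, h2, h3, h4, h5, h6⟩ := eff_for (R := R) (M := M) (v := v) (A := A)
    (x := 2) (y := y) (T := fun _ => 19)
    (c := .seq (cStore 2 (cVar 5) (cVar 2)) (cSet 5 (cAdd (cVar 5) (cNot (cGet a (cVar 2))))))
    (by omega) hy hy2 hB
    (fun j v₁ A₁ => (∀ y, y ≠ 2 → y ≠ 5 → v₁ y = v y) ∧ (∀ b ≠ 2, A₁ b = A b) ∧
      v₁ 5 = v 5 + ∑ i ∈ Finset.range j, (1 - A a i) ∧ (∀ q < v 5, A₁ 2 q = A 2 q) ∧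
      ∀ i < j, A a i = 0 → ∃ q < v₁ 5, A₁ 2 q = i)
    ⟨fun y h2 _ => by rw [Function.update_of_ne h2], fun _ _ => rfl, by simp, fun _ _ => rfl,
      fun i hi => by omega⟩ (by
      rintro j hj v₁ A₁ h2 hyB ⟨hI1, hI2, hI3, hI4, hI5⟩
      have e₁ := eff_store (R := R) (M := M) 2 (comp_var (A := A₁) (v := v₁) (show 5 < 10 by omega))
        (comp_var (show 2 < 10 by omega))
      rw [h2] at e₁
      set A₂ := Function.update A₁ 2 (Function.update (A₁ 2) (v₁ 5) j) with hA₂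
      have e₂ := eff_set (R := R) (M := M) 5 (comp_add (comp_var (A := A₂) (v := v₁)
        (show 5 < 10 by omega)) (comp_not (comp_get (comp_var (show 2 < 10 by omega)) a)))
      have ha' : A₂ a j = A a j := by rw [hA₂, Function.update_of_ne ha, hI2 a ha]
      rw [h2, ha'] at e₂
      refine ⟨_, A₂, (e₁.seq e₂).le (by omega), by rw [Function.update_of_ne (by omega), h2],
        by rw [Function.update_of_ne hy5, hyB], ?_, ?_, ?_, ?_, ?_⟩
      · intro z hz2 hz5
        rw [Function.update_of_ne hz2, Function.update_of_ne hz5, hI1 z hz2 hz5]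
      · intro b hb
        rw [hA₂, Function.update_of_ne hb, hI2 b hb]
      · rw [Function.update_of_ne (by omega), Function.update_self, hI3, Finset.sum_range_succ,
          add_assoc]
      · intro q hq
        rw [hA₂, Function.update_self, Function.update_of_ne (by omega), hI4 q hq]
      · intro i hi h0
        rw [Function.update_of_ne (by omega), Function.update_self, hA₂, Function.update_self]
        rcases Nat.lt_succ_iff_lt_or_eq.1 hi with h | rfl
        · obtain ⟨q, hq, hq'⟩ := hI5 i h h0
          exact ⟨q, by omega, by rw [Function.update_of_ne (by omega), hq']⟩
        · exact ⟨v₁ 5, by omega, Function.update_self _ _ _⟩)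
  refine ⟨v₁, A₁, h1.le (by simp), h2, h3, by rw [h4, sum_marks hS], h5, fun i hi => ?_⟩
  exact h6 i i.2 ((hS i).2 hi)

/-- The preparation: peeling and collecting the 2-core. -/
def prepCmd : Cmd :=
  .seq peelCmd (.seq (cSet 5 (cConst 0)) (.seq (cCollect 1 1) (cCollect 0 0)))

/-- The number of rounds of peeling after which nothing changes. -/
def peelDepth (R : RepMatrix m n) : ℕ := (exists_stable R).choose

/-- A stable set of vertices and its labels are disjoint parts of the core. Hence the collected list
has at most `coreCard R` entries. -/
theorem card_le_coreCard {S : Finset (Fin n)} (hS : keepV R (keepL R S) = S) :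
    S.card + (keepL R S).card ≤ coreCard R := by
  classical
  obtain ⟨h1, h2⟩ := mem_core_of_stable hS
  rw [add_comm, ← Finset.card_disjSum, coreCard, ← Set.ncard_coe_finset]
  refine Set.ncard_le_ncard ?_ (Set.toFinite _)
  rintro (ℓ | w) h
  · exact h2 ℓ (by simpa using h)
  · exact h1 w (by simpa using h)

theorem eff_prepCmd (hA : A = fun _ _ => 0) (h0 : v 0 = m) (h1 : v 1 = n) :
    ∃ v₁ A₁ N, Eff R M prepCmd v A v₁ A₁ ((peelDepth R + 3) * (inputSize R * 61)) ∧
      v₁ 0 = m ∧ v₁ 5 = N ∧ Covers R A₁ N ∧ N ≤ coreCard R := by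
  obtain ⟨hK, hK'⟩ := (exists_stable R).choose_spec
  change aliveV R (peelDepth R + 1) = aliveV R (peelDepth R) at hK
  obtain ⟨v₁, A₁, e₁, h10, h11, hmV, hmL⟩ := eff_peelCmd (M := M) hA h0 h1 hK hK'
  have e₂ := eff_set (R := R) (M := M) (A := A₁) (v := v₁) 5 (comp_const 0)
  set v₂ := Function.update v₁ 5 0 with hv₂
  obtain ⟨v₃, A₃, e₃, hv₃, hA₃, h35, -, hc₃⟩ := eff_collect (R := R) (M := M) (v := v₂) (A := A₁)
    (y := 1) (a := 1) (by omega) (by omega) (by omega) (by omega)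
    (show v₂ 1 = n by simp [hv₂, h11]) hmV
  obtain ⟨v₄, A₄, e₄, hv₄, hA₄, h45, hq₄, hc₄⟩ := eff_collect (R := R) (M := M) (v := v₃) (A := A₃)
    (y := 0) (a := 0) (by omega) (by omega) (by omega) (by omega)
    (show v₃ 0 = m by rw [hv₃ 0 (by omega) (by omega)]; simp [hv₂, h10])
    (show Marks (keepL R (aliveV R (peelDepth R))) (A₃ 0) by rwa [hA₃ 0 (by omega)])
  refine ⟨v₄, A₄, v₄ 5, (e₁.seq (e₂.seq (e₃.seq e₄))).le ?_, ?_, rfl, ⟨?_, ?_⟩, ?_⟩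
  · rw [show peelDepth R + 3 = peelDepth R + 2 + 1 by omega, add_mul (peelDepth R + 2) 1, one_mul]
    have : n * 28 + m * 28 + 18 ≤ inputSize R * 61 := by unfold inputSize; omega
    omega
  · rw [hv₄ 0 (by omega) (by omega), hv₃ 0 (by omega) (by omega)]
    simp [hv₂, h10]
  · intro w hw
    obtain ⟨q, hq, hq'⟩ := hc₃ w (mem_aliveV_of_mem_core _ hw)
    exact ⟨q, by omega, by rw [hq₄ q hq, hq']⟩
  · intro ℓ hℓ
    exact hc₄ ℓ (inl_mem_core_keepL (fun w hw => mem_aliveV_of_mem_core _ hw) hℓ)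
  · rw [h45, h35, hv₂, Function.update_self, zero_add]
    exact card_le_coreCard hK

/-- If k + 1 rounds are effective, a vertex removed in the last of them starts a path on 2k + 1
nodes. So the number of rounds is logarithmic in a typical graph. -/
theorem peelDepth_le {t : ℝ} (h : ∀ l : List (Fin m ⊕ Fin n), l.Nodup →
    l.IsChain (incGraph R).Adj → (l.length : ℝ) ≤ t) (ht : 0 ≤ t) : (peelDepth R : ℝ) ≤ t + 1 := by
  obtain ⟨-, hK'⟩ := (exists_stable R).choose_spec
  rcases hk : peelDepth R with _ | k
  · simp; linarith
  have hne := hK' k (by change k < peelDepth R; omega)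
  obtain ⟨w, hw, hw'⟩ := Finset.exists_of_ssubset
    ((aliveV_succ_subset R k).ssubset_of_ne hne)
  obtain ⟨l, hnd, hch, hlen, -⟩ := exists_path_of_peeled R k w hw hw'
  have := h _ hnd hch
  rw [List.length_cons, hlen] at this
  push_cast at this ⊢
  have : (0 : ℝ) ≤ k := by positivity
  linarith

end Collect

/-! ### The program -/

section Program

variable {m n : ℕ} {R : RepMatrix m n} {P : Cmd}

theorem leads_seq {s : Config m n} {c d : Cmd} {rest : List Cmd} (hs : s.stack = .seq c d :: rest) :
    Leads R s { s with stack := c :: d :: rest, time := s.time + 1 } 1 := by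
  have hq : Quiet s := ⟨by simp [hs], by rintro ⟨e, r, h⟩; rw [hs] at h; cases h⟩
  convert Leads.single (R := R) hq using 1
  unfold next
  rw [hs]

theorem leads_loop_true {s : Config m n} {x y : ℕ} {c : Cmd} {rest : List Cmd}
    (hs : s.stack = .loop (ltTest x y) c :: rest) (h : s.vars x < s.vars y) :
    Leads R s { s with stack := c :: .loop (ltTest x y) c :: rest, time := s.time + 1 } 1 := by
  have hq : Quiet s := ⟨by simp [hs], by rintro ⟨e, r, h⟩; rw [hs] at h; cases h⟩
  convert Leads.single (R := R) hq using 1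
  unfold next
  rw [hs]
  simp only [Config.eval_eq, ltTest, value]
  rw [if_pos (by omega)]

theorem leads_loop_false {s : Config m n} {x y : ℕ} {c : Cmd} {rest : List Cmd}
    (hs : s.stack = .loop (ltTest x y) c :: rest) (h : s.vars y ≤ s.vars x) :
    Leads R s { s with stack := rest, time := s.time + 1 } 1 :=
  Runs.loop_false (by simp only [ltTest, value]; omega) s rest hs rfl rfl rfl

/-- Every step without a draw costs exactly one unit of time. -/
theorem Leads.fields {s a : Config m n} {t : ℕ} (h : Leads R s a t) :
    a.rounds = s.rounds ∧ a.time = s.time + t := by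
  obtain ⟨hq, rfl⟩ := h
  induction t with
  | zero => simp
  | succ t ih =>
    obtain ⟨h1, h2⟩ := ih fun i hi => hq i (by omega)
    obtain ⟨h3, h4⟩ := hq t (by omega)
    rw [Function.iterate_succ_apply']
    refine ⟨(next_fields R _).2.2.trans h1, ?_⟩
    rw [← add_assoc, ← h2]
    generalize (next R)^[t] s = s' at h3 h4
    unfold next
    rcases hs : s'.stack with _ | ⟨c, rest⟩
    · exact absurd hs h3
    · cases c <;> first | rfl | exact absurd ⟨_, _, hs⟩ h4

/-- If every draw leads to the next one or to a halt, so does every reachable configuration. -/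
theorem leads_of_reachable {Anc : Config m n → Prop}
    (h0 : ∃ a t, Leads R (start P m n) a t ∧ Anc a)
    (hanc : ∀ a, Anc a → a.stack = [] ∨ ∃ e rest, a.stack = .draw e :: rest ∧
      ∃ h : a.eval R e < m, ∀ N ∈ maximalMatchings (labelSet R ⟨a.eval R e, h⟩),
        ∃ a' t, Leads R (a.redraw R rest ⟨a.eval R e, h⟩ N) a' t ∧ Anc a')
    {s : Config m n} (hs : Reachable R P s) : ∃ a t, Leads R s a t ∧ Anc a := by
  refine reachable_induction (Q := fun s => ∃ a t, Leads R s a t ∧ Anc a) h0 ?_ hs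
  rintro s - ⟨a, t, hl, ha⟩ s' hs'
  -- Either the configuration itself draws or halts, or a deterministic step brings its target one
  -- step nearer.
  rcases t with _ | t
  · obtain rfl : s = a := hl.2
    rcases hanc s ha with h | ⟨e, rest, he, h, hN⟩
    · rw [step_halted h] at hs'
      obtain rfl : s' = s := by simpa using hs'
      exact ⟨s', 0, Leads.refl s', ha⟩
    · rw [step_draw he h, PMF.mem_support_map_iff] at hs'
      obtain ⟨N, hNs, rfl⟩ := hs'
      exact hN N (mem_support_randomMatching.1 hNs)
  · have hq : Quiet s := hl.1 0 (by omega)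
    rw [step_eq_pure_next hq.2] at hs'
    obtain rfl : s' = next R s := by simpa using hs'
    exact ⟨a, t, ⟨fun i hi => hl.1 (i + 1) (by omega), hl.2⟩, ha⟩

/-- The body of the loop in `drawAll`. -/
def drawBody : Cmd := .seq (.draw (.var 2)) (.assign 2 (.add (.var 2) (.const 1)))

/-- The first draw of all matchings. -/
def drawAll : Cmd :=
  .seq (.assign 2 (.const 0))
    (.loop (ltTest 2 0) drawBody)

/-- The loop of the algorithm. -/
def mainLoop : Cmd :=
  .loop (ltTest 6 5) (.seq (.draw (.get 2 (.var 6))) (cSet 6 cPos))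

/-- The commands after the first draw of all matchings. -/
def tailCmd : Cmd := .seq (cSet 6 cPos) mainLoop

/-- An implementation of the Weak Bipartization Algorithm. -/
def prog : Cmd := .seq prepCmd (.seq drawAll tailCmd)

end Program

/-! ### Correctness and running time of the program -/

section Anchors

variable {m n : ℕ} {R : RepMatrix m n} {N T : ℕ}

/-- The memory after the preparation. -/
structure Prepared (R : RepMatrix m n) (N : ℕ) (s : Config m n) : Prop where
  zero : s.vars 0 = m
  five : s.vars 5 = N
  covers : Covers R s.arrs N
  matching : ∀ ℓ, IsMatchingOf (labelSet R ℓ) (s.matching ℓ)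

/-- The labels below `j`. -/
def labelsBelow (m j : ℕ) : Finset (Fin m) := Finset.univ.filter fun ℓ => (ℓ : ℕ) < j

/-- A bound for the time before the first repeated draw. -/
def initTime (R : RepMatrix m n) (N T : ℕ) : ℕ :=
  T + (totalSize R + m * 4) + inputSize R * tPos N + 6

/-- A bound for the time of a round. -/
def roundTime (R : RepMatrix m n) (N : ℕ) : ℕ := totalSize R + inputSize R * tPos N + 5

/-- The machine is about to draw the matching of label `j` for the first time. -/
structure AtInit (R : RepMatrix m n) (T j : ℕ) (s : Config m n) : Prop where
  lt : j < m
  stack : s.stack = [.draw (.var 2), .assign 2 (.add (.var 2) (.const 1)),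
    .loop (ltTest 2 0) drawBody, tailCmd]
  two : s.vars 2 = j
  drawn : s.drawn = labelsBelow m j
  rounds : s.rounds = 0
  time : s.time ≤ T + ∑ i ∈ Finset.range j, (tsize R i + 4) + 2

/-- The machine is about to execute the body of the while loop. -/
structure AtLoop (R : RepMatrix m n) (N : ℕ) (s : Config m n) : Prop where
  stack : s.stack = [.draw (.get 2 (.var 6)), cSet 6 cPos, mainLoop]
  six : s.vars 6 = pos R s.matching s.arrs N
  lt : pos R s.matching s.arrs N < N

/-- The configurations in which the program draws or halts. -/
def Anchor (R : RepMatrix m n) (N T : ℕ) (s : Config m n) : Prop :=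
  Prepared R N s ∧ ((∃ j, AtInit R T j s) ∨
    s.drawn = Finset.univ ∧ s.time ≤ initTime R N T + s.rounds * roundTime R N ∧
      (AtLoop R N s ∨ s.stack = [] ∧ codd R s.matching = ∅))

/-- The result of the search decides: `N` means that `codd` is empty and the loop ends, a smaller
value is the position of a label to redraw. -/
theorem Anchor.of_mainLoop {s : Config m n} (h : Prepared R N s) (hs : s.stack = [mainLoop])
    (hd : s.drawn = Finset.univ) (h6 : s.vars 6 = pos R s.matching s.arrs N)
    (ht : s.time + 2 ≤ initTime R N T + s.rounds * roundTime R N) :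
    ∃ a t, Leads R s a t ∧ Anchor R N T a := by
  rcases pos_spec h.matching h.covers with ⟨h1, h2⟩ | ⟨h1, -⟩
  · refine ⟨_, _, leads_loop_false hs (by rw [h.five, h6, h1]), ⟨h.1, h.2, h.3, h.4⟩,
      Or.inr ⟨hd, ?_, Or.inr ⟨rfl, h2⟩⟩⟩
    change s.time + 1 ≤ initTime R N T + s.rounds * roundTime R N
    omega
  · refine ⟨_, _, (leads_loop_true hs (by rw [h.five, h6]; exact h1)).trans (leads_seq rfl),
      ⟨h.1, h.2, h.3, h.4⟩, Or.inr ⟨hd, ht, Or.inl ⟨rfl, h6, h1⟩⟩⟩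

theorem Anchor.of_search {s : Config m n} (h : Prepared R N s)
    (hs : s.stack = [cSet 6 cPos, mainLoop]) (hd : s.drawn = Finset.univ)
    (ht : s.time + inputSize R * tPos N + 4 ≤ initTime R N T + s.rounds * roundTime R N) :
    ∃ a t, Leads R s a t ∧ Anchor R N T a := by
  have hc : Ctx m N 10 s.vars := ⟨by omega, h.zero, h.five⟩
  obtain ⟨w, u, hu, hr, hw⟩ := eff_set (R := R) (M := s.matching) (A := s.arrs) 6 hc.comp_pos
    s.vars fun _ _ => rfl
  have hl := hr s [mainLoop] hs rfl rfl rfl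
  obtain ⟨a, t, hl', ha⟩ := Anchor.of_mainLoop (T := T) (R := R) (N := N)
    (s := { s with stack := [mainLoop], vars := w, arrs := s.arrs, time := s.time + u })
    ⟨(hw 0 (by omega)).trans h.zero, (hw 5 (by omega)).trans h.five, h.covers, h.matching⟩ rfl hd
    (hw 6 (by omega)) (by change s.time + u + 2 ≤ initTime R N T + s.rounds * roundTime R N; omega)
  exact ⟨a, _, hl.trans hl', ha⟩

theorem sum_tsize_add_four (R : RepMatrix m n) :
    ∑ i ∈ Finset.range m, (tsize R i + 4) = totalSize R + m * 4 := by
  rw [Finset.sum_add_distrib, sum_tsize]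
  simp

theorem Anchor.of_drawAll {s : Config m n} {j : ℕ} (h : Prepared R N s) (hj : j ≤ m)
    (hs : s.stack = [.loop (ltTest 2 0) drawBody, tailCmd]) (h2 : s.vars 2 = j)
    (hd : s.drawn = labelsBelow m j) (hr : s.rounds = 0)
    (ht : s.time ≤ T + ∑ i ∈ Finset.range j, (tsize R i + 4)) :
    ∃ a t, Leads R s a t ∧ Anchor R N T a := by
  rcases hj.lt_or_eq with hj | rfl
  · refine ⟨_, _, (leads_loop_true hs (by rw [h2, h.zero]; exact hj)).trans (leads_seq rfl),
      ⟨h.1, h.2, h.3, h.4⟩, Or.inl ⟨j, hj, rfl, h2, hd, hr, ?_⟩⟩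
    change s.time + 1 + 1 ≤ _
    omega
  · have hl := (leads_loop_false (R := R) hs (by rw [h2, h.zero])).trans (leads_seq rfl)
    obtain ⟨a, t, hl', ha⟩ := Anchor.of_search (T := T) (R := R) (N := N)
      (s := { s with stack := [cSet 6 cPos, mainLoop], time := s.time + 1 + 1 })
      ⟨h.1, h.2, h.3, h.4⟩ rfl (hd.trans (by ext ℓ; simp [labelsBelow])) (by
        change s.time + 1 + 1 + inputSize R * tPos N + 4 ≤ initTime R N T + s.rounds * _
        rw [sum_tsize_add_four] at ht
        unfold initTime
        omega)
    exact ⟨a, _, hl.trans hl', ha⟩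

theorem Prepared.redraw {s : Config m n} (h : Prepared R N s) (rest : List Cmd) {ℓ : Fin m}
    {E : Finset (Sym2 (Fin n))} (hE : E ∈ maximalMatchings (labelSet R ℓ)) :
    Prepared R N (s.redraw R rest ℓ E) :=
  ⟨h.1, h.2, h.3, Config.redraw_matching_isMatchingOf h.matching rest hE⟩

/-- Whatever matching is drawn, the machine reaches the next anchor without a further draw. A first
draw leaves the number of rounds at 0; a repeated draw raises it by one, which pays for the draw and
the next search. -/
theorem Anchor.after_draw {s : Config m n} (h : Anchor R N T s) :
    s.stack = [] ∨ ∃ e rest, s.stack = .draw e :: rest ∧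
      ∃ hlt : s.eval R e < m, ∀ E ∈ maximalMatchings (labelSet R ⟨s.eval R e, hlt⟩),
        ∃ a t, Leads R (s.redraw R rest ⟨s.eval R e, hlt⟩ E) a t ∧ Anchor R N T a := by
  obtain ⟨hp, ⟨j, hj⟩ | ⟨hd, ht, hL | ⟨h0, -⟩⟩⟩ := h
  · have hev : s.eval R (.var 2) = j := hj.two
    refine Or.inr ⟨_, _, hj.stack, hev ▸ hj.lt, fun E hE => ?_⟩
    have hp' := hp.redraw [.assign 2 (.add (.var 2) (.const 1)),
      .loop (ltTest 2 0) drawBody, tailCmd] hE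
    have hfin : (⟨s.eval R (.var 2), hev ▸ hj.lt⟩ : Fin m) = ⟨j, hj.lt⟩ := Fin.ext hev
    rw [hfin] at hp' hE ⊢
    set s' := s.redraw R [.assign 2 (.add (.var 2) (.const 1)),
      .loop (ltTest 2 0) drawBody, tailCmd] ⟨j, hj.lt⟩ E with hs'
    have hl := runs_assign (R := R) (M := s'.matching) (v := s'.vars) (A := s'.arrs) 2
      (.add (.var 2) (.const 1)) s' _ rfl rfl rfl rfl
    have hval : value R s'.matching s'.vars s'.arrs (.add (.var 2) (.const 1)) = j + 1 :=
      congrArg (· + 1) hj.two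
    rw [hval] at hl
    have hmem : (⟨j, hj.lt⟩ : Fin m) ∉ s.drawn := by rw [hj.drawn]; simp [labelsBelow]
    obtain ⟨a, t, hl', ha⟩ := Anchor.of_drawAll (T := T) (R := R) (N := N) (j := j + 1)
      (s := { s' with
        stack := [.loop (ltTest 2 0) drawBody, tailCmd]
        vars := Function.update s'.vars 2 (j + 1)
        time := s'.time + 1 })
      ⟨hp'.1, hp'.2, hp'.3, hp'.4⟩ hj.lt rfl
      (Function.update_self 2 (j + 1) s'.vars)
      (by
        change insert _ s.drawn = _
        rw [hj.drawn]
        ext ℓ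
        simp only [labelsBelow, Finset.mem_insert, Finset.mem_filter, Finset.mem_univ, true_and,
          Fin.ext_iff]
        omega)
      ((if_neg hmem).trans hj.rounds) (by
        have := hj.time
        have := tsize_eq (R := R) ⟨j, hj.lt⟩
        change s.time + (labelSet R ⟨j, hj.lt⟩).card + 1 + 1 ≤ _
        rw [Finset.sum_range_succ]
        simp only at this
        omega)
    exact ⟨a, _, hl.trans hl', ha⟩
  · have hev : s.eval R (.get 2 (.var 6)) = s.arrs 2 (pos R s.matching s.arrs N) :=
      congrArg (s.arrs 2) hL.six
    obtain ⟨h1, -⟩ | ⟨-, hlt, -⟩ := pos_spec hp.matching hp.covers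
    · exact absurd h1 hL.lt.ne
    refine Or.inr ⟨_, _, hL.stack, hev ▸ hlt, fun E hE => ?_⟩
    refine Anchor.of_search (hp.redraw _ hE) rfl ?_ ?_
    · change insert _ s.drawn = _
      rw [hd]
      simp
    · have hcard := tsize_le R (⟨s.eval R (.get 2 (.var 6)), hev ▸ hlt⟩ : Fin m)
      rw [tsize_eq] at hcard
      have hr : (s.redraw R [cSet 6 cPos, mainLoop] ⟨_, hev ▸ hlt⟩ E).rounds = s.rounds + 1 :=
        if_pos (by rw [hd]; exact Finset.mem_univ _)
      rw [hr, add_mul, one_mul]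
      change s.time + (labelSet R _).card + 1 + _ + 4 ≤ _
      have : roundTime R N = totalSize R + inputSize R * tPos N + 5 := rfl
      omega
  · exact Or.inl h0

theorem exists_anchor_start (R : RepMatrix m n) : ∃ N ≤ coreCard R, ∃ a t,
    Leads R (start prog m n) a t ∧
      Anchor R N ((peelDepth R + 3) * (inputSize R * 61) + 4) a := by
  obtain ⟨v, A, N, he, h0, h5, hc, hN⟩ := eff_prepCmd (R := R) (M := fun _ => ∅)
    (A := fun _ _ => 0) (v := fun x => if x = 0 then m else if x = 1 then n else 0) rfl rfl rfl
  refine ⟨N, hN, ?_⟩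
  obtain ⟨w, u, hu, hr, hw⟩ := he _ fun _ _ => rfl
  have l1 : Leads R (start prog m n) _ 1 := leads_seq rfl
  have l2 := l1.trans (hr _ _ rfl rfl rfl rfl)
  have l3 := (l2.trans (leads_seq rfl)).trans (leads_seq rfl)
  have l4 := l3.trans (runs_assign (R := R) (M := fun _ => ∅) (v := w) (A := A) 2 (.const 0)
    _ _ rfl rfl rfl rfl)
  -- The summand 4 pays for opening three compositions and for one assignment.
  obtain ⟨a, t, hl, ha⟩ := Anchor.of_drawAll (R := R) (N := N) (j := 0)
    (T := (peelDepth R + 3) * (inputSize R * 61) + 4)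
    (s := ⟨[.loop (ltTest 2 0) drawBody, tailCmd], Function.update w 2 0, A, ∅, fun _ => ∅, 0,
      0 + 1 + u + 1 + 1 + 1⟩)
    ⟨(Function.update_of_ne (show 0 ≠ 2 by omega) 0 w).trans ((hw 0 (by omega)).trans h0),
      (Function.update_of_ne (show 5 ≠ 2 by omega) 0 w).trans ((hw 5 (by omega)).trans h5), hc,
      fun ℓ => by constructor <;> simp⟩ (Nat.zero_le _) rfl (Function.update_self 2 0 w)
    (by simp [labelsBelow]) rfl (by simp only [Finset.range_zero, Finset.sum_empty]; omega)
  exact ⟨a, _, l4.trans hl, ha⟩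

theorem exists_anchor (R : RepMatrix m n) : ∃ N ≤ coreCard R, ∀ s, Reachable R prog s →
    ∃ a t, Leads R s a t ∧ Anchor R N ((peelDepth R + 3) * (inputSize R * 61) + 4) a := by
  obtain ⟨N, hN, h⟩ := exists_anchor_start R
  exact ⟨N, hN, fun s hs => leads_of_reachable h (fun a ha => ha.after_draw) hs⟩

theorem Leads.eq_of_not_quiet {s a : Config m n} {t : ℕ} (h : Leads R s a t) (hs : ¬ Quiet s) :
    s = a := by
  rcases t with _ | t
  · exact h.2
  · exact absurd (h.1 0 (Nat.succ_pos t)) hs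

/-- A configuration that draws or has halted is not quiet, so it coincides with the anchor it leads
to, and the description of anchors applies. -/
theorem implements_prog : Implements prog where
  draws m n R s hs e rest he := by
    obtain ⟨N, -, h⟩ := exists_anchor R
    obtain ⟨a, t, hl, ha⟩ := h s hs
    obtain rfl := hl.eq_of_not_quiet fun hq => hq.2 ⟨e, rest, he⟩
    obtain ⟨hp, ⟨j, hj⟩ | ⟨hd, -, hL | ⟨h0, -⟩⟩⟩ := ha
    · obtain rfl : Expr.var 2 = e := by
        have := hj.stack.symm.trans he
        simp only [List.cons.injEq, Cmd.draw.injEq] at this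
        exact this.1
      have hev : s.eval R (.var 2) = j := hj.two
      exact ⟨hev ▸ hj.lt, Or.inl (by rw [hj.drawn]; simp [labelsBelow, hev])⟩
    · obtain rfl : Expr.get 2 (.var 6) = e := by
        have := hL.stack.symm.trans he
        simp only [List.cons.injEq, Cmd.draw.injEq] at this
        exact this.1
      have hev : s.eval R (.get 2 (.var 6)) = s.arrs 2 (pos R s.matching s.arrs N) :=
        congrArg (s.arrs 2) hL.six
      obtain ⟨h1, -⟩ | ⟨-, hlt, hst, hσ⟩ := pos_spec hp.matching hp.covers
      · exact absurd h1 hL.lt.ne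
      simp only [hev]
      exact ⟨hlt, Or.inr ⟨hd, hst, hσ⟩⟩
    · rw [h0] at he
      cases he
  halts m n R s hs h0 := by
    obtain ⟨N, -, h⟩ := exists_anchor R
    obtain ⟨a, t, hl, ha⟩ := h s hs
    obtain rfl := hl.eq_of_not_quiet fun hq => hq.1 h0
    obtain ⟨hp, ⟨j, hj⟩ | ⟨hd, -, hL | ⟨-, hc⟩⟩⟩ := ha
    · rw [hj.stack] at h0; cases h0
    · rw [hL.stack] at h0; cases h0
    · exact ⟨hd, hc⟩
  progress m n R s hs := by
    obtain ⟨N, -, h⟩ := exists_anchor R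
    obtain ⟨a, t, hl, ha⟩ := h s hs
    refine ⟨t, a, ?_, ha.after_draw.imp id fun ⟨e, rest, he, _⟩ => ⟨e, rest, he⟩⟩
    rw [runFrom_eq_pure_iterate fun i hi => (hl.1 i hi).2, hl.2]
    simp

/-- A bound for the time that the program takes with at most `K` rounds. -/
def progTime (R : RepMatrix m n) (K : ℕ) : ℕ :=
  inputSize R * ((peelDepth R + 3) * 61 + (K + 1) * (∑ N ∈ Finset.range (coreCard R + 1), tPos N) +
    (K + 1) * 14)

/-- Summing `tPos` over all sizes up to that of the core gives a bound that is monotone in the size,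
whether or not `tPos` is. -/
theorem time_le_progTime {N K r : ℕ} (hN : N ≤ coreCard R) (hr : r ≤ K) :
    initTime R N ((peelDepth R + 3) * (inputSize R * 61) + 4) + r * roundTime R N ≤
      progTime R K := by
  have h1 : tPos N ≤ ∑ N ∈ Finset.range (coreCard R + 1), tPos N :=
    Finset.single_le_sum (f := tPos) (fun _ _ => Nat.zero_le _) (Finset.mem_range.2 (by omega))
  have h2 : m * 4 + totalSize R + 10 ≤ inputSize R * 14 := by unfold inputSize; omega
  have h3 : totalSize R + 5 ≤ inputSize R * 14 := by unfold inputSize; omega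
  have h4 := Nat.mul_le_mul_right (totalSize R + inputSize R * tPos N + 5) hr
  have h5 := Nat.mul_le_mul_left K h3
  have h6 := Nat.mul_le_mul_left ((K + 1) * inputSize R) h1
  unfold initTime roundTime progTime
  nlinarith

theorem anchor_time {N K : ℕ} (hN : N ≤ coreCard R) {s : Config m n}
    (h : Anchor R N ((peelDepth R + 3) * (inputSize R * 61) + 4) s) (hK : s.rounds ≤ K) :
    s.time ≤ progTime R K := by
  refine le_trans ?_ (time_le_progTime hN hK)
  obtain ⟨-, ⟨j, hj⟩ | ⟨-, ht, -⟩⟩ := h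
  · have h1 := hj.time
    have h2 : ∑ i ∈ Finset.range j, (tsize R i + 4) ≤ ∑ i ∈ Finset.range m, (tsize R i + 4) :=
      Finset.sum_le_sum_of_subset (Finset.range_subset_range.2 hj.lt.le)
    rw [sum_tsize_add_four] at h2
    unfold initTime
    omega
  · exact ht

/-- Each step before the halt costs at least one unit, so a bound on the time forces a halt. -/
theorem halted_or_le_time {P : Cmd} {s : Config m n} {t : ℕ} (hs : s ∈ (run R P t).support) :
    s.stack = [] ∨ t ≤ s.time := by
  induction t generalizing s with
  | zero => exact Or.inr (Nat.zero_le _)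
  | succ t ih =>
    rw [run, runFrom, PMF.mem_support_bind_iff] at hs
    obtain ⟨s', hs', hstep⟩ := hs
    by_cases h0 : s'.stack = []
    · rw [step_halted h0] at hstep
      obtain rfl : s = s' := by simpa using hstep
      exact Or.inl h0
    have ht := (ih hs').resolve_left h0
    refine Or.inr ?_
    by_cases hd : AtDraw s'
    · obtain ⟨e, rest, he⟩ := hd
      unfold step at hstep
      simp only [he] at hstep
      split_ifs at hstep with hlt
      · rw [PMF.mem_support_map_iff] at hstep
        obtain ⟨N, -, rfl⟩ := hstep
        change t + 1 ≤ s'.time + _ + 1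
        omega
      · obtain rfl : s = _ := by simpa using hstep
        change t + 1 ≤ s'.time + 1
        omega
    · rw [step_eq_pure_next hd] at hstep
      obtain rfl : s = next R s' := by simpa using hstep
      rw [(Leads.single (R := R) ⟨h0, hd⟩).fields.2]
      omega

/-- With at most `K` rounds so far, the time is at most that of the next anchor, hence at most
`progTime R K` and less than the number `T` of steps; so the machine has halted. -/
theorem one_le_haltProb_add (hR : ∀ l, ¬ BadPath (incGraph R) l) {K T : ℕ} (hT : progTime R K < T) :
    1 ≤ haltProb R prog T + 2 ^ (coreCard R + 1) / ((K + 1 : ℕ) : ℝ≥0∞) := by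
  obtain ⟨N, hN, hanc⟩ := exists_anchor R
  refine (one_le_toOuterMeasure_add (run R prog T) (A := {s | s.stack = [] ∧ s.time ≤ T})
    (B := {s | K + 1 ≤ s.rounds}) fun s hs => ?_).trans (add_le_add le_rfl ?_)
  · by_cases hK : s.rounds ≤ K
    · left
      obtain ⟨a, t, hl, ha⟩ := hanc s ⟨T, hs⟩
      obtain ⟨h1, h2⟩ := hl.fields
      have h3 := anchor_time hN ha (h1.le.trans hK)
      rcases halted_or_le_time hs with h0 | h0
      · exact ⟨h0, by omega⟩
      · omega
    · right
      change K + 1 ≤ s.rounds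
      omega
  · rw [ENNReal.le_div_iff_mul_le (Or.inl (by simp)) (Or.inl (by simp)), mul_comm]
    exact implements_prog.rounds_tail hR T (K + 1)

end Anchors

/-! ### The asymptotic bounds -/

section Asymptotics

theorem ofReal_one_sub_le {ε : ℝ} (hε : 0 < ε) {x y : ℝ≥0∞} (h : 1 ≤ x + y)
    (hy : y ≤ ENNReal.ofReal ε) : ENNReal.ofReal (1 - ε) ≤ x := by
  rw [ENNReal.ofReal_sub 1 hε.le, ENNReal.ofReal_one, tsub_le_iff_right]
  exact h.trans (add_le_add le_rfl hy)

theorem exists_two_pow_div_le (B : ℕ) {ε : ℝ} (hε : 0 < ε) :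
    ∃ K : ℕ, ∀ K' ≥ K, ∀ b ≤ B,
      (2 : ℝ≥0∞) ^ (b + 1) / ((K' + 1 : ℕ) : ℝ≥0∞) ≤ ENNReal.ofReal ε := by
  obtain ⟨K, hK⟩ := exists_nat_gt ((2 : ℝ) ^ (B + 1) / ε)
  refine ⟨K, fun K' hK' b hb => ENNReal.div_le_of_le_mul ?_⟩
  rw [div_lt_iff₀ hε] at hK
  have h1 : (2 : ℝ) ^ (b + 1) ≤ 2 ^ (B + 1) := pow_le_pow_right₀ (by norm_num) (by omega)
  have h2 : (K : ℝ) * ε ≤ ((K' + 1 : ℕ) : ℝ) * ε := by gcongr; omega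
  calc (2 : ℝ≥0∞) ^ (b + 1) = ENNReal.ofReal ((2 : ℝ) ^ (b + 1)) := by
        rw [ENNReal.ofReal_pow (by norm_num)]; simp
    _ ≤ ENNReal.ofReal (ε * ((K' + 1 : ℕ) : ℝ)) := ENNReal.ofReal_le_ofReal (by linarith)
    _ = _ := by rw [ENNReal.ofReal_mul hε.le, ENNReal.ofReal_natCast]

theorem tendsto_log_natCast : Tendsto (fun n : ℕ => Real.log n) atTop atTop :=
  Real.tendsto_log_atTop.comp tendsto_natCast_atTop_atTop

/-- For bounded cores a number `K` of rounds that depends on `B` and ε is enough, and log n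
eventually exceeds it. -/
theorem Implements.tendsto_haltRoundsProb {P : Cmd} (hP : Implements P) {c : ℝ} (h0 : 0 < c)
    (h1 : c < 1) {ε : ℝ} (hε : 0 < ε) :
    Tendsto (fun n : ℕ => matrixLaw n n (c / n) {R | terminationProb R P = 1 ∧
      ENNReal.ofReal (1 - ε) ≤ haltRoundsProb R P ⌊Real.log n⌋₊}) atTop (𝓝 1) := by
  refine tendsto_matrixLaw_of_typical h0 h1 _ fun B => ?_
  obtain ⟨K, hK⟩ := exists_two_pow_div_le B hε
  filter_upwards [tendsto_log_natCast.eventually_ge_atTop (K : ℝ)] with n hn R hR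
  refine ⟨hP.terminationProb_eq_one hR.noBad, ?_⟩
  exact ofReal_one_sub_le hε (hP.one_le_haltRoundsProb_add hR.noBad _).1
    (hK _ (Nat.le_floor hn) _ hR.coreCard_le)

/-- By `hlog`, everything that depends on `B` and `K` is below one multiple of log n, so the leading
constant depends on `a` only. -/
theorem progTime_lt {n B K : ℕ} {R : RepMatrix n n} {a : ℝ} (ha : 0 ≤ a)
    (hR : Typical R B (a * Real.log n)) (hn : 3 ≤ n)
    (hlog : ((244 + (K + 1) * (∑ N ∈ Finset.range (B + 1), tPos N) + (K + 1) * 14 : ℕ) : ℝ) ≤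
      Real.log n) :
    progTime R K < ⌊(3 * (61 * a + 1) + 1) * ((n + totalSize R : ℝ) * Real.log n)⌋₊ := by
  set L := Real.log n with hL
  set D : ℕ := (K + 1) * (∑ N ∈ Finset.range (B + 1), tPos N) + (K + 1) * 14 with hD
  have hn' : (3 : ℝ) ≤ n := by exact_mod_cast hn
  have hD0 : (0 : ℝ) ≤ D := by positivity
  have hlog' : 244 + (D : ℝ) ≤ L := by
    refine le_trans (le_of_eq ?_) hlog
    rw [hD]; push_cast; ring
  have hpd := peelDepth_le hR.length_le (by positivity)
  have h1 : (progTime R K : ℝ) ≤ (inputSize R : ℝ) * (((peelDepth R : ℝ) + 3) * 61 + D) := by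
    have hle : progTime R K ≤ inputSize R * ((peelDepth R + 3) * 61 + D) := by
      unfold progTime
      rw [add_assoc]
      refine Nat.mul_le_mul_left _ (Nat.add_le_add_left (Nat.add_le_add_right
        (Nat.mul_le_mul_left _ ?_) _) _)
      refine Finset.sum_le_sum_of_subset (Finset.range_subset_range.2 ?_)
      have := hR.coreCard_le
      omega
    exact_mod_cast hle
  -- The peeling depth is at most a·L + 1, and 244 = 61·4 collects the constants.
  have h2 : ((peelDepth R : ℝ) + 3) * 61 + D ≤ (61 * a + 1) * L := by nlinarith
  set S : ℝ := (totalSize R : ℝ) with hS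
  have hS0 : 0 ≤ S := by positivity
  have h3 : (inputSize R : ℝ) ≤ 3 * (n + S) := by
    have : (inputSize R : ℝ) = n + n + S + 1 := by rw [inputSize]; push_cast; rfl
    rw [this]; linarith
  have h4 : (inputSize R : ℝ) * (((peelDepth R : ℝ) + 3) * 61 + D) ≤
      3 * (n + S) * ((61 * a + 1) * L) := by gcongr
  -- The last summand 1 of the constant makes room for the strict inequality after rounding down.
  have h5 : 1 ≤ (n + S) * L := by nlinarith
  refine Nat.lt_of_succ_le (Nat.le_floor ?_)
  push_cast
  linarith

/-- `C` comes from the path length bound alone, so it is fixed before ε, the bound `B` for the core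
and the number `K` of rounds; these affect only how large n has to be. -/
theorem tendsto_haltProb_prog {c : ℝ} (h0 : 0 < c) (h1 : c < 1) :
    ∃ C : ℝ, 0 < C ∧ ∀ ε : ℝ, 0 < ε →
      Tendsto (fun n : ℕ => matrixLaw n n (c / n) {R | terminationProb R prog = 1 ∧
        ENNReal.ofReal (1 - ε) ≤
          haltProb R prog ⌊C * ((n + totalSize R : ℝ) * Real.log n)⌋₊}) atTop (𝓝 1) := by
  have ha : 0 < 2 / Real.log c⁻¹ := div_pos two_pos (Real.log_pos ((one_lt_inv₀ h0).2 h1))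
  refine ⟨3 * (61 * (2 / Real.log c⁻¹) + 1) + 1, by positivity, fun ε hε => ?_⟩
  refine tendsto_matrixLaw_of_typical h0 h1 _ fun B => ?_
  obtain ⟨K, hK⟩ := exists_two_pow_div_le B hε
  filter_upwards [tendsto_log_natCast.eventually_ge_atTop _, eventually_ge_atTop 3]
    with n hlog hn R hR
  refine ⟨implements_prog.terminationProb_eq_one hR.noBad, ?_⟩
  exact ofReal_one_sub_le hε (one_le_haltProb_add hR.noBad (progTime_lt ha.le hR hn hlog))
    (hK K le_rfl _ hR.coreCard_le)

end Asymptotics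

end WeakBip

end

theorem mainTheorem5 :
    (∀ P : WeakBip.Cmd, WeakBip.Implements P → ∀ c : ℝ, 0 < c → c < 1 → ∀ ε : ℝ, 0 < ε →
      Tendsto
        (fun n : ℕ => WeakBip.matrixLaw n n (c / n)
          {R | WeakBip.terminationProb R P = 1 ∧
            ENNReal.ofReal (1 - ε) ≤ WeakBip.haltRoundsProb R P ⌊Real.log n⌋₊})
        atTop (𝓝 1)) ∧
    ∃ P : WeakBip.Cmd, WeakBip.Implements P ∧ ∀ c : ℝ, 0 < c → c < 1 →
      ∃ C : ℝ, 0 < C ∧ ∀ ε : ℝ, 0 < ε →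
        Tendsto
          (fun n : ℕ => WeakBip.matrixLaw n n (c / n)
            {R | WeakBip.terminationProb R P = 1 ∧
              ENNReal.ofReal (1 - ε) ≤
                WeakBip.haltProb R P ⌊C * ((n + WeakBip.totalSize R : ℝ) * Real.log n)⌋₊})
          atTop (𝓝 1) :=
  ⟨fun _ hP _ h0 h1 _ hε => hP.tendsto_haltRoundsProb h0 h1 hε,
    WeakBip.prog, WeakBip.implements_prog, fun _ h0 h1 => WeakBip.tendsto_haltProb_prog h0 h1⟩
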